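/- **Setting.** Let $X\subset\mathbb R^2\cong\mathbb C$ be a set of sites of bounded density (there is $N$ such that every closed disk of radius $1$ contains at most $N$ sites), each carrying $m$ internal states, and let $H=\ell^2(X)\otimes\mathbb C^m$ with its standard orthonormal basis. Let $P$ be an orthogonal projection on $H$ whose matrix elements decay exponentially, $|P_{\mathbf x,\mathbf y}|\le C_1e^{-C_2|\mathbf x-\mathbf y|}$ with $C_1,C_2>0$, and which commutes with an on-site time reversal, that is, with an antiunitary $\Theta$ of the form $(\Theta\psi)(\mathbf x)=T_{\mathbf x}\overline{\psi(\mathbf x)}$, $T_{\mathbf x}$ unitary $m\times m$ matrices, with $\Theta^2=-1$. **Half-flux insertion.** For a point $p$ of the plane, inserting a half-flux at $p$ replaces $P$ by $Q$ with $Q_{\mathbf x,\mathbf y}=s_{\mathbf x,\mathbf y}P_{\mathbf x,\mathbf y}$, where $s$ is one of the following. * *Geometric construction:* any phases with $|s_{\mathbf x,\mathbf y}|=1$, $s_{\mathbf x,\mathbf x}=1$, $s_{\mathbf y,\mathbf x}=\overline{s_{\mathbf x,\mathbf y}}$, such that along each closed polygon $\mathbf x_1,\dots,\mathbf x_n,\mathbf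 x_{n+1}=\mathbf x_1$ of sites that does not pass through $p$ the product $\prod_i s_{\mathbf x_i,\mathbf x_{i+1}}$ is $(-1)^w$, $w$ being the winding number of the polygon around $p$ (so it is $-1$ if a simple loop encloses $p$ and $1$ if it does not); for a polygon that passes through $p$ the product may be either $1$ or $-1$. * *Topological construction:* the plane is divided into three sectors by three distinct rays from $p$ (a site on a ray may be assigned to either adjacent sector), and $s_{\mathbf x,\mathbf y}=1$ if $\mathbf x,\mathbf y$ belong to the same sector, $s_{\mathbf x,\mathbf y}=-1$ otherwise. For $\mu\in(0,1)$ let $\overline Q=\mathbf 1_{(\mu,\infty)}(Q)$ be the spectral flattening of $Q$ at the chemical potential $\mu$ (for instance $\mu=\tfrac12$), and let $\operatorname{tr}^v(Q)=\operatorname{Tr}(Q-\overline Q)$. **Claim.** There is an element $\nu\in\mathbb Z_2$, determined by $P$ alone, such that for every point $p$, every $s$ as above and every $\mu\in(0,1)$: the matrix $(s_{\mathbf x,\mathbf y}P_{\mathbf x,\mathbf y})$ defines a bounded self-adjoint operator $Q$; the step function $\mathbf 1_{(\mu,\infty)}$ is continuous on the spectrum of $Q$; the operator $Q-\overline Q$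 is trace class; and $\operatorname{tr}^v(Q)$ is an integer with $\operatorname{tr}^v(Q)\equiv\nu \pmod 2$. In particular $\operatorname{tr}^v(Q)\bmod 2$ does not depend on the position $p$ of the flux. -/

import Mathlib

open scoped ComplexConjugate

namespace HalfFlux

/-- `X` is the set of sites, points of the plane (identified with `ℂ`), of bounded
density: the number of sites in a disk of radius `1` is bounded. -/
def BoundedDensity (X : Set ℂ) : Prop :=
  ∃ N : ℕ, ∀ z : ℂ, (X ∩ Metric.closedBall z 1).encard ≤ N

/- `H` is the one-particle Hilbert space and `b` its site basis: the vectors `b (x, a)` with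
`a : Fin m` are the `m` internal states at the site `x`. -/
variable {X : Set ℂ} {m : ℕ} {H : Type*} [NormedAddCommGroup H] [InnerProductSpace ℂ H]
  (b : HilbertBasis (X × Fin m) ℂ H)

/-- Matrix element `A_{i,j} = ⟨b_i, A b_j⟩`. -/
noncomputable def entry (A : H →L[ℂ] H) (i j : X × Fin m) : ℂ := inner ℂ (b i) (A (b j))

/-- The block `A_{x,y}`, an `m × m` matrix. -/
noncomputable def block (A : H →L[ℂ] H) (x y : X) : Matrix (Fin m) (Fin m) ℂ :=
  Matrix.of fun k l => entry b A (x, k) (y, l)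

/-- Exponential decay of the matrix elements: `|A_{x,y}| ≤ C₁ exp (-C₂ |x - y|)`. -/
def ExpDecay (A : H →L[ℂ] H) : Prop :=
  ∃ C₁ C₂ : ℝ, 0 < C₁ ∧ 0 < C₂ ∧ ∀ i j : X × Fin m,
    ‖entry b A i j‖ ≤ C₁ * Real.exp (-C₂ * ‖(i.1 : ℂ) - (j.1 : ℂ)‖)

/-- `T` describes an on-site antiunitary `(Θ ψ)(x) = T_x · conj (ψ(x))` with `Θ² = -1`. -/
def IsTimeReversal (T : X → Matrix (Fin m) (Fin m) ℂ) : Prop :=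
  ∀ x, T x ∈ Matrix.unitaryGroup (Fin m) ℂ ∧ T x * (T x).map conj = -1

/-- `A` commutes with the time reversal `(Θ ψ)(x) = T_x · conj (ψ(x))`, written blockwise. -/
def TimeReversalSymmetric (T : X → Matrix (Fin m) (Fin m) ℂ) (A : H →L[ℂ] H) :
    Prop :=
  ∀ x y, T x * (block b A x y).map conj = block b A x y * T y

/-- Phases `s_{x,y}` describing a half flux at the point `p`, as in the Peierls substitution.
A loop is a closed polygon `x 0, x 1, …, x n, x 0` of sites (the index addition in `Fin (n + 1)`
is cyclic). If it does not pass through `p`, the sum of the angles under which its edges are seen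
from `p` is `2 π k`, with `k` the winding number around `p`, and the product of the phases along
it has to be `(-1) ^ k`: it is `-1` if `p` is in the loop and `1` otherwise. For a loop which
passes through `p` either of the two signs is allowed. -/
structure IsHalfFluxPhase (p : ℂ) (s : X → X → ℂ) : Prop where
  norm_eq_one : ∀ x y, ‖s x y‖ = 1
  self_eq_one : ∀ x, s x x = 1
  symm : ∀ x y, s y x = conj (s x y)
  loop : ∀ (n : ℕ) (x : Fin (n + 1) → X),
    (∀ i, p ∉ segment ℝ (x i : ℂ) (x (i + 1) : ℂ)) →
    ∀ k : ℤ,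
      (∑ i, Complex.arg (((x (i + 1) : ℂ) - p) / ((x i : ℂ) - p)) = 2 * Real.pi * k) →
      ∏ i, s (x i) (x (i + 1)) = (-1) ^ k
  loop_through : ∀ (n : ℕ) (x : Fin (n + 1) → X),
    ∏ i, s (x i) (x (i + 1)) = 1 ∨ ∏ i, s (x i) (x (i + 1)) = -1

/-- `c` assigns the sites to the three sectors into which the plane is divided by the rays from
`p` at the angles `θ₀ < θ₁ < θ₂ < θ₀ + 2π`; a site on a ray may be assigned to either of the two
neighbouring sectors. -/
def IsSectorPartition (p : ℂ) (θ₀ θ₁ θ₂ : ℝ) (c : X → Fin 3) : Prop :=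
  θ₀ < θ₁ ∧ θ₁ < θ₂ ∧ θ₂ < θ₀ + 2 * Real.pi ∧
  ∀ x : X, ∃ r t : ℝ, 0 ≤ r ∧ (x : ℂ) = p + r * Complex.exp (t * Complex.I) ∧
    ((c x = 0 ∧ t ∈ Set.Icc θ₀ θ₁) ∨ (c x = 1 ∧ t ∈ Set.Icc θ₁ θ₂) ∨
      (c x = 2 ∧ t ∈ Set.Icc θ₂ (θ₀ + 2 * Real.pi)))

/-- The signs of the topological construction: for a partition of the plane into three sectors
meeting at `p`, diagonal blocks are kept and off-diagonal blocks change sign. -/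
def IsTopologicalSign (p : ℂ) (s : X → X → ℂ) : Prop :=
  ∃ (θ₀ θ₁ θ₂ : ℝ) (c : X → Fin 3), IsSectorPartition p θ₀ θ₁ θ₂ c ∧
    ∀ x y, s x y = if c x = c y then 1 else -1

/-- `Q_{x,y} = s_{x,y} P_{x,y}`. -/
def IsPeierls (s : X → X → ℂ) (P Q : H →L[ℂ] H) : Prop :=
  ∀ i j : X × Fin m, entry b Q i j = s i.1 j.1 * entry b P i j

/-- The step function: `0` on `(-∞, μ]` and `1` on `(μ, ∞)`. -/
noncomputable def step (μ t : ℝ) : ℝ := if t ≤ μ then 0 else 1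

/-- The spectral flattening of `Q` at the chemical potential `μ`, by continuous functional calculus
(meaningful when `Q` is self-adjoint and the step function is continuous on the spectrum). -/
noncomputable def flatten [CompleteSpace H] (μ : ℝ) (Q : H →L[ℂ] H) : H →L[ℂ] H :=
  cfc (step μ) Q

/-- Trace class operators: absolutely convergent sums of operators of rank at most one. -/
def IsTraceClass (A : H →L[ℂ] H) : Prop :=
  ∃ u v : ℕ → H, Summable (fun n => ‖u n‖ * ‖v n‖) ∧
    ∀ ψ, HasSum (fun n => inner ℂ (u n) ψ • v n) (A ψ)

/-- The trace (of a trace class operator), in the site basis. -/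
noncomputable def trace (A : H →L[ℂ] H) : ℂ := ∑' i, entry b A i i

/-- The trace over vertex states `tr^v(Q) = Tr (Q - Q̄)`, with `Q̄` flattened at `μ`. -/
noncomputable def vertexTrace [CompleteSpace H] (μ : ℝ) (Q : H →L[ℂ] H) : ℂ :=
  trace b (Q - flatten μ Q)

end HalfFlux

/-! Away from p the phases are a gauge transformation, so near a distant site x the operator Q looks
like P. Since P = P², the row of Q - Q² at x is exponentially small in the distance of x from p.
Hence Q - Q² is trace class, the spectrum of Q can accumulate only at 0 and 1, and Q - Q̄ = (Q - Q²)
g(Q) with g continuous on the spectrum (`sub_flatten_eq`). This estimate is made for signs built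
from half angles; all other half fluxes inherit the conclusion by comparison.

Parity. A gauge transformation leaves the vertex trace unchanged, and after a suitable one any two
half fluxes differ by a trace class operator with zero diagonal. Their vertex traces then differ by
Tr (E - F) for two projections commuting with Θ. This number is even (`trace_sub_projection_even`):
(E - F)² commutes with E and F; on a finite rank spectral subspace containing its eigenvalues near 1
the two projections have even rank by Kramers degeneracy, and the complement contributes 0. A change
of μ is covered by the same argument.

Integrality. Put half fluxes at 0 and at n. The pair is asymptotically trivial, so comparison with
P, whose vertex trace is 0, shows that its vertex trace is even. For large n it is also nearly the
sum of the vertex traces of the two single fluxes, which differ by an even integer. So twice the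
vertex trace of one flux is arbitrarily close to even integers, and the vertex trace is an integer
(`exists_int_vertexTrace`). Additivity is proved for polynomials vanishing at 0 and 1 and carried
over to the step function at a chemical potential in a gap common to the three operators; the width
of the gap is bounded below independently of n because the trace norm of Q - Q² is bounded
uniformly. -/

namespace HalfFlux

/-! ### Trace class operators and the trace -/

section Trace

variable {H : Type*} [NormedAddCommGroup H] [InnerProductSpace ℂ H]

/-- The trace norm of `A` is at most `M`. -/
def HasTraceBound (A : H →L[ℂ] H) (M : ℝ) : Prop :=
  ∃ u v : ℕ → H, Summable (fun n => ‖u n‖ * ‖v n‖) ∧ ∑' n, ‖u n‖ * ‖v n‖ ≤ M ∧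
    ∀ ψ, HasSum (fun n => inner ℂ (u n) ψ • v n) (A ψ)

theorem HasTraceBound.isTraceClass {A : H →L[ℂ] H} {M : ℝ} (h : HasTraceBound A M) :
    IsTraceClass A := by
  obtain ⟨u, v, h1, -, h2⟩ := h
  exact ⟨u, v, h1, h2⟩

theorem IsTraceClass.exists_hasTraceBound {A : H →L[ℂ] H} (h : IsTraceClass A) :
    ∃ M, HasTraceBound A M := by
  obtain ⟨u, v, h1, h2⟩ := h
  exact ⟨_, u, v, h1, le_rfl, h2⟩

/-- Extension by zero along an injection into ℕ; sums and products can then serve as index types. -/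
theorem hasTraceBound_of_countable {κ : Type*} [Countable κ] {A : H →L[ℂ] H} {M : ℝ}
    (u v : κ → H) (h1 : Summable (fun n => ‖u n‖ * ‖v n‖)) (h2 : ∑' n, ‖u n‖ * ‖v n‖ ≤ M)
    (h3 : ∀ ψ, HasSum (fun n => inner ℂ (u n) ψ • v n) (A ψ)) : HasTraceBound A M := by
  obtain ⟨e, he⟩ := exists_injective_nat κ
  have key : (fun n => ‖Function.extend e u 0 n‖ * ‖Function.extend e v 0 n‖)
      = Function.extend e (fun k => ‖u k‖ * ‖v k‖) 0 := by
    funext n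
    by_cases hn : ∃ k, e k = n
    · obtain ⟨k, rfl⟩ := hn
      simp [he.extend_apply]
    · simp [Function.extend_apply' _ _ _ hn]
  refine ⟨Function.extend e u 0, Function.extend e v 0, ?_, ?_, fun ψ => ?_⟩
  · rw [key]; exact (summable_extend_zero he).2 h1
  · rw [key]; exact (tsum_extend_zero he _).trans_le h2
  · have : (fun n => inner ℂ (Function.extend e u 0 n) ψ • Function.extend e v 0 n)
        = Function.extend e (fun k => inner ℂ (u k) ψ • v k) 0 := by
      funext n
      by_cases hn : ∃ k, e k = n
      · obtain ⟨k, rfl⟩ := hn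
        simp [he.extend_apply]
      · simp [Function.extend_apply' _ _ _ hn]
    rw [this]
    exact (hasSum_extend_zero he).2 (h3 ψ)

theorem HasTraceBound.add {A B : H →L[ℂ] H} {M N : ℝ} (hA : HasTraceBound A M)
    (hB : HasTraceBound B N) : HasTraceBound (A + B) (M + N) := by
  obtain ⟨u, v, h1, h2, h3⟩ := hA
  obtain ⟨u', v', h1', h2', h3'⟩ := hB
  have hs : HasSum (fun n => ‖Sum.elim u u' n‖ * ‖Sum.elim v v' n‖)
      (∑' n, ‖u n‖ * ‖v n‖ + ∑' n, ‖u' n‖ * ‖v' n‖) :=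
    HasSum.sum h1.hasSum h1'.hasSum
  refine hasTraceBound_of_countable (Sum.elim u u') (Sum.elim v v') hs.summable ?_ fun ψ => ?_
  · rw [hs.tsum_eq]; exact add_le_add h2 h2'
  · exact HasSum.sum (f := fun n => inner ℂ (Sum.elim u u' n) ψ • Sum.elim v v' n) (h3 ψ) (h3' ψ)

theorem HasTraceBound.mul_left {A : H →L[ℂ] H} {M : ℝ} (hA : HasTraceBound A M)
    (B : H →L[ℂ] H) : HasTraceBound (B * A) (‖B‖ * M) := by
  obtain ⟨u, v, h1, h2, h3⟩ := hA
  have hle : ∀ n, ‖u n‖ * ‖B (v n)‖ ≤ ‖B‖ * (‖u n‖ * ‖v n‖) := fun n => by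
    rw [mul_left_comm]
    exact mul_le_mul_of_nonneg_left (B.le_opNorm _) (norm_nonneg _)
  have hs : Summable fun n => ‖u n‖ * ‖B (v n)‖ :=
    (h1.mul_left ‖B‖).of_nonneg_of_le (fun n => by positivity) hle
  refine ⟨u, fun n => B (v n), hs, ?_, fun ψ => ?_⟩
  · refine (hs.tsum_le_tsum hle (h1.mul_left _)).trans ?_
    rw [tsum_mul_left]
    exact mul_le_mul_of_nonneg_left h2 (norm_nonneg _)
  · simpa using B.hasSum (h3 ψ)

theorem HasTraceBound.mul_right [CompleteSpace H] {A : H →L[ℂ] H} {M : ℝ}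
    (hA : HasTraceBound A M) (B : H →L[ℂ] H) : HasTraceBound (A * B) (M * ‖B‖) := by
  obtain ⟨u, v, h1, h2, h3⟩ := hA
  have hle : ∀ n, ‖ContinuousLinearMap.adjoint B (u n)‖ * ‖v n‖ ≤ ‖B‖ * (‖u n‖ * ‖v n‖) :=
    fun n => by
      rw [← mul_assoc]
      refine mul_le_mul_of_nonneg_right ?_ (norm_nonneg _)
      simpa using (ContinuousLinearMap.adjoint B).le_opNorm (u n)
  have hs : Summable fun n => ‖ContinuousLinearMap.adjoint B (u n)‖ * ‖v n‖ :=
    (h1.mul_left ‖B‖).of_nonneg_of_le (fun n => by positivity) hle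
  refine ⟨fun n => ContinuousLinearMap.adjoint B (u n), v, hs, ?_, fun ψ => ?_⟩
  · refine (hs.tsum_le_tsum hle (h1.mul_left _)).trans ?_
    rw [tsum_mul_left, mul_comm]
    exact mul_le_mul_of_nonneg_right h2 (norm_nonneg _)
  · simpa [ContinuousLinearMap.adjoint_inner_left] using h3 (B ψ)

theorem IsTraceClass.add {A B : H →L[ℂ] H} (hA : IsTraceClass A) (hB : IsTraceClass B) :
    IsTraceClass (A + B) := by
  obtain ⟨M, hM⟩ := hA.exists_hasTraceBound
  obtain ⟨N, hN⟩ := hB.exists_hasTraceBound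
  exact (hM.add hN).isTraceClass

theorem IsTraceClass.mul_left {A : H →L[ℂ] H} (hA : IsTraceClass A) (B : H →L[ℂ] H) :
    IsTraceClass (B * A) := by
  obtain ⟨M, hM⟩ := hA.exists_hasTraceBound
  exact (hM.mul_left B).isTraceClass

theorem IsTraceClass.mul_right [CompleteSpace H] {A : H →L[ℂ] H} (hA : IsTraceClass A)
    (B : H →L[ℂ] H) : IsTraceClass (A * B) := by
  obtain ⟨M, hM⟩ := hA.exists_hasTraceBound
  exact (hM.mul_right B).isTraceClass

theorem IsTraceClass.neg {A : H →L[ℂ] H} (hA : IsTraceClass A) : IsTraceClass (-A) := by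
  simpa using hA.mul_left (-1)

theorem IsTraceClass.sub {A B : H →L[ℂ] H} (hA : IsTraceClass A) (hB : IsTraceClass B) :
    IsTraceClass (A - B) := by
  simpa [sub_eq_add_neg] using hA.add hB.neg

theorem isTraceClass_zero : IsTraceClass (0 : H →L[ℂ] H) :=
  ⟨0, 0, by simp, fun ψ => by simp⟩

theorem _root_.Orthonormal.sum_norm_inner_mul_norm_inner_le {κ : Type*} {e : κ → H}
    (he : Orthonormal ℂ e) (u v : H) (s : Finset κ) :
    ∑ i ∈ s, ‖inner ℂ u (e i)‖ * ‖inner ℂ (e i) v‖ ≤ ‖u‖ * ‖v‖ := by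
  refine (Real.sum_mul_le_sqrt_mul_sqrt s _ _).trans ?_
  refine mul_le_mul ?_ ?_ (Real.sqrt_nonneg _) (norm_nonneg _)
  · refine Real.sqrt_le_iff.2 ⟨norm_nonneg _, ?_⟩
    simpa only [norm_inner_symm] using he.sum_inner_products_le u (s := s)
  · exact Real.sqrt_le_iff.2 ⟨norm_nonneg _, he.sum_inner_products_le v⟩

/-- The orthonormal family is arbitrary, not the site basis: this is what turns a trace bound into a
bound on dimensions and on numbers of spectral points. -/
theorem HasTraceBound.sum_norm_inner_le {A : H →L[ℂ] H} {M : ℝ} (hA : HasTraceBound A M)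
    {κ : Type*} {e : κ → H} (he : Orthonormal ℂ e) (s : Finset κ) :
    ∑ i ∈ s, ‖inner ℂ (e i) (A (e i))‖ ≤ M := by
  obtain ⟨u, v, h1, h2, h3⟩ := hA
  have hsum : ∀ i, Summable fun n => ‖inner ℂ (u n) (e i)‖ * ‖inner ℂ (e i) (v n)‖ := fun i =>
    h1.of_nonneg_of_le (fun n => by positivity) fun n => by
      simpa using he.sum_norm_inner_mul_norm_inner_le (u n) (v n) {i}
  have hi : ∀ i, ‖inner ℂ (e i) (A (e i))‖
      ≤ ∑' n, ‖inner ℂ (u n) (e i)‖ * ‖inner ℂ (e i) (v n)‖ := fun i => by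
    have h := (innerSL ℂ (e i)).hasSum (h3 (e i))
    have hs : Summable fun n => ‖(innerSL ℂ (e i)) (inner ℂ (u n) (e i) • v n)‖ := by
      simpa [norm_mul, inner_smul_right] using hsum i
    have := norm_tsum_le_tsum_norm hs
    rw [h.tsum_eq] at this
    simpa [norm_mul, inner_smul_right] using this
  refine (Finset.sum_le_sum fun i _ => hi i).trans ?_
  rw [← Summable.tsum_finsetSum fun i _ => hsum i]
  refine le_trans (Summable.tsum_le_tsum (fun n => ?_) (summable_sum fun i _ => hsum i) h1) h2
  exact he.sum_norm_inner_mul_norm_inner_le (u n) (v n) s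

variable {X : Set ℂ} {m : ℕ} (b : HilbertBasis (X × Fin m) ℂ H)

/-- The double series ⟨u n, b i⟩⟨b i, v n⟩ converges absolutely by Cauchy–Schwarz and Bessel.
Summing over i first gives the right side by Parseval, summing over n first gives the diagonal of A.
-/
theorem hasSum_entry_diag {κ : Type*} {A : H →L[ℂ] H} {u v : κ → H}
    (h1 : Summable (fun n => ‖u n‖ * ‖v n‖))
    (h3 : ∀ ψ, HasSum (fun n => inner ℂ (u n) ψ • v n) (A ψ)) :
    HasSum (fun i => entry b A i i) (∑' n, inner ℂ (u n) (v n)) := by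
  have hn : ∀ n, Summable fun i => ‖inner ℂ (u n) (b i) * inner ℂ (b i) (v n)‖ := fun n =>
    summable_of_sum_le (fun i => norm_nonneg _) fun s => by
      simpa [norm_mul] using b.orthonormal.sum_norm_inner_mul_norm_inner_le (u n) (v n) s
  have hF : Summable fun q : κ × (X × Fin m) =>
      inner ℂ (u q.1) (b q.2) * inner ℂ (b q.2) (v q.1) := by
    refine Summable.of_norm ((summable_prod_of_nonneg fun _ => norm_nonneg _).2 ⟨hn, ?_⟩)
    refine h1.of_nonneg_of_le (fun n => tsum_nonneg fun i => norm_nonneg _) fun n => ?_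
    refine (hn n).tsum_le_of_sum_le fun s => ?_
    simpa [norm_mul] using b.orthonormal.sum_norm_inner_mul_norm_inner_le (u n) (v n) s
  have h4 := hF.hasSum.prod_fiberwise fun n => b.hasSum_inner_mul_inner (u n) (v n)
  have h5 := ((Equiv.prodComm _ _).hasSum_iff.2 hF.hasSum).prod_fiberwise
    (g := fun i => entry b A i i) fun i => by
      have := (innerSL ℂ (b i)).hasSum (h3 (b i))
      simpa [inner_smul_right, entry] using this
  rw [h4.tsum_eq]
  exact h5

theorem IsTraceClass.hasSum_trace {A : H →L[ℂ] H} (hA : IsTraceClass A) :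
    HasSum (fun i => entry b A i i) (trace b A) := by
  obtain ⟨u, v, h1, h3⟩ := hA
  exact (hasSum_entry_diag b h1 h3).summable.hasSum

theorem trace_eq_tsum {κ : Type*} {A : H →L[ℂ] H} {u v : κ → H}
    (h1 : Summable (fun n => ‖u n‖ * ‖v n‖))
    (h3 : ∀ ψ, HasSum (fun n => inner ℂ (u n) ψ • v n) (A ψ)) :
    trace b A = ∑' n, inner ℂ (u n) (v n) :=
  (hasSum_entry_diag b h1 h3).tsum_eq

theorem HasTraceBound.norm_trace_le {A : H →L[ℂ] H} {M : ℝ} (hA : HasTraceBound A M) :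
    ‖trace b A‖ ≤ M := by
  obtain ⟨u, v, h1, h2, h3⟩ := hA
  rw [trace_eq_tsum b h1 h3]
  have hle : ∀ n, ‖inner ℂ (u n) (v n)‖ ≤ ‖u n‖ * ‖v n‖ := fun n => norm_inner_le_norm _ _
  have hs := h1.of_nonneg_of_le (fun n => norm_nonneg _) hle
  exact (norm_tsum_le_tsum_norm hs).trans ((hs.tsum_le_tsum hle h1).trans h2)

theorem entry_add (A B : H →L[ℂ] H) (i j : X × Fin m) :
    entry b (A + B) i j = entry b A i j + entry b B i j := by
  simp [entry]

theorem entry_sub (A B : H →L[ℂ] H) (i j : X × Fin m) :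
    entry b (A - B) i j = entry b A i j - entry b B i j := by
  simp [entry]

theorem trace_add {A B : H →L[ℂ] H} (hA : IsTraceClass A) (hB : IsTraceClass B) :
    trace b (A + B) = trace b A + trace b B := by
  simpa [trace, entry_add] using ((hA.hasSum_trace b).add (hB.hasSum_trace b)).tsum_eq

theorem trace_sub {A B : H →L[ℂ] H} (hA : IsTraceClass A) (hB : IsTraceClass B) :
    trace b (A - B) = trace b A - trace b B := by
  simpa [trace, entry_sub] using ((hA.hasSum_trace b).sub (hB.hasSum_trace b)).tsum_eq

/-- Moving B to the left or to the right factor of each rank one term, both traces become the sum of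
⟨u n, B (v n)⟩. -/
theorem trace_mul_comm [CompleteSpace H] {A : H →L[ℂ] H} (hA : IsTraceClass A) (B : H →L[ℂ] H) :
    trace b (A * B) = trace b (B * A) := by
  obtain ⟨u, v, h1, h3⟩ := hA
  have hle : ∀ n, ‖ContinuousLinearMap.adjoint B (u n)‖ * ‖v n‖ ≤ ‖B‖ * (‖u n‖ * ‖v n‖) :=
    fun n => by
      rw [← mul_assoc]
      refine mul_le_mul_of_nonneg_right ?_ (norm_nonneg _)
      simpa using (ContinuousLinearMap.adjoint B).le_opNorm (u n)
  have hle' : ∀ n, ‖u n‖ * ‖B (v n)‖ ≤ ‖B‖ * (‖u n‖ * ‖v n‖) := fun n => by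
    rw [mul_left_comm]
    exact mul_le_mul_of_nonneg_left (B.le_opNorm _) (norm_nonneg _)
  rw [trace_eq_tsum b (u := fun n => ContinuousLinearMap.adjoint B (u n)) (v := v)
      ((h1.mul_left ‖B‖).of_nonneg_of_le (fun n => by positivity) hle)
      (fun ψ => by simpa [ContinuousLinearMap.adjoint_inner_left] using h3 (B ψ)),
    trace_eq_tsum b (u := u) (v := fun n => B (v n))
      ((h1.mul_left ‖B‖).of_nonneg_of_le (fun n => by positivity) hle')
      (fun ψ => by simpa using B.hasSum (h3 ψ))]
  simp [ContinuousLinearMap.adjoint_inner_left]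

theorem trace_neg (A : H →L[ℂ] H) : trace b (-A) = - trace b A := by
  simp [trace, entry, tsum_neg]

end Trace

/-! ### Spectrum and flattening when A - A² is trace class -/

section Spectral

variable {H : Type*} [NormedAddCommGroup H] [InnerProductSpace ℂ H] [CompleteSpace H]

/-- Approximate eigenvectors replace eigenvectors: tent functions with disjoint supports around the
points of F give nonzero orthogonal vectors in whose directions `cfc g A` has expectation at least c
/ 2. Half of c is given up so that the bound holds on a neighbourhood of each point. -/
theorem card_mul_le_of_hasTraceBound_cfc {A : H →L[ℂ] H} (hA : IsSelfAdjoint A) {g : ℝ → ℝ}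
    (hg : Continuous g) {M c : ℝ} (hM : HasTraceBound (cfc g A) M) (hc : 0 < c) (F : Finset ℝ)
    (hF : ∀ t ∈ F, t ∈ spectrum ℝ A ∧ c ≤ g t) : F.card * (c / 2) ≤ M := by
  -- The two requirements on the radius δ: g stays above c / 2 on each interval, and the intervals
  -- are disjoint.
  have h1 : ∀ t ∈ F, ∀ᶠ δ in nhdsWithin (0 : ℝ) (Set.Ioi 0),
      (∀ x, |x - t| < δ → c / 2 ≤ g x) ∧ ∀ s ∈ F, s ≠ t → 2 * δ ≤ |s - t| := by
    intro t ht
    refine Filter.Eventually.and ?_ ?_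
    · have : ∀ᶠ x in nhds t, c / 2 < g x :=
        hg.continuousAt.eventually_const_lt (by linarith [(hF t ht).2])
      obtain ⟨ε, hε, hx⟩ := Metric.eventually_nhds_iff.1 this
      filter_upwards [Ioo_mem_nhdsGT hε] with δ hδ x hxt
      exact (hx (by rw [Real.dist_eq]; exact hxt.trans hδ.2)).le
    · rw [Filter.eventually_all_finset]
      intro s _
      by_cases hst : s = t
      · exact Filter.Eventually.of_forall fun _ h => absurd hst h
      · have hpos : 0 < |s - t| / 2 := by
          have := abs_pos.2 (sub_ne_zero.2 hst)
          linarith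
        filter_upwards [Ioo_mem_nhdsGT hpos] with δ hδ _
        linarith [hδ.2]
  obtain ⟨δ, hδF, hδ⟩ := (((Filter.eventually_all_finset F).2 h1).and
    self_mem_nhdsWithin).exists
  have hδ : (0 : ℝ) < δ := hδ
  let φ : ℝ → ℝ → ℝ := fun t x => max 0 (1 - |x - t| / δ)
  have hφc : ∀ t, Continuous (φ t) := fun t => by fun_prop
  have hφ0 : ∀ t x, δ ≤ |x - t| → φ t x = 0 := fun t x h => by
    refine max_eq_left ?_
    have : 1 ≤ |x - t| / δ := (one_le_div hδ).2 h
    linarith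
  -- By spectral mapping 1 = φ t t lies in the spectrum of φ t (A), which therefore is not 0.
  have hne : ∀ t : F, ∃ w : H, cfc (φ t) A w ≠ 0 := by
    rintro ⟨t, ht⟩
    by_contra! h
    have h0 : cfc (φ t) A = 0 := ContinuousLinearMap.ext h
    have h2 := cfc_map_spectrum (R := ℝ) (φ t) A hA (hφc t).continuousOn
    rw [h0] at h2
    have h3 : (1 : ℝ) ∈ spectrum ℝ (0 : H →L[ℂ] H) := by
      rw [h2]
      exact ⟨t, (hF t ht).1, by simp [φ]⟩
    rcases subsingleton_or_nontrivial (H →L[ℂ] H) with hs | hs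
    · simp [spectrum.of_subsingleton] at h3
    · simp [spectrum.zero_eq] at h3
  choose w hw using hne
  let v : F → H := fun t => cfc (φ t) A (w t)
  have hsa : ∀ t, IsSelfAdjoint (cfc (φ t) A) := fun t => cfc_predicate _ _
  have hin : ∀ (t s : F) (x y : H) , inner ℂ (cfc (φ t) A x) (cfc (φ s) A y)
      = inner ℂ x (cfc (fun r => φ t r * φ s r) A y) := fun t s x y => by
    rw [cfc_mul (φ t) (φ s) A (hφc t).continuousOn (hφc s).continuousOn,
      mul_apply_eq_comp, ← ContinuousLinearMap.adjoint_inner_left (cfc (φ t) A),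
      ContinuousLinearMap.isSelfAdjoint_iff'.1 (hsa t)]
  have horth : Orthonormal ℂ fun t : F => ((‖v t‖ : ℂ)⁻¹) • v t := by
    refine ⟨fun t => by
      rw [norm_smul, norm_inv, Complex.norm_real, norm_norm, inv_mul_cancel₀ (norm_ne_zero_iff.2 (hw t))], fun t s hts => ?_⟩
    have : (fun r => φ t r * φ s r) = fun _ => 0 := by
      funext r
      by_cases h : δ ≤ |r - t|
      · simp [hφ0 _ _ h]
      · have h4 := (hδF s s.2).2 t t.2 (fun h => hts (Subtype.ext h))
        have h5 : δ ≤ |r - s| := by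
          have := abs_sub_le (t : ℝ) r s
          rw [abs_sub_comm (t : ℝ) r] at this
          linarith
        simp [hφ0 _ _ h5]
    simp [inner_smul_left, inner_smul_right, v, hin, this]
  have hlow : ∀ t : F, c / 2 ≤ ‖inner ℂ (((‖v t‖ : ℂ)⁻¹) • v t)
      (cfc g A (((‖v t‖ : ℂ)⁻¹) • v t))‖ := by
    intro t
    have hmono : cfc (fun r => c / 2 * (φ t r * φ t r)) A
        ≤ cfc (fun r => φ t r * (g r * φ t r)) A := by
      refine cfc_mono (fun r _ => ?_) (by have := hφc t; fun_prop) (by have := hφc t; fun_prop)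
      by_cases h : δ ≤ |r - t|
      · simp [hφ0 _ _ h]
      · have := (hδF t t.2).1 r (not_le.1 h)
        nlinarith [mul_self_nonneg (φ t r)]
    have h6 := ((ContinuousLinearMap.le_def _ _).1 hmono).re_inner_nonneg_right (w t)
    have e1 : cfc (fun r => c / 2 * (φ t r * φ t r)) A (w t)
        = ((c / 2 : ℝ) : ℂ) • cfc (φ t) A (v t) := by
      rw [cfc_const_mul (c / 2) (fun r => φ t r * φ t r) A
        (((hφc t).mul (hφc t)).continuousOn), cfc_mul (φ t) (φ t) A (hφc t).continuousOn
        (hφc t).continuousOn, RCLike.real_smul_eq_coe_smul (K := ℂ)]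
      rfl
    have e2 : cfc (fun r => φ t r * (g r * φ t r)) A (w t) = cfc (φ t) A (cfc g A (v t)) := by
      rw [cfc_mul (φ t) (fun r => g r * φ t r) A (hφc t).continuousOn
        ((hg.mul (hφc t)).continuousOn), cfc_mul g (φ t) A hg.continuousOn (hφc t).continuousOn]
      simp [v]
    have e3 : ∀ y, inner ℂ (w t) (cfc (φ t) A y) = inner ℂ (v t) y := fun y => by
      rw [← ContinuousLinearMap.adjoint_inner_left,
        ContinuousLinearMap.isSelfAdjoint_iff'.1 (hsa t)]
    have hv : 0 < ‖v t‖ := norm_pos_iff.2 (hw t)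
    rw [sub_apply, inner_sub_right, e1, e2, inner_smul_right, e3, e3,
      inner_self_eq_norm_sq_to_K] at h6
    have h7 : c / 2 * ‖v t‖ ^ 2 ≤ (inner ℂ (v t) (cfc g A (v t))).re := by
      have e4 : ((c / 2 : ℝ) : ℂ) * ((‖v t‖ : ℂ)) ^ 2 = ((c / 2 * ‖v t‖ ^ 2 : ℝ) : ℂ) := by
        push_cast; ring
      have h8 : 0 ≤ (inner ℂ (v t) (cfc g A (v t)) - ((c / 2 : ℝ) : ℂ) * ((‖v t‖ : ℂ)) ^ 2).re := h6
      rw [e4, Complex.sub_re, Complex.ofReal_re] at h8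
      linarith
    rw [map_smul, inner_smul_left, inner_smul_right, norm_mul, norm_mul]
    simp only [map_inv₀, Complex.conj_ofReal, norm_inv, Complex.norm_real, norm_norm]
    have h9 := h7.trans (Complex.re_le_norm _)
    rw [← mul_assoc, ← mul_inv, ← sq, inv_mul_eq_div, le_div_iff₀ (by positivity)]
    exact h9
  have := (Finset.sum_le_sum fun t _ => hlow t).trans (hM.sum_norm_inner_le horth Finset.univ)
  simpa using this

theorem finite_of_isTraceClass_cfc {A : H →L[ℂ] H} (hA : IsSelfAdjoint A) {g : ℝ → ℝ}
    (hg : Continuous g) (hM : IsTraceClass (cfc g A)) {c : ℝ} (hc : 0 < c) :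
    (spectrum ℝ A ∩ {t | c ≤ g t}).Finite := by
  obtain ⟨M, hM⟩ := hM.exists_hasTraceBound
  by_contra h
  obtain ⟨n, hn⟩ := exists_nat_gt (M / (c / 2))
  obtain ⟨F, hF, hFn⟩ := Set.Infinite.exists_subset_card_eq h n
  have := card_mul_le_of_hasTraceBound_cfc hA hg hM hc F fun t ht => hF ht
  rw [hFn, ← le_div_iff₀ (by positivity)] at this
  linarith

theorem cfc_sub_sq {A : H →L[ℂ] H} (hA : IsSelfAdjoint A) :
    cfc (fun t : ℝ => t - t * t) A = A - A * A := by
  rw [cfc_sub (fun t : ℝ => t) (fun t => t * t) A, cfc_mul (fun t : ℝ => t) (fun t => t) A,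
    cfc_id' ℝ A]

/-- On [a, 1 - a] one has t - t² ≥ a (1 - a). The explicit count gives uniformity over families with
a common trace bound. -/
theorem card_spectrum_le {A : H →L[ℂ] H} (hA : IsSelfAdjoint A) {M : ℝ}
    (hM : HasTraceBound (A - A * A) M) {a : ℝ} (ha : 0 < a) (ha' : a < 1) (F : Finset ℝ)
    (hF : ∀ t ∈ F, t ∈ spectrum ℝ A ∧ t ∈ Set.Icc a (1 - a)) :
    F.card * (a * (1 - a) / 2) ≤ M := by
  rw [← cfc_sub_sq hA] at hM
  refine card_mul_le_of_hasTraceBound_cfc hA (by fun_prop) hM (mul_pos ha (by linarith)) F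
    fun t ht => ⟨(hF t ht).1, ?_⟩
  nlinarith [mul_nonneg (sub_nonneg.2 (hF t ht).2.1) (sub_nonneg.2 (hF t ht).2.2)]

theorem spectrum_inter_finite {A : H →L[ℂ] H} (hA : IsSelfAdjoint A)
    (hM : IsTraceClass (A - A * A)) {a : ℝ} (ha : 0 < a) (ha' : a < 1) :
    (spectrum ℝ A ∩ Set.Icc a (1 - a)).Finite := by
  rw [← cfc_sub_sq hA] at hM
  refine (finite_of_isTraceClass_cfc hA (by fun_prop) hM
    (mul_pos ha (sub_pos.2 ha'))).subset fun t ht => ⟨ht.1, ?_⟩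
  have := mul_nonneg (sub_nonneg.2 ht.2.1) (sub_nonneg.2 ht.2.2)
  simp only [Set.mem_ofPred_eq]
  nlinarith

/-- The point μ may belong to S: it is then isolated in S. -/
theorem continuousOn_step {S U : Set ℝ} {μ : ℝ} (hU : U ∈ nhds μ) (hS : (S ∩ U).Finite) :
    ContinuousOn (step μ) S := by
  intro x _
  rcases lt_trichotomy x μ with h | rfl | h
  · refine ContinuousAt.continuousWithinAt ?_
    have : step μ =ᶠ[nhds x] fun _ => 0 := by
      filter_upwards [Iio_mem_nhds h] with y hy
      simp [step, (Set.mem_Iio.1 hy).le]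
    exact continuousAt_const.congr this.symm
  · have : ∀ᶠ y in nhdsWithin x S, step x y = step x x := by
      rw [eventually_nhdsWithin_iff]
      have h1 : ((S ∩ U) \ {x})ᶜ ∈ nhds x :=
        (hS.subset Set.sdiff_subset).isClosed.isOpen_compl.mem_nhds (by simp)
      filter_upwards [h1, hU] with y hy hyU hyS
      by_contra hne
      exact hy ⟨⟨hyS, hyU⟩, fun h => hne (by rw [Set.mem_singleton_iff.1 h])⟩
    exact (tendsto_const_nhds (x := step x x)).congr' (this.mono fun _ h => h.symm)
  · refine ContinuousAt.continuousWithinAt ?_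
    have : step μ =ᶠ[nhds x] fun _ => 1 := by
      filter_upwards [Ioi_mem_nhds h] with y hy
      simp [step, not_le.2 (Set.mem_Ioi.1 hy)]
    exact continuousAt_const.congr this.symm

theorem continuousOn_step_spectrum {A : H →L[ℂ] H} (hA : IsSelfAdjoint A)
    (hM : IsTraceClass (A - A * A)) {μ : ℝ} (hμ : μ ∈ Set.Ioo (0 : ℝ) 1) :
    ContinuousOn (step μ) (spectrum ℝ A) := by
  obtain ⟨h0, h1⟩ := hμ
  have hm : 0 < min μ (1 - μ) := lt_min h0 (by linarith)
  have hm1 := min_le_left μ (1 - μ)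
  have hm2 := min_le_right μ (1 - μ)
  exact continuousOn_step (Icc_mem_nhds (by linarith) (by linarith))
    (spectrum_inter_finite hA hM (a := min μ (1 - μ) / 2) (by linarith) (by linarith))

/-- The quotient `(t - step μ t) / (t - t ^ 2)`. -/
noncomputable def stepQuotient (μ t : ℝ) : ℝ := if t ≤ μ then (1 - t)⁻¹ else -t⁻¹

theorem sub_step_eq {μ : ℝ} (hμ : μ ∈ Set.Ioo (0 : ℝ) 1) (t : ℝ) :
    t - step μ t = (t - t * t) * stepQuotient μ t := by
  obtain ⟨h0, h1⟩ := hμ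
  unfold step stepQuotient
  split_ifs with h
  · have : 1 - t ≠ 0 := by linarith
    field_simp; ring
  · have : t ≠ 0 := by linarith
    field_simp; ring

/-- The truncations by min and max keep both denominators away from 0 on the whole line, so that the
only discontinuity is that of the step. -/
theorem stepQuotient_eq (μ t : ℝ) :
    stepQuotient μ t = (1 - step μ t) * (1 - min t μ)⁻¹ - step μ t * (max t μ)⁻¹ := by
  unfold step stepQuotient
  split_ifs with h
  · simp [h]
  · simp [(not_le.1 h).le]

theorem continuousOn_stepQuotient {μ : ℝ} (hμ : μ ∈ Set.Ioo (0 : ℝ) 1) {S : Set ℝ}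
    (hS : ContinuousOn (step μ) S) : ContinuousOn (stepQuotient μ) S := by
  have h1 : ∀ t, 1 - min t μ ≠ 0 := fun t => by
    have := min_le_right t μ
    linarith [hμ.2]
  have h2 : ∀ t, max t μ ≠ 0 := fun t => by
    have := le_max_right t μ
    linarith [hμ.1]
  have h3 : Continuous fun t => (1 - min t μ)⁻¹ := Continuous.inv₀ (by fun_prop) h1
  have h4 : Continuous fun t => (max t μ)⁻¹ := Continuous.inv₀ (by fun_prop) h2
  rw [show stepQuotient μ = _ from funext (stepQuotient_eq μ)]
  exact ((continuousOn_const.sub hS).mul h3.continuousOn).sub (hS.mul h4.continuousOn)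

theorem sub_flatten_eq {A : H →L[ℂ] H} (hA : IsSelfAdjoint A) {μ : ℝ}
    (hμ : μ ∈ Set.Ioo (0 : ℝ) 1) (hc : ContinuousOn (step μ) (spectrum ℝ A)) :
    A - flatten μ A = (A - A * A) * cfc (stepQuotient μ) A := by
  rw [flatten, ← cfc_sub_sq hA, ← cfc_mul (fun t : ℝ => t - t * t) _ A (by fun_prop)
    (continuousOn_stepQuotient hμ hc)]
  nth_rewrite 1 [← cfc_id' ℝ A]
  rw [← cfc_sub (fun t : ℝ => t) (step μ) A]
  exact congrArg (fun f => cfc f A) (funext (sub_step_eq hμ))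

theorem isTraceClass_sub_flatten {A : H →L[ℂ] H} (hA : IsSelfAdjoint A)
    (hM : IsTraceClass (A - A * A)) {μ : ℝ} (hμ : μ ∈ Set.Ioo (0 : ℝ) 1) :
    IsTraceClass (A - flatten μ A) := by
  rw [sub_flatten_eq hA hμ (continuousOn_step_spectrum hA hM hμ)]
  exact hM.mul_right _

theorem isStarProjection_cfc_step {A : H →L[ℂ] H} {μ : ℝ}
    (hc : ContinuousOn (step μ) (spectrum ℝ A)) :
    IsStarProjection (cfc (step μ) A) := by
  refine ⟨?_, cfc_predicate _ _⟩
  rw [IsIdempotentElem, ← cfc_mul (step μ) (step μ) A hc hc]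
  refine congrArg (fun f => cfc f A) (funext fun t => ?_)
  by_cases h : t ≤ μ <;> simp [step, h]

end Spectral

/-! ### Kramers degeneracy and the parity of traces of projections -/

section Kramers

variable {H : Type*} [NormedAddCommGroup H] [InnerProductSpace ℂ H]

/-- `Θ` is an isometric antilinear map with `Θ² = -1`. -/
structure IsKramers (Θ : H → H) : Prop where
  map_add : ∀ x y, Θ (x + y) = Θ x + Θ y
  map_smul : ∀ (c : ℂ) x, Θ (c • x) = conj c • Θ x
  norm_map : ∀ x, ‖Θ x‖ = ‖x‖
  sq : ∀ x, Θ (Θ x) = -x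

namespace IsKramers

variable {Θ : H → H} (hΘ : IsKramers Θ)
include hΘ

theorem map_zero : Θ 0 = 0 := by simpa using hΘ.map_smul 0 0

theorem map_neg (x : H) : Θ (-x) = -Θ x := by simpa using hΘ.map_smul (-1) x

theorem map_sub (x y : H) : Θ (x - y) = Θ x - Θ y := by
  rw [sub_eq_add_neg, hΘ.map_add, hΘ.map_neg, sub_eq_add_neg]

theorem map_sum {κ : Type*} (s : Finset κ) (f : κ → H) : Θ (∑ i ∈ s, f i) = ∑ i ∈ s, Θ (f i) := by
  classical
  induction s using Finset.induction_on with
  | empty => simpa using hΘ.map_zero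
  | insert a s ha ih => rw [Finset.sum_insert ha, Finset.sum_insert ha, hΘ.map_add, ih]

theorem isometry : Isometry Θ := Isometry.of_dist_eq fun x y => by
  rw [dist_eq_norm, ← hΘ.map_sub, hΘ.norm_map, dist_eq_norm]

/-- If M is the matrix of Θ in a basis of V, then Θ² = -1 reads M · conj M = -1. Taking
determinants, |det M|² = (-1) ^ dim V, so the dimension is even. -/
theorem even_finrank (V : Submodule ℂ H) [FiniteDimensional ℂ V] (hV : ∀ v ∈ V, Θ v ∈ V) :
    Even (Module.finrank ℂ V) := by
  let B := Module.finBasis ℂ V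
  let J : V → V := fun v => ⟨Θ v, hV v v.2⟩
  let M : Matrix (Fin (Module.finrank ℂ V)) (Fin (Module.finrank ℂ V)) ℂ :=
    Matrix.of fun i j => B.repr (J (B j)) i
  have hM : M * M.map conj = -1 := by
    ext k j
    have h1 : J (J (B j)) = ∑ i, conj (M i j) • J (B i) := by
      apply Subtype.ext
      have h2 : (J (B j) : H) = ∑ i, M i j • (B i : H) := by
        have := congrArg (Subtype.val) (B.sum_repr (J (B j)))
        rw [Submodule.coe_sum] at this
        exact this.symm
      change Θ (J (B j) : H) = _
      rw [h2, hΘ.map_sum]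
      simp [hΘ.map_smul, J]
    have h3 : J (J (B j)) = - B j := Subtype.ext (hΘ.sq _)
    have h4 := congrArg (fun v => B.repr v k) (h1.symm.trans h3)
    simp only [_root_.map_sum, _root_.map_smul, _root_.map_neg, Finsupp.coe_finsetSum, Finset.sum_apply,
      Finsupp.smul_apply, smul_eq_mul, Finsupp.neg_apply, Module.Basis.repr_self] at h4
    rw [Matrix.mul_apply, Matrix.neg_apply, Matrix.one_apply]
    rw [Finsupp.single_apply] at h4
    simp only [eq_comm (a := k)]
    rw [← h4]
    exact Finset.sum_congr rfl fun i _ => mul_comm _ _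
  have hdet := congrArg Matrix.det hM
  rw [Matrix.det_mul, show M.map conj = (starRingEnd ℂ).mapMatrix M from rfl,
    ← RingHom.map_det, Complex.mul_conj, Matrix.det_neg, Matrix.det_one, mul_one,
    Fintype.card_fin] at hdet
  rcases Nat.even_or_odd (Module.finrank ℂ V) with h | h
  · exact h
  · rw [h.neg_one_pow] at hdet
    have : Complex.normSq M.det = -1 := by exact_mod_cast hdet
    linarith [Complex.normSq_nonneg M.det]

end IsKramers

/-- `A` commutes with the antilinear map `Θ`. -/
def CommutesWith (Θ : H → H) (A : H →L[ℂ] H) : Prop := ∀ ψ, A (Θ ψ) = Θ (A ψ)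

variable {Θ : H → H}

theorem CommutesWith.mul {A B : H →L[ℂ] H} (hA : CommutesWith Θ A) (hB : CommutesWith Θ B) :
    CommutesWith Θ (A * B) := fun ψ => by
  rw [mul_apply_eq_comp, mul_apply_eq_comp, hB ψ, hA]

theorem CommutesWith.sub (hΘ : IsKramers Θ) {A B : H →L[ℂ] H} (hA : CommutesWith Θ A)
    (hB : CommutesWith Θ B) : CommutesWith Θ (A - B) := fun ψ => by
  simp only [sub_apply, hB ψ, hA ψ, hΘ.map_sub]

theorem isClosed_commutesWith (hΘ : IsKramers Θ) : IsClosed {A | CommutesWith Θ A} := by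
  simp only [CommutesWith, Set.ofPred_forall]
  refine isClosed_iInter fun ψ => isClosed_eq ?_ ?_
  · exact (ContinuousLinearMap.apply ℂ H (Θ ψ)).continuous
  · exact hΘ.isometry.continuous.comp (ContinuousLinearMap.apply ℂ H ψ).continuous

/-- The bounded operators which, together with their adjoints, commute with `Θ`. -/
def kramersSubalgebra [CompleteSpace H] (hΘ : IsKramers Θ) : StarSubalgebra ℝ (H →L[ℂ] H) where
  carrier := {A | CommutesWith Θ A ∧ CommutesWith Θ (star A)}
  mul_mem' {A B} hA hB := ⟨hA.1.mul hB.1, by rw [star_mul]; exact hB.2.mul hA.2⟩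
  add_mem' {A B} hA hB := by
    refine ⟨fun ψ => ?_, fun ψ => ?_⟩
    · rw [add_apply, add_apply, hA.1, hB.1, hΘ.map_add]
    · rw [star_add, add_apply, add_apply, hA.2, hB.2, hΘ.map_add]
  algebraMap_mem' r := by
    have : CommutesWith Θ (algebraMap ℝ (H →L[ℂ] H) r) := fun ψ => by
      rw [Algebra.algebraMap_eq_smul_one]
      simpa using (hΘ.map_smul (r : ℂ) ψ).symm
    exact ⟨this, by rwa [← algebraMap_star_comm, star_trivial]⟩
  star_mem' {A} hA := ⟨hA.2, by rw [star_star]; exact hA.1⟩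

/-- The real functional calculus stays in the closed real star subalgebra generated by A. Real
scalars are essential, Θ being antilinear. -/
theorem CommutesWith.cfc [CompleteSpace H] (hΘ : IsKramers Θ) {A : H →L[ℂ] H}
    (hA : IsSelfAdjoint A) (h : CommutesWith Θ A) (f : ℝ → ℝ) : CommutesWith Θ (cfc f A) := by
  have hc : IsClosed (kramersSubalgebra hΘ : Set (H →L[ℂ] H)) :=
    (isClosed_commutesWith hΘ).inter ((isClosed_commutesWith hΘ).preimage continuous_star)
  have hm : A ∈ kramersSubalgebra hΘ := ⟨h, by rwa [hA.star_eq]⟩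
  exact (StarAlgebra.elemental.le_of_mem hc hm (cfc_mem_elemental f A)).1

variable [CompleteSpace H] {X : Set ℂ} {m : ℕ} (b : HilbertBasis (X × Fin m) ℂ H)

/-- The trace bound limits the size of an orthonormal basis of the range, so the trace is the
dimension of a finite dimensional space preserved by Θ. -/
theorem trace_projection_even (hΘ : IsKramers Θ) {E : H →L[ℂ] H} (hE : IsStarProjection E)
    (hT : IsTraceClass E) (hc : CommutesWith Θ E) : ∃ k : ℤ, trace b E = ((2 * k : ℤ) : ℂ) := by
  have hEE : ∀ x, E (E x) = E x := fun x => by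
    conv_rhs => rw [← hE.isIdempotentElem.eq]
    rfl
  let V : Submodule ℂ H := LinearMap.ker ((1 - E : H →L[ℂ] H) : H →ₗ[ℂ] H)
  have hmem : ∀ x, x ∈ V ↔ E x = x := fun x => by
    rw [LinearMap.mem_ker]
    exact sub_eq_zero.trans eq_comm
  have hVc : IsClosed (V : Set H) := ContinuousLinearMap.isClosed_ker (1 - E)
  have : CompleteSpace V := hVc.completeSpace_coe
  obtain ⟨w, B, hB⟩ := exists_hilbertBasis ℂ V
  have hBV : ∀ i, E (B i : H) = B i := fun i => (hmem _).1 (B i).2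
  have ho : Orthonormal ℂ fun i => (B i : H) :=
    B.orthonormal.comp_linearIsometry V.subtypeₗᵢ
  obtain ⟨M, hM⟩ := hT.exists_hasTraceBound
  have hcard : ∀ s : Finset w, (s.card : ℝ) ≤ M := fun s => by
    have := hM.sum_norm_inner_le ho s
    have h1 : ∀ i : w, ‖(B i : H)‖ = 1 := fun i => ho.1 i
    simpa [hBV, h1] using this
  have hfin : Finite w := by
    by_contra hinf
    rw [not_finite_iff_infinite] at hinf
    obtain ⟨n, hn⟩ := exists_nat_gt M
    obtain ⟨s, hs⟩ := Infinite.exists_subset_card_eq w n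
    have := hcard s
    rw [hs] at this
    linarith
  have := Fintype.ofFinite w
  have : FiniteDimensional ℂ V := B.toOrthonormalBasis.toBasis.finiteDimensional_of_finite
  have hrank : Module.finrank ℂ V = Fintype.card w :=
    Module.finrank_eq_card_basis B.toOrthonormalBasis.toBasis
  have htr : trace b E = Fintype.card w := by
    rw [trace_eq_tsum b (u := fun i => (B i : H)) (v := fun i => (B i : H))
      (Summable.of_finite) (fun ψ => ?_)]
    · have h1 : ∀ i : w, ‖(B i : H)‖ = 1 := fun i => ho.1 i
      simp [tsum_fintype, h1]
    · have h2 := (B.hasSum_repr ⟨E ψ, (hmem _).2 (hEE ψ)⟩)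
      have h3 := V.subtypeL.hasSum h2
      have h4 : ∀ i, B.repr ⟨E ψ, (hmem _).2 (hEE ψ)⟩ i = inner ℂ (B i : H) ψ := fun i => by
        rw [B.repr_apply_apply, Submodule.coe_inner, ← ContinuousLinearMap.adjoint_inner_left E,
          ContinuousLinearMap.isSelfAdjoint_iff'.1 hE.isSelfAdjoint, hBV]
      simpa [h4] using h3
  obtain ⟨k, hk⟩ := hΘ.even_finrank V fun v hv => by
    rw [hmem] at hv ⊢
    rw [hc, hv]
  refine ⟨k, ?_⟩
  rw [htr, ← hrank, hk]
  push_cast; ring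

/-- D = E - F and C = 1 - E - F anticommute and D² + C² = 1. Moving one factor C cyclically shows
that the trace of D^(2n+1) C² equals its own negative, so all odd powers of D have the same trace;
and the traces of these powers tend to 0. -/
theorem trace_sub_eq_zero_of_norm_lt_one {E F : H →L[ℂ] H} (hE : IsIdempotentElem E)
    (hF : IsIdempotentElem F) (hT : IsTraceClass (E - F)) (hn : ‖(E - F) * (E - F)‖ < 1) :
    trace b (E - F) = 0 := by
  set D := E - F with hD
  set C := 1 - E - F with hC
  have hE' : E * E = E := hE
  have hF' : F * F = F := hF
  have hCD : C * D = -(D * C) := by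
    simp only [hC, hD, mul_sub, sub_mul, one_mul, mul_one, hE', hF']
    abel
  have hCC : D * D = 1 - C * C := by
    simp only [hC, hD, mul_sub, sub_mul, one_mul, mul_one, hE', hF']
    abel
  have hCS : Commute C (D * D) := by
    rw [Commute, SemiconjBy, ← mul_assoc, hCD, neg_mul, mul_assoc, hCD, mul_neg, neg_neg, mul_assoc]
  have htc : ∀ n : ℕ, IsTraceClass (D * (D * D) ^ n) := fun n => hT.mul_right _
  have hstep : ∀ n : ℕ, trace b (D * (D * D) ^ n) = trace b D := by
    intro n
    induction n with
    | zero => simp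
    | succ n ih =>
      have h1 : D * (D * D) ^ (n + 1) = D * (D * D) ^ n - D * (D * D) ^ n * C * C := by
        rw [pow_succ, ← mul_assoc D, hCC, mul_sub, mul_one, ← hCC, mul_assoc _ C C]
      have h2 : C * (D * (D * D) ^ n * C) = -(D * (D * D) ^ n * C * C) := by
        rw [← mul_assoc, ← mul_assoc, hCD, neg_mul, neg_mul, mul_assoc D C,
          (hCS.pow_right n).eq, mul_assoc, mul_assoc, mul_assoc, mul_assoc]
      have h3 : trace b (D * (D * D) ^ n * C * C) = 0 := by
        have h4 := trace_mul_comm b ((htc n).mul_right C) C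
        rw [h2, trace_neg] at h4
        linear_combination h4 / 2
      rw [h1, trace_sub b (htc n) (((htc n).mul_right C).mul_right C), h3, sub_zero, ih]
  obtain ⟨M, hM⟩ := hT.exists_hasTraceBound
  have hle : ∀ n : ℕ, ‖trace b D‖ ≤ M * ‖D * D‖ ^ (n + 1) := fun n => by
    rw [← hstep (n + 1)]
    refine ((hM.mul_right _).norm_trace_le b).trans ?_
    refine mul_le_mul_of_nonneg_left (norm_pow_le' _ n.succ_pos) ?_
    exact (norm_nonneg _).trans (hM.norm_trace_le b)
  have hlim : Filter.Tendsto (fun n : ℕ => M * ‖D * D‖ ^ (n + 1)) Filter.atTop (nhds (M * 0)) :=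
    ((tendsto_pow_atTop_nhds_zero_of_lt_one (norm_nonneg _) hn).comp
      (Filter.tendsto_add_atTop_nat 1)).const_mul M
  have := ge_of_tendsto' hlim hle
  rw [mul_zero] at this
  exact norm_le_zero_iff.1 this

/-- S = (E - F)² commutes with E and F, hence so does its spectral projection W for a threshold a <
1. On the range of W, which has finite dimension, both projections have even rank; on the complement
`trace_sub_eq_zero_of_norm_lt_one` applies. -/
theorem trace_sub_projection_even (hΘ : IsKramers Θ) {E F : H →L[ℂ] H} (hE : IsStarProjection E)
    (hF : IsStarProjection F) (hT : IsTraceClass (E - F)) (hcE : CommutesWith Θ E)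
    (hcF : CommutesWith Θ F) : ∃ k : ℤ, trace b (E - F) = ((2 * k : ℤ) : ℂ) := by
  have hE' : E * E = E := hE.isIdempotentElem
  have hF' : F * F = F := hF.isIdempotentElem
  set S := (E - F) * (E - F) with hS
  have hDsa : IsSelfAdjoint (E - F) := hE.isSelfAdjoint.sub hF.isSelfAdjoint
  have hSsa : IsSelfAdjoint S := by
    rw [IsSelfAdjoint, hS, star_mul, hDsa.star_eq]
  have hSpos : ∀ t ∈ spectrum ℝ S, 0 ≤ t := by
    have := spectrum_star_mul_self_nonneg (b := E - F)
    rwa [hDsa.star_eq] at this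
  have hST : IsTraceClass S := hT.mul_right _
  have hES : Commute S E := by
    simp only [Commute, SemiconjBy, hS, mul_sub, sub_mul, ← mul_assoc, hE', hF']
    simp only [mul_assoc, hE']
    abel
  have hFS : Commute S F := by
    simp only [Commute, SemiconjBy, hS, mul_sub, sub_mul, ← mul_assoc, hE', hF']
    simp only [mul_assoc, hF']
    abel
  have hfin : (spectrum ℝ S ∩ Set.Ici (1 / 4)).Finite := by
    have := finite_of_isTraceClass_cfc hSsa (g := fun t => t) continuous_id
      (by rwa [cfc_id' ℝ S]) (c := 1 / 4) (by norm_num)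
    exact this
  -- Above 1/4 the spectrum of S is finite, so the step at a is continuous on it; a < 3/4 leaves the
  -- rest of S with norm below 1.
  obtain ⟨a, ha, haS⟩ : ∃ a ∈ Set.Ioo (1 / 4 : ℝ) (3 / 4), a ∉ spectrum ℝ S ∩ Set.Ici (1 / 4) :=
    ((Set.Ioo_infinite (by norm_num)).sdiff hfin).nonempty
  have hcont : ContinuousOn (step a) (spectrum ℝ S) :=
    continuousOn_step (Ici_mem_nhds ha.1) hfin
  set W := cfc (step a) S with hW
  have hWp : IsStarProjection W := isStarProjection_cfc_step hcont
  have hWT : IsTraceClass W := by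
    have h1 : ∀ t, max t a ≠ 0 := fun t => by
      have := le_max_right t a
      linarith [ha.1]
    have h2 : Continuous fun t : ℝ => (max t a)⁻¹ := Continuous.inv₀ (by fun_prop) h1
    -- W is S times a bounded function of S, since the step vanishes for t ≤ a.
    have : W = cfc (fun t : ℝ => t) S * cfc (fun t => step a t * (max t a)⁻¹) S := by
      rw [← cfc_mul (fun t : ℝ => t) (fun t => step a t * (max t a)⁻¹) S (by fun_prop)
        (hcont.mul h2.continuousOn), hW]
      refine congrArg (fun f => cfc f S) (funext fun t => ?_)
      unfold step
      split_ifs with h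
      · simp
      · rw [max_eq_left (not_le.1 h).le]
        have : t ≠ 0 := by linarith [ha.1]
        field_simp
    rw [this, cfc_id' ℝ S]
    exact hST.mul_right _
  have hcW : CommutesWith Θ W :=
    CommutesWith.cfc hΘ hSsa ((hcE.sub hΘ hcF).mul (hcE.sub hΘ hcF)) _
  have hWE : Commute W E := hES.cfc_real _
  have hWF : Commute W F := hFS.cfc_real _
  obtain ⟨k, hk⟩ := trace_projection_even b hΘ (hE.mul hWp hWE.symm) (hWT.mul_left E)
    (hcE.mul hcW)
  obtain ⟨l, hl⟩ := trace_projection_even b hΘ (hF.mul hWp hWF.symm) (hWT.mul_left F)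
    (hcF.mul hcW)
  have hW1 := hWp.one_sub
  have hzero : trace b (E * (1 - W) - F * (1 - W)) = 0 := by
    refine trace_sub_eq_zero_of_norm_lt_one b
      (hE.mul hW1 ((Commute.one_right E).sub_right hWE.symm)).isIdempotentElem
      (hF.mul hW1 ((Commute.one_right F).sub_right hWF.symm)).isIdempotentElem
      (by rw [← sub_mul]; exact hT.mul_right _) ?_
    have hcomm : Commute (1 - W) (E - F) :=
      (Commute.one_left _).sub_left (hWE.sub_right hWF)
    have h3 : (E * (1 - W) - F * (1 - W)) * (E * (1 - W) - F * (1 - W))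
        = cfc (fun t => t * (1 - step a t)) S := by
      rw [cfc_mul (fun t : ℝ => t) (fun t => 1 - step a t) S (by fun_prop)
        (continuousOn_const.sub hcont), cfc_sub (fun _ : ℝ => 1) (step a) S, cfc_const_one ℝ S,
        cfc_id' ℝ S, ← hW, ← sub_mul, mul_assoc, ← mul_assoc (1 - W), hcomm.eq, mul_assoc,
        hW1.isIdempotentElem.eq, ← mul_assoc]
    rw [h3]
    refine (norm_cfc_le (c := a) (by linarith [ha.1]) fun t ht => ?_).trans_lt
      (by linarith [ha.2])
    unfold step
    split_ifs with h
    · simpa [abs_of_nonneg (hSpos t ht)] using h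
    · simpa using (by linarith [ha.1] : (0 : ℝ) ≤ a)
  refine ⟨k - l, ?_⟩
  have hsplit : E - F = (E * W - F * W) + (E * (1 - W) - F * (1 - W)) := by
    simp only [mul_sub, mul_one]; abel
  rw [hsplit, trace_add b ((hWT.mul_left E).sub (hWT.mul_left F))
    (by rw [← sub_mul]; exact hT.mul_right _), hzero, trace_sub b (hWT.mul_left E)
    (hWT.mul_left F), hk, hl]
  push_cast; ring

theorem isTraceClass_sub_sq_of_sub {A B : H →L[ℂ] H} (hA : IsTraceClass (A - A * A))
    (hAB : IsTraceClass (A - B)) : IsTraceClass (B - B * B) := by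
  have : B - B * B = (A - A * A) - (A - B) + ((A - B) * B + A * (A - B)) := by
    simp only [mul_sub, sub_mul]; abel
  rw [this]
  exact (hA.sub hAB).add ((hAB.mul_right B).add (hAB.mul_left A))

/-- The difference of the flattenings is (A - Ā) - (B - B̄) - (A - B), and the last term has trace 0
because the diagonals agree. The case A = B is a change of the chemical potential. -/
theorem vertexTrace_sub_even (hΘ : IsKramers Θ) {A B : H →L[ℂ] H} (hA : IsSelfAdjoint A)
    (hB : IsSelfAdjoint B) (hcA : CommutesWith Θ A) (hcB : CommutesWith Θ B)
    (hAT : IsTraceClass (A - A * A)) (hAB : IsTraceClass (A - B))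
    (hdiag : ∀ i, entry b A i i = entry b B i i) {μ μ' : ℝ} (hμ : μ ∈ Set.Ioo (0 : ℝ) 1)
    (hμ' : μ' ∈ Set.Ioo (0 : ℝ) 1) :
    ∃ k : ℤ, vertexTrace b μ A - vertexTrace b μ' B = ((2 * k : ℤ) : ℂ) := by
  have hBT := isTraceClass_sub_sq_of_sub hAT hAB
  have h1 := isTraceClass_sub_flatten hA hAT hμ
  have h2 := isTraceClass_sub_flatten hB hBT hμ'
  have h3 : flatten μ' B - flatten μ A = (A - flatten μ A) - (B - flatten μ' B) - (A - B) := by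
    abel
  have h4 : trace b (A - B) = 0 := by
    simp [trace, entry_sub, hdiag]
  obtain ⟨k, hk⟩ := trace_sub_projection_even b hΘ
    (isStarProjection_cfc_step (continuousOn_step_spectrum hB hBT hμ'))
    (isStarProjection_cfc_step (continuousOn_step_spectrum hA hAT hμ))
    (by change IsTraceClass (flatten μ' B - flatten μ A); rw [h3]; exact (h1.sub h2).sub hAB)
    (hcB.cfc hΘ hB _) (hcA.cfc hΘ hA _)
  refine ⟨k, ?_⟩
  rw [← hk]
  change _ = trace b (flatten μ' B - flatten μ A)
  rw [h3, trace_sub b (h1.sub h2) hAB, trace_sub b h1 h2, h4, sub_zero]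
  rfl

end Kramers

/-! ### Exponential sums over sets of bounded density -/

section Density

open scoped ENNReal

theorem summable_exp_neg_mul_abs_int {c : ℝ} (hc : 0 < c) :
    Summable fun a : ℤ => Real.exp (-c * |(a : ℝ)|) := by
  have h : Summable fun n : ℕ => Real.exp (-c * n) := by
    simpa [mul_comm] using Real.summable_exp_nat_mul_iff.2 (neg_lt_zero.2 hc)
  refine Summable.of_nat_of_neg ?_ ?_ <;> simpa using h

variable {X : Set ℂ}

/-- Each unit square of the grid based at z lies in a disk of radius 1 and so contains at most N
sites; the sum over squares is dominated by a product of two geometric series. -/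
theorem BoundedDensity.exists_tsum_exp_le (hX : BoundedDensity X) {c : ℝ} (hc : 0 < c) :
    ∃ K : ℝ≥0∞, K ≠ ∞ ∧ ∀ z : ℂ, ∑' x : X, ENNReal.ofReal (Real.exp (-c * ‖(x : ℂ) - z‖)) ≤ K := by
  obtain ⟨N, hN⟩ := hX
  let e : ℤ → ℝ≥0∞ := fun a => ENNReal.ofReal (Real.exp (-(c / 2) * |(a : ℝ)|))
  have he : ∑' a, e a ≠ ∞ := by
    rw [← ENNReal.ofReal_tsum_of_nonneg (fun _ => (Real.exp_pos _).le)
      (summable_exp_neg_mul_abs_int (half_pos hc))]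
    exact ENNReal.ofReal_ne_top
  refine ⟨N * (ENNReal.ofReal (Real.exp c) * ((∑' a, e a) * ∑' a, e a)), ?_, fun z => ?_⟩
  · exact ENNReal.mul_ne_top (ENNReal.natCast_ne_top N)
      (ENNReal.mul_ne_top ENNReal.ofReal_ne_top (ENNReal.mul_ne_top he he))
  let cell : X → ℤ × ℤ := fun x => (⌊((x : ℂ) - z).re⌋, ⌊((x : ℂ) - z).im⌋)
  -- The factor exp c pays for rounding: |⌊re⌋| + |⌊im⌋| is at most 2‖x - z‖ + 2.
  let h : ℤ × ℤ → ℝ≥0∞ := fun q => ENNReal.ofReal (Real.exp c) * (e q.1 * e q.2)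
  have hfloor : ∀ t : ℝ, |((⌊t⌋ : ℤ) : ℝ)| ≤ |t| + 1 := fun t => by
    have h1 := Int.floor_le t
    have h2 := Int.lt_floor_add_one t
    rw [abs_le]
    constructor
    · linarith [neg_abs_le t]
    · linarith [le_abs_self t]
  have h1 : ∀ x : X, ENNReal.ofReal (Real.exp (-c * ‖(x : ℂ) - z‖)) ≤ h (cell x) := fun x => by
    simp only [h, e, cell]
    rw [← ENNReal.ofReal_mul (Real.exp_pos _).le, ← ENNReal.ofReal_mul (Real.exp_pos _).le,
      ← Real.exp_add, ← Real.exp_add]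
    refine ENNReal.ofReal_le_ofReal (Real.exp_le_exp.2 ?_)
    have h2 := (hfloor ((x : ℂ) - z).re).trans
      (add_le_add_left (Complex.abs_re_le_norm ((x : ℂ) - z)) 1)
    have h3 := (hfloor ((x : ℂ) - z).im).trans
      (add_le_add_left (Complex.abs_im_le_norm ((x : ℂ) - z)) 1)
    nlinarith
  have hcard : ∀ q, (cell ⁻¹' {q}).encard ≤ N := fun q => by
    let w : ℂ := z + ⟨q.1 + 1 / 2, q.2 + 1 / 2⟩
    refine le_trans ?_ (hN w)
    rw [← (Subtype.val_injective (p := (· ∈ X))).encard_image]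
    refine Set.encard_le_encard ?_
    rintro _ ⟨x, hx, rfl⟩
    refine ⟨x.2, ?_⟩
    have hx' : cell x = q := hx
    have ha : ⌊((x : ℂ) - z).re⌋ = q.1 := congrArg Prod.fst hx'
    have hb : ⌊((x : ℂ) - z).im⌋ = q.2 := congrArg Prod.snd hx'
    rw [Int.floor_eq_iff] at ha hb
    rw [Metric.mem_closedBall, dist_eq_norm]
    refine (Complex.norm_le_abs_re_add_abs_im _).trans ?_
    have h4 : |((x : ℂ) - w).re| ≤ 1 / 2 := by
      simp only [w, Complex.sub_re, Complex.add_re] at ha ⊢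
      rw [abs_le]; constructor <;> linarith
    have h5 : |((x : ℂ) - w).im| ≤ 1 / 2 := by
      simp only [w, Complex.sub_im, Complex.add_im] at hb ⊢
      rw [abs_le]; constructor <;> linarith
    linarith
  calc ∑' x : X, ENNReal.ofReal (Real.exp (-c * ‖(x : ℂ) - z‖))
      ≤ ∑' x : X, h (cell x) := ENNReal.tsum_le_tsum h1
    _ = ∑' q, ∑' x : cell ⁻¹' {q}, h (cell x) := by
      rw [← (Equiv.sigmaFiberEquiv cell).tsum_eq fun x => h (cell x), ENNReal.tsum_sigma']
      rfl
    _ ≤ ∑' q, N * h q := by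
      refine ENNReal.tsum_le_tsum fun q => ?_
      have : ∀ x : cell ⁻¹' {q}, h (cell x) = h q := fun x => congrArg h x.2
      simp only [this]
      rw [ENNReal.tsum_set_const]
      exact mul_le_mul_left (by exact_mod_cast hcard q) _
    _ = _ := by
      rw [ENNReal.tsum_mul_left]
      simp only [h]
      rw [ENNReal.tsum_mul_left, ENNReal.tsum_prod']
      simp only [ENNReal.tsum_mul_left, ENNReal.tsum_mul_right]

theorem BoundedDensity.countable (hX : BoundedDensity X) : Countable X := by
  obtain ⟨K, hK, h⟩ := hX.exists_tsum_exp_le one_pos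
  have := Summable.countable_support_ennreal (ne_top_of_le_ne_top hK (h 0))
  rw [show Function.support _ = (Set.univ : Set X) from
    Set.eq_univ_of_forall fun x => (ENNReal.ofReal_pos.2 (Real.exp_pos _)).ne'] at this
  exact Set.countable_univ_iff.1 this

theorem BoundedDensity.exists_tsum_exp_le' (hX : BoundedDensity X) (m : ℕ) {c : ℝ} (hc : 0 < c) :
    ∃ K : ℝ≥0∞, K ≠ ∞ ∧ ∀ z : ℂ,
      ∑' i : X × Fin m, ENNReal.ofReal (Real.exp (-c * ‖(i.1 : ℂ) - z‖)) ≤ K := by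
  obtain ⟨K, hK, h⟩ := hX.exists_tsum_exp_le hc
  refine ⟨m * K, ENNReal.mul_ne_top (ENNReal.natCast_ne_top m) hK, fun z => ?_⟩
  rw [ENNReal.tsum_prod']
  simp only [ENNReal.tsum_const, ENat.card_eq_coe_natCard, Nat.card_eq_fintype_card,
    Fintype.card_fin]
  rw [ENNReal.tsum_mul_left]
  exact mul_le_mul_right (h z) _

end Density

/-! ### Operators given by their matrix elements -/

section Kernel

open scoped ENNReal

variable {X : Set ℂ} {m : ℕ} {H : Type*} [NormedAddCommGroup H] [InnerProductSpace ℂ H]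
  (b : HilbertBasis (X × Fin m) ℂ H)

theorem tsum_enorm_inner_sq_le (v : H) : ∑' i, ‖inner ℂ (b i) v‖ₑ ^ 2 ≤ ‖v‖ₑ ^ 2 := by
  rw [ENNReal.tsum_eq_iSup_sum]
  refine iSup_le fun s => ?_
  have := ENNReal.ofReal_le_ofReal (b.orthonormal.sum_inner_products_le v (s := s))
  rw [ENNReal.ofReal_sum_of_nonneg fun _ _ => by positivity] at this
  simpa [ENNReal.ofReal_pow] using this

theorem ext_entry {A B : H →L[ℂ] H} (h : ∀ i j, entry b A i j = entry b B i j) : A = B := by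
  refine ContinuousLinearMap.ext_on (s := Set.range b)
    (Submodule.dense_iff_topologicalClosure_eq_top.2 b.dense_span) ?_
  rintro _ ⟨j, rfl⟩
  refine b.repr.injective (lp.ext (funext fun i => ?_))
  rw [b.repr_apply_apply, b.repr_apply_apply]
  exact h i j

/-- A is the sum of its matrix units, each of rank one and norm |A i j|. -/
theorem hasTraceBound_of_tsum_enorm_entry_le [Countable X] [CompleteSpace H] {A : H →L[ℂ] H}
    {M : ℝ} (hM0 : 0 ≤ M) (hM : ∑' i, ∑' j, ‖entry b A i j‖ₑ ≤ ENNReal.ofReal M) :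
    HasTraceBound A M := by
  rw [← ENNReal.tsum_prod (f := fun i j => ‖entry b A i j‖ₑ)] at hM
  have hs : Summable fun q : (X × Fin m) × (X × Fin m) => ‖entry b A q.1 q.2‖ :=
    summable_norm_iff.2 (Summable.of_enorm (ne_top_of_le_ne_top ENNReal.ofReal_ne_top hM))
  have hb : ∀ i, ‖b i‖ = 1 := b.orthonormal.1
  refine hasTraceBound_of_countable (κ := (X × Fin m) × (X × Fin m))
    (fun q => conj (entry b A q.1 q.2) • b q.2) (fun q => b q.1) ?_ ?_ fun ψ => ?_
  · simpa [norm_smul, hb] using hs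
  · simp only [norm_smul, hb, RCLike.norm_conj, mul_one]
    rw [← ENNReal.ofReal_le_ofReal_iff hM0, ENNReal.ofReal_tsum_of_nonneg (fun _ => norm_nonneg _) hs]
    simpa using hM
  · have hF : Summable fun q : (X × Fin m) × (X × Fin m) =>
        inner ℂ (conj (entry b A q.1 q.2) • b q.2) ψ • b q.1 := by
      refine Summable.of_norm ((hs.mul_right ‖ψ‖).of_nonneg_of_le (fun _ => norm_nonneg _)
        fun q => ?_)
      rw [norm_smul, hb, mul_one, inner_smul_left, Complex.conj_conj, norm_mul]
      refine mul_le_mul_of_nonneg_left ?_ (norm_nonneg _)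
      simpa [hb] using norm_inner_le_norm (𝕜 := ℂ) (b q.2) ψ
    have h1 := hF.hasSum.prod_fiberwise (g := fun i => inner ℂ (b i) (A ψ) • b i) fun i => by
      refine HasSum.smul_const ?_ (b i)
      have := b.hasSum_inner_mul_inner (ContinuousLinearMap.adjoint A (b i)) ψ
      simpa [ContinuousLinearMap.adjoint_inner_left, inner_smul_left, entry, mul_comm] using this
    have h2 := b.hasSum_repr (A ψ)
    simp only [b.repr_apply_apply] at h2
    rw [← h1.unique h2]
    exact hF.hasSum

/-- Schur test: a kernel with bounded row and column sums defines a bounded operator. -/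
theorem exists_entry_eq [CompleteSpace H] (k : X × Fin m → X × Fin m → ℂ) {K : ℝ≥0∞} (hK : K ≠ ∞)
    (hrow : ∀ i, ∑' j, ‖k i j‖ₑ ≤ K) (hcol : ∀ j, ∑' i, ‖k i j‖ₑ ≤ K) :
    ∃ A : H →L[ℂ] H, (∀ i j, entry b A i j = k i j) ∧ ‖A‖ ≤ 2 * K.toReal := by
  -- The terms of ⟨A v, w⟩ for the operator to be constructed. Each is bounded by a part summed with
  -- the column bound and a part summed with the row bound.
  let t : H → H → (X × Fin m) × (X × Fin m) → ℂ := fun v w q =>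
    conj (k q.1 q.2) * inner ℂ v (b q.2) * inner ℂ (b q.1) w
  have hle : ∀ v w, ∑' q, ‖t v w q‖ₑ ≤ K * ‖v‖ₑ ^ 2 + K * ‖w‖ₑ ^ 2 := fun v w => by
    have h1 : ∀ q, ‖t v w q‖ₑ ≤ ‖k q.1 q.2‖ₑ * ‖inner ℂ (b q.2) v‖ₑ ^ 2
        + ‖k q.1 q.2‖ₑ * ‖inner ℂ (b q.1) w‖ₑ ^ 2 := fun q => by
      have h2 : ∀ x y : ℝ≥0∞, x * y ≤ x ^ 2 + y ^ 2 := fun x y => by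
        rcases le_total x y with h | h
        · exact (mul_le_mul_left h y).trans (by rw [← sq]; exact le_add_self)
        · exact (mul_le_mul_right h x).trans (by rw [← sq]; exact le_self_add)
      simp only [t, enorm_mul, ← mul_add]
      rw [mul_assoc, RCLike.enorm_conj]
      refine mul_le_mul_right ?_ _
      rw [← inner_conj_symm v, RCLike.enorm_conj]
      exact h2 _ _
    refine (ENNReal.tsum_le_tsum h1).trans ?_
    rw [ENNReal.tsum_add]
    refine add_le_add ?_ ?_
    · rw [ENNReal.tsum_prod', ENNReal.tsum_comm]
      simp only [ENNReal.tsum_mul_right]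
      refine (ENNReal.tsum_le_tsum fun j => mul_le_mul_left (hcol j) _).trans ?_
      rw [ENNReal.tsum_mul_left]
      exact mul_le_mul_right (tsum_enorm_inner_sq_le b v) _
    · rw [ENNReal.tsum_prod']
      simp only [ENNReal.tsum_mul_right]
      refine (ENNReal.tsum_le_tsum fun j => mul_le_mul_left (hrow j) _).trans ?_
      rw [ENNReal.tsum_mul_left]
      exact mul_le_mul_right (tsum_enorm_inner_sq_le b w) _
  have hsum : ∀ v w, Summable (t v w) := fun v w =>
    Summable.of_enorm (ne_top_of_le_ne_top (by finiteness) (hle v w))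
  let f : H →ₗ⋆[ℂ] H →ₗ[ℂ] ℂ := LinearMap.mk₂'ₛₗ _ _ (fun v w => ∑' q, t v w q)
    (fun v v' w => by
      rw [← (hsum v w).tsum_add (hsum v' w)]
      exact tsum_congr fun q => by simp only [t, inner_add_left]; ring)
    (fun c v w => by
      rw [smul_eq_mul, ← tsum_mul_left]
      exact tsum_congr fun q => by simp only [t, inner_smul_left]; ring)
    (fun v w w' => by
      rw [← (hsum v w).tsum_add (hsum v w')]
      exact tsum_congr fun q => by simp only [t, inner_add_right]; ring)
    (fun c v w => by
      rw [smul_eq_mul, ← tsum_mul_left]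
      exact tsum_congr fun q => by simp only [t, inner_smul_right, RingHom.id_apply]; ring)
  have hf : ∀ v w, ‖f v w‖ ≤ K.toReal * ‖v‖ ^ 2 + K.toReal * ‖w‖ ^ 2 := fun v w => by
    have h3 := (enorm_tsum_le_tsum_enorm (f := t v w)).trans (hle v w)
    have h4 := ENNReal.toReal_mono (by finiteness) h3
    rw [ENNReal.toReal_add (by finiteness) (by finiteness)] at h4
    simpa [f] using h4
  have hf' : ∀ v w, ‖f v w‖ ≤ 2 * K.toReal * ‖v‖ * ‖w‖ := fun v w => by
    rcases eq_or_ne v 0 with rfl | hv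
    · simp
    rcases eq_or_ne w 0 with rfl | hw
    · simp
    have hv' : 0 < ‖v‖ := norm_pos_iff.2 hv
    have hw' : 0 < ‖w‖ := norm_pos_iff.2 hw
    -- Normalizing both vectors turns K (‖v‖² + ‖w‖²) into 2 K ‖v‖ ‖w‖.
    have h5 := hf (((‖v‖ : ℂ)⁻¹) • v) (((‖w‖ : ℂ)⁻¹) • w)
    simp only [map_smulₛₗ, LinearMap.smul_apply, smul_eq_mul, norm_mul, norm_smul, map_inv₀,
      Complex.conj_ofReal, norm_inv, Complex.norm_real, norm_norm, RingHom.id_apply,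
      inv_mul_cancel₀ hv'.ne', inv_mul_cancel₀ hw'.ne'] at h5
    rw [← mul_assoc, ← mul_inv, inv_mul_le_iff₀ (by positivity)] at h5
    nlinarith
  let B : H →L⋆[ℂ] H →L[ℂ] ℂ := f.mkContinuous₂ _ hf'
  refine ⟨InnerProductSpace.continuousLinearMapOfBilin B, fun i j => ?_, ?_⟩
  · classical
    rw [entry, ← inner_conj_symm, InnerProductSpace.continuousLinearMapOfBilin_apply]
    change conj (∑' q, t (b j) (b i) q) = k i j
    have ho := orthonormal_iff_ite.1 b.orthonormal
    rw [tsum_eq_single (i, j)]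
    · have hb : ∀ i, ‖b i‖ = 1 := b.orthonormal.1
      simp [t, hb]
    · rintro ⟨i', j'⟩ hne
      simp only [t, ho]
      by_cases h1 : i' = i
      · have : j ≠ j' := fun h => hne (by rw [h1, h])
        simp [this]
      · simp [h1]
  · refine ContinuousLinearMap.opNorm_le_bound _ (by positivity) fun v => ?_
    set w := InnerProductSpace.continuousLinearMapOfBilin B v with hw
    have h6 : ‖inner ℂ w w‖ ≤ 2 * K.toReal * ‖v‖ * ‖w‖ := by
      nth_rewrite 1 [hw]
      rw [InnerProductSpace.continuousLinearMapOfBilin_apply]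
      exact hf' v w
    rw [inner_self_eq_norm_sq_to_K, norm_pow] at h6
    simp only [Complex.coe_algebraMap, Complex.norm_real, norm_norm] at h6
    rcases (norm_nonneg w).eq_or_lt with h7 | h7
    · rw [← h7]; positivity
    · rw [sq] at h6
      exact le_of_mul_le_mul_right h6 h7

end Kernel

/-! ### Locality of polynomials in operators with decaying matrix elements -/

section Comparison

open scoped ENNReal

/-- The weight `exp t`, as an extended nonnegative number. -/
noncomputable def expWeight (t : ℝ) : ℝ≥0∞ := ENNReal.ofReal (Real.exp t)

theorem expWeight_add (s t : ℝ) : expWeight (s + t) = expWeight s * expWeight t := by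
  rw [expWeight, Real.exp_add, ENNReal.ofReal_mul (Real.exp_pos _).le, expWeight, expWeight]

theorem expWeight_mono {s t : ℝ} (h : s ≤ t) : expWeight s ≤ expWeight t :=
  ENNReal.ofReal_le_ofReal (Real.exp_le_exp.2 h)

theorem expWeight_ne_top (t : ℝ) : expWeight t ≠ ∞ := ENNReal.ofReal_ne_top

theorem one_le_expWeight {t : ℝ} (h : 0 ≤ t) : 1 ≤ expWeight t := by
  simpa [expWeight] using Real.one_le_exp h

variable {X : Set ℂ} {m : ℕ} {H : Type*} [NormedAddCommGroup H] [InnerProductSpace ℂ H]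
  (b : HilbertBasis (X × Fin m) ℂ H)

/-- Distance of the sites of two basis states. -/
noncomputable def siteDist (i j : X × Fin m) : ℝ := ‖(i.1 : ℂ) - (j.1 : ℂ)‖

theorem siteDist_nonneg (i j : X × Fin m) : 0 ≤ siteDist i j := norm_nonneg _

theorem siteDist_self (i : X × Fin m) : siteDist i i = 0 := by simp [siteDist]

theorem siteDist_triangle (i j k : X × Fin m) : siteDist i k ≤ siteDist i j + siteDist j k :=
  norm_sub_le_norm_sub_add_norm_sub _ _ _

/-- The row sums of the matrix of `A`, weighted by `exp (c * distance)`, are at most `K`. -/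
def RowBound (c : ℝ) (K : ℝ≥0∞) (A : H →L[ℂ] H) : Prop :=
  ∀ i, ∑' j, ‖entry b A i j‖ₑ * expWeight (c * siteDist i j) ≤ K

variable [CompleteSpace H]

theorem hasSum_entry_mul (A B : H →L[ℂ] H) (i j : X × Fin m) :
    HasSum (fun k => entry b A i k * entry b B k j) (entry b (A * B) i j) := by
  have := b.hasSum_inner_mul_inner (ContinuousLinearMap.adjoint A (b i)) (B (b j))
  simpa [ContinuousLinearMap.adjoint_inner_left, entry] using this

omit [CompleteSpace H] in
theorem entry_one_eq [DecidableEq (X × Fin m)] (i j : X × Fin m) :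
    entry b 1 i j = if i = j then 1 else 0 :=
  orthonormal_iff_ite.1 b.orthonormal i j

/-- By the triangle inequality the weight is submultiplicative along i → l → j, so weighted row sums
multiply. -/
theorem RowBound.tsum_pow_le {c : ℝ} (hc : 0 ≤ c) {K : ℝ≥0∞} {A : H →L[ℂ] H}
    (hA : RowBound b c K A) (n : ℕ) : RowBound b c (K ^ n) (A ^ n) := by
  classical
  intro i
  induction n with
  | zero =>
    simp only [pow_zero, entry_one_eq]
    rw [tsum_eq_single i fun j hj => by simp [hj.symm]]
    simp [siteDist_self, expWeight]
  | succ n ih =>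
    calc ∑' j, ‖entry b (A ^ (n + 1)) i j‖ₑ * expWeight (c * siteDist i j)
        ≤ ∑' j, ∑' l, (‖entry b (A ^ n) i l‖ₑ * expWeight (c * siteDist i l)) *
            (‖entry b A l j‖ₑ * expWeight (c * siteDist l j)) := by
          refine ENNReal.tsum_le_tsum fun j => ?_
          rw [pow_succ, ← (hasSum_entry_mul b (A ^ n) A i j).tsum_eq]
          refine (mul_le_mul_left enorm_tsum_le_tsum_enorm _).trans ?_
          rw [← ENNReal.tsum_mul_right]
          refine ENNReal.tsum_le_tsum fun l => ?_
          rw [enorm_mul, mul_mul_mul_comm, ← expWeight_add]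
          refine mul_le_mul_right (expWeight_mono ?_) _
          rw [← mul_add]
          exact mul_le_mul_of_nonneg_left (siteDist_triangle i l j) hc
      _ = ∑' l, (‖entry b (A ^ n) i l‖ₑ * expWeight (c * siteDist i l)) *
            ∑' j, (‖entry b A l j‖ₑ * expWeight (c * siteDist l j)) := by
          rw [ENNReal.tsum_comm]
          simp only [ENNReal.tsum_mul_left]
      _ ≤ ∑' l, (‖entry b (A ^ n) i l‖ₑ * expWeight (c * siteDist i l)) * K :=
          ENNReal.tsum_le_tsum fun l => mul_le_mul_right (hA l) _
      _ ≤ K ^ (n + 1) := by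
          rw [ENNReal.tsum_mul_right, pow_succ]
          exact mul_le_mul_left ih _

/-- `A` and `B` have the same matrix elements, up to the gauge transformation by the signs `g`,
between sites at distance at most `ρ` from the site of `i`. -/
def AgreeOnBall (g : X → ℤˣ) (i : X × Fin m) (ρ : ℝ) (A B : H →L[ℂ] H) : Prop :=
  ∀ j l, siteDist i j ≤ ρ → siteDist i l ≤ ρ →
    entry b A j l = ((g j.1 * g l.1 : ℤˣ) : ℤ) * entry b B j l

theorem enorm_sign_mul (u : ℤˣ) (z : ℂ) : ‖((u : ℤ) : ℂ) * z‖ₑ = ‖z‖ₑ := by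
  rcases Int.units_eq_one_or u with rfl | rfl <;> simp

theorem sign_mul_self (u : ℤˣ) : ((u : ℤ) : ℂ) * ((u : ℤ) : ℂ) = 1 := by
  rcases Int.units_eq_one_or u with rfl | rfl <;> simp

/-- The difference of the matrix elements of `A` and of the gauge transform of `B`. -/
noncomputable def gaugeDiff (g : X → ℤˣ) (A B : H →L[ℂ] H) (i j : X × Fin m) : ℂ :=
  entry b A i j - ((g i.1 * g j.1 : ℤˣ) : ℤ) * entry b B i j

/-- Telescoping, with B' the gauge transform of B: A^(n+1) - B'^(n+1) = (A^n - B'^n) A + B'^n (A -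
B'). The last factor is supported on pairs leaving the ball, so every path from i that uses it has
length at least ρ and carries the weight exp (c ρ). Each step adds 2 K^(n+1). -/
theorem gaugeDiff_pow_le {c : ℝ} (hc : 0 ≤ c) {K : ℝ≥0∞} {A B : H →L[ℂ] H}
    (hA : RowBound b c K A) (hB : RowBound b c K B) {g : X → ℤˣ} {i : X × Fin m} {ρ : ℝ}
    (h : AgreeOnBall b g i ρ A B) (n : ℕ) :
    ∑' j, ‖gaugeDiff b g (A ^ n) (B ^ n) i j‖ₑ * expWeight (c * max ρ (siteDist i j))
      ≤ 2 * n * K ^ n := by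
  classical
  induction n with
  | zero =>
    have : ∀ j, gaugeDiff b g (A ^ 0) (B ^ 0) i j = 0 := fun j => by
      rw [gaugeDiff, pow_zero, pow_zero, entry_one_eq]
      by_cases hij : i = j
      · subst hij; simp
      · simp [hij]
    rw [ENNReal.tsum_eq_zero.2 fun j => by rw [this]; simp]
    exact zero_le
  | succ n ih =>
    have hD : ∀ j, HasSum (fun l => gaugeDiff b g (A ^ n) (B ^ n) i l * entry b A l j +
        ((g i.1 * g l.1 : ℤˣ) : ℤ) * entry b (B ^ n) i l * gaugeDiff b g A B l j)
        (gaugeDiff b g (A ^ (n + 1)) (B ^ (n + 1)) i j) := fun j => by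
      have h1 := (hasSum_entry_mul b (A ^ n) A i j).sub
        ((hasSum_entry_mul b (B ^ n) B i j).mul_left (((g i.1 * g j.1 : ℤˣ) : ℤ) : ℂ))
      rw [← pow_succ, ← pow_succ] at h1
      refine h1.congr_fun ?_
      intro l
      have h2 := sign_mul_self (g l.1)
      simp only [gaugeDiff, Units.val_mul, Int.cast_mul]
      linear_combination ((g i.1 : ℤ) : ℂ) * ((g j.1 : ℤ) : ℂ) * entry b (B ^ n) i l *
        entry b B l j * (-h2)
    -- Either l and j are both in the ball and the difference vanishes, or the path i → l → j has
    -- length at least max ρ (siteDist i j).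
    have hw : ∀ l j, ‖gaugeDiff b g A B l j‖ₑ * expWeight (c * max ρ (siteDist i j)) ≤
        (‖entry b A l j‖ₑ + ‖entry b B l j‖ₑ) * expWeight (c * siteDist l j) *
          expWeight (c * siteDist i l) := fun l j => by
      by_cases hlj : siteDist i l ≤ ρ ∧ siteDist i j ≤ ρ
      · simp [gaugeDiff, h l j hlj.1 hlj.2]
      · rw [mul_assoc, ← expWeight_add]
        refine mul_le_mul' ?_ (expWeight_mono ?_)
        · refine (enorm_sub_le).trans ?_
          rw [enorm_sign_mul]
        · rw [← mul_add, add_comm]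
          refine mul_le_mul_of_nonneg_left (max_le ?_ (siteDist_triangle i l j)) hc
          by_contra hcon
          push Not at hcon
          exact hlj ⟨by linarith [siteDist_nonneg l j], by linarith [siteDist_triangle i l j]⟩
    calc ∑' j, ‖gaugeDiff b g (A ^ (n + 1)) (B ^ (n + 1)) i j‖ₑ *
          expWeight (c * max ρ (siteDist i j))
        ≤ ∑' j, ∑' l, ((‖gaugeDiff b g (A ^ n) (B ^ n) i l‖ₑ *
              expWeight (c * max ρ (siteDist i l))) *
                (‖entry b A l j‖ₑ * expWeight (c * siteDist l j)) +
            (‖entry b (B ^ n) i l‖ₑ * expWeight (c * siteDist i l)) *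
              ((‖entry b A l j‖ₑ + ‖entry b B l j‖ₑ) * expWeight (c * siteDist l j))) := by
          refine ENNReal.tsum_le_tsum fun j => ?_
          rw [← (hD j).tsum_eq]
          refine (mul_le_mul_left enorm_tsum_le_tsum_enorm _).trans ?_
          rw [← ENNReal.tsum_mul_right]
          refine ENNReal.tsum_le_tsum fun l => ?_
          refine (mul_le_mul_left (enorm_add_le _ _) _).trans ?_
          rw [add_mul]
          refine add_le_add ?_ ?_
          · rw [enorm_mul, mul_mul_mul_comm, ← expWeight_add, ← mul_add]
            refine mul_le_mul_right (expWeight_mono (mul_le_mul_of_nonneg_left (max_le ?_ ?_) hc)) _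
            · linarith [le_max_left ρ (siteDist i l), siteDist_nonneg l j]
            · linarith [le_max_right ρ (siteDist i l), siteDist_triangle i l j]
          · rw [enorm_mul, enorm_sign_mul, mul_assoc]
            refine (mul_le_mul_right (hw l j) _).trans_eq ?_
            ring
      _ = ∑' l, ((‖gaugeDiff b g (A ^ n) (B ^ n) i l‖ₑ *
              expWeight (c * max ρ (siteDist i l))) *
                ∑' j, (‖entry b A l j‖ₑ * expWeight (c * siteDist l j)) +
            (‖entry b (B ^ n) i l‖ₑ * expWeight (c * siteDist i l)) *
              (∑' j, ‖entry b A l j‖ₑ * expWeight (c * siteDist l j) +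
                ∑' j, ‖entry b B l j‖ₑ * expWeight (c * siteDist l j))) := by
          rw [ENNReal.tsum_comm]
          simp only [ENNReal.tsum_add, ENNReal.tsum_mul_left, add_mul]
      _ ≤ ∑' l, ((‖gaugeDiff b g (A ^ n) (B ^ n) i l‖ₑ *
              expWeight (c * max ρ (siteDist i l))) * K +
            (‖entry b (B ^ n) i l‖ₑ * expWeight (c * siteDist i l)) * (K + K)) :=
          ENNReal.tsum_le_tsum fun l => add_le_add (mul_le_mul_right (hA l) _)
            (mul_le_mul_right (add_le_add (hA l) (hB l)) _)
      _ ≤ 2 * n * K ^ n * K + K ^ n * (K + K) := by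
          rw [ENNReal.tsum_add, ENNReal.tsum_mul_right, ENNReal.tsum_mul_right]
          exact add_le_add (mul_le_mul_left ih _) (mul_le_mul_left (hB.tsum_pow_le b hc n i) _)
      _ = 2 * (n + 1 : ℕ) * K ^ (n + 1) := by
          push_cast; ring

/-- The constant depends on h, c and K only, not on the operators, the signs, the site or the
radius; the later bounds uniform in the flux positions rest on this. -/
theorem exists_gaugeDiff_aeval_le (h : Polynomial ℝ) {c : ℝ} (hc : 0 ≤ c) {K : ℝ≥0∞}
    (hK : K ≠ ∞) : ∃ C : ℝ≥0∞, C ≠ ∞ ∧ ∀ (A B : H →L[ℂ] H), RowBound b c K A → RowBound b c K B →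
      ∀ (g : X → ℤˣ) (i : X × Fin m) (ρ : ℝ), AgreeOnBall b g i ρ A B →
        ∑' j, ‖gaugeDiff b g (Polynomial.aeval A h) (Polynomial.aeval B h) i j‖ₑ *
          expWeight (c * max ρ (siteDist i j)) ≤ C := by
  induction h using Polynomial.induction_on' with
  | add p q hp hq =>
    obtain ⟨C, hC, h1⟩ := hp
    obtain ⟨C', hC', h2⟩ := hq
    refine ⟨C + C', by finiteness, fun A B hA hB g i ρ h => ?_⟩
    refine le_trans ?_ (add_le_add (h1 A B hA hB g i ρ h) (h2 A B hA hB g i ρ h))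
    rw [← ENNReal.tsum_add]
    refine ENNReal.tsum_le_tsum fun j => ?_
    rw [← add_mul]
    refine mul_le_mul_left (le_trans (le_of_eq ?_) (enorm_add_le _ _)) _
    simp only [gaugeDiff, map_add, entry_add]
    ring_nf
  | monomial n a =>
    refine ⟨‖a‖ₑ * (2 * n * K ^ n), by finiteness, fun A B hA hB g i ρ h => ?_⟩
    refine le_trans (le_of_eq ?_) (mul_le_mul_right (gaugeDiff_pow_le b hc hA hB h n) ‖a‖ₑ)
    rw [← ENNReal.tsum_mul_left]
    refine tsum_congr fun j => ?_
    have h1 : ∀ A : H →L[ℂ] H, entry b (Polynomial.aeval A (Polynomial.monomial n a)) i j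
        = (a : ℂ) * entry b (A ^ n) i j := fun A => by
      rw [Polynomial.aeval_monomial, Algebra.algebraMap_eq_smul_one, smul_mul_assoc, one_mul,
        RCLike.real_smul_eq_coe_smul (K := ℂ)]
      simp [entry]
    have h2 : ‖(a : ℂ)‖ₑ = ‖a‖ₑ := by
      rw [← ofReal_norm, Complex.norm_real, ofReal_norm]
    rw [← h2, ← mul_assoc, ← enorm_mul, gaugeDiff, h1, h1, gaugeDiff]
    ring_nf

end Comparison

/-! ### Half fluxes from half angles, and asymptotic equivalence -/

section HalfAngle

/-- The sign of the real part of a complex number. -/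
noncomputable def reSign (z : ℂ) : ℤˣ := if z.re < 0 then -1 else 1

theorem reSign_conj (z : ℂ) : reSign (conj z) = reSign z := by simp [reSign]

theorem norm_sub_sign_mul_sq {a c : ℂ} (ha : ‖a‖ = 1) (hc : ‖c‖ = 1) (u : ℤˣ) :
    ‖a - (u : ℤ) * c‖ ^ 2 = 2 - 2 * ((u : ℤ) * (conj a * c).re) := by
  have ha' : a.re ^ 2 + a.im ^ 2 = 1 := by
    rw [← Complex.sq_norm_sub_sq_re a, ha]; ring
  have hc' : c.re ^ 2 + c.im ^ 2 = 1 := by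
    rw [← Complex.sq_norm_sub_sq_re c, hc]; ring
  rw [← Complex.normSq_eq_norm_sq, Complex.normSq_apply]
  rcases Int.units_eq_one_or u with rfl | rfl <;>
  · simp
    linear_combination ha' + hc'

theorem reSign_eq_of_norm_sub_lt {a c : ℂ} (ha : ‖a‖ = 1) (hc : ‖c‖ = 1) {u : ℤˣ}
    (h : ‖a - (u : ℤ) * c‖ < 1) : reSign (conj a * c) = u := by
  have h1 := norm_sub_sign_mul_sq ha hc u
  have h2 : ‖a - (u : ℤ) * c‖ ^ 2 < 1 := by
    rw [sq_lt_one_iff₀ (norm_nonneg _)]; exact h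
  rcases Int.units_eq_one_or u with rfl | rfl
  · simp only [Units.val_one, Int.cast_one, one_mul] at h1 h2
    rw [reSign, if_neg (by linarith)]
  · simp only [Units.val_neg, Units.val_one, Int.cast_neg, Int.cast_one, neg_mul, one_mul] at h1 h2
    rw [reSign, if_pos (by linarith)]

/-- Square roots of nearby unit numbers are near up to sign: a² - c² = (a - u c)(a + u c), and for
the sign u of Re (conj a · c) the second factor has norm at least 1. -/
theorem norm_sub_reSign_mul_le {a c : ℂ} (ha : ‖a‖ = 1) (hc : ‖c‖ = 1) :
    ‖a - (reSign (conj a * c) : ℤ) * c‖ ≤ ‖a ^ 2 - c ^ 2‖ := by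
  set u := reSign (conj a * c) with hu
  have h1 : a ^ 2 - c ^ 2 = (a - (u : ℤ) * c) * (a - ((-u : ℤˣ) : ℤ) * c) := by
    rcases Int.units_eq_one_or u with h | h <;> rw [h] <;> simp <;> ring
  have h2 := norm_sub_sign_mul_sq ha hc (-u)
  have h3 : 0 ≤ ((u : ℤ) : ℝ) * (conj a * c).re := by
    rw [hu, reSign]
    split_ifs with h
    · simp only [Units.val_neg, Units.val_one, Int.cast_neg, Int.cast_one]; linarith
    · simp only [Units.val_one, Int.cast_one]; linarith
  have h4 : 1 ≤ ‖a - ((-u : ℤˣ) : ℤ) * c‖ := by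
    rw [← one_le_sq_iff₀ (norm_nonneg _), h2, Units.val_neg, Int.cast_neg]
    linarith
  rw [h1, norm_mul]
  exact le_mul_of_one_le_right (norm_nonneg _) h4

/-- With the optimal signs on three sides of a quadrilateral, the fourth pair is within 3/4 < 1 for
the product sign, which is therefore the optimal one. -/
theorem reSign_mul_reSign {a c a' c' : ℂ} (ha : ‖a‖ = 1) (hc : ‖c‖ = 1) (ha' : ‖a'‖ = 1)
    (hc' : ‖c'‖ = 1) (h1 : ‖a ^ 2 - c ^ 2‖ ≤ 1 / 4) (h2 : ‖a ^ 2 - a' ^ 2‖ ≤ 1 / 4)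
    (h3 : ‖c ^ 2 - c' ^ 2‖ ≤ 1 / 4) :
    reSign (conj a' * c')
      = reSign (conj a * a') * reSign (conj c * c') * reSign (conj a * c) := by
  refine reSign_eq_of_norm_sub_lt ha' hc' ?_
  have e1 := (norm_sub_reSign_mul_le ha hc).trans h1
  have e2 := (norm_sub_reSign_mul_le ha ha').trans h2
  have e3 := (norm_sub_reSign_mul_le hc hc').trans h3
  generalize reSign (conj a * a') = u at *
  generalize reSign (conj c * c') = v at *
  generalize reSign (conj a * c) = w at *
  have e4 : a' - ((u * v * w : ℤˣ) : ℤ) * c' = -(u : ℤ) * ((a - (u : ℤ) * a') - (a - (w : ℤ) * c)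
      - (w : ℤ) * (c - (v : ℤ) * c')) := by
    have hu := sign_mul_self u
    simp only [Units.val_mul, Int.cast_mul]
    linear_combination (-a') * hu
  have hn : ∀ u : ℤˣ, ‖((u : ℤ) : ℂ)‖ = 1 := fun u => by
    rcases Int.units_eq_one_or u with rfl | rfl <;> simp
  rw [e4, norm_mul, norm_neg, hn, one_mul]
  refine (norm_sub_le _ _).trans_lt ?_
  rw [norm_mul, hn, one_mul]
  linarith [norm_sub_le (a - (u : ℤ) * a') (a - (w : ℤ) * c)]

theorem norm_div_norm_sub_le {u v : ℂ} (hu : u ≠ 0) (hv : v ≠ 0) :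
    ‖u / ‖u‖ - v / ‖v‖‖ ≤ 2 * ‖u - v‖ / ‖u‖ := by
  have hu' : 0 < ‖u‖ := norm_pos_iff.2 hu
  have hv' : 0 < ‖v‖ := norm_pos_iff.2 hv
  have hu0 : (‖u‖ : ℂ) ≠ 0 := by exact_mod_cast hu'.ne'
  have hv0 : (‖v‖ : ℂ) ≠ 0 := by exact_mod_cast hv'.ne'
  have h1 : u / ‖u‖ - v / ‖v‖ = ((u - v) + (v / ‖v‖) * ((‖v‖ - ‖u‖ : ℝ) : ℂ)) / ‖u‖ := by
    push_cast
    field_simp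
    ring
  rw [h1, norm_div, Complex.norm_real, norm_norm]
  refine div_le_div_of_nonneg_right ((norm_add_le _ _).trans ?_) hu'.le
  rw [norm_mul, norm_div, Complex.norm_real, Complex.norm_real, norm_norm, div_self hv'.ne',
    one_mul, Real.norm_eq_abs]
  have := abs_norm_sub_norm_le v u
  rw [norm_sub_rev v u] at this
  linarith

variable {X : Set ℂ}

/-- `h x` is a unit complex number in the direction of half of the angle of `x - p`. -/
structure IsHalfAngle (p : ℂ) (h : X → ℂ) : Prop where
  norm_eq_one : ∀ x, ‖h x‖ = 1
  sq_eq : ∀ x : X, (x : ℂ) ≠ p → h x ^ 2 = ((x : ℂ) - p) / ‖(x : ℂ) - p‖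

/-- The signs of the half flux with the half angle function `h`. -/
noncomputable def fluxSign (h : X → ℂ) (x y : X) : ℤˣ := reSign (conj (h x) * h y)

theorem fluxSign_symm (h : X → ℂ) (x y : X) : fluxSign h y x = fluxSign h x y := by
  rw [fluxSign, fluxSign, ← reSign_conj]
  simp [mul_comm]

theorem reSign_conj_mul_self (z : ℂ) : reSign (conj z * z) = 1 := by
  rw [reSign, if_neg]
  rw [mul_comm, Complex.mul_conj, Complex.ofReal_re]
  exact not_lt.2 (Complex.normSq_nonneg z)

theorem fluxSign_self (h : X → ℂ) (x : X) : fluxSign h x x = 1 := reSign_conj_mul_self _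

theorem IsHalfAngle.norm_sq_sub_sq_le {p q : ℂ} {h k : X → ℂ} (hh : IsHalfAngle p h)
    (hk : IsHalfAngle q k) {x y : X} (hx : (x : ℂ) ≠ p) (hy : (y : ℂ) ≠ q) :
    ‖h x ^ 2 - k y ^ 2‖ ≤ 2 * ‖((x : ℂ) - p) - ((y : ℂ) - q)‖ / ‖(x : ℂ) - p‖ := by
  rw [hh.sq_eq x hx, hk.sq_eq y hy]
  exact norm_div_norm_sub_le (sub_ne_zero.2 hx) (sub_ne_zero.2 hy)

/-- The gauge aligns each half angle with the one at x. Radius 1/8 of the distance to p keeps the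
squared half angles within the 1/4 that `reSign_mul_reSign` needs. -/
theorem IsHalfAngle.locally_trivial {p : ℂ} {h : X → ℂ} (hh : IsHalfAngle p h) (x : X) :
    ∃ g : X → ℤˣ, ∀ y z : X, ‖(x : ℂ) - y‖ ≤ ‖(x : ℂ) - p‖ / 8 →
      ‖(x : ℂ) - z‖ ≤ ‖(x : ℂ) - p‖ / 8 → fluxSign h y z = g y * g z := by
  refine ⟨fun y => reSign (conj (h x) * h y), fun y z hy hz => ?_⟩
  -- For x = p the radius is 0 and the ball contains only x.
  rcases eq_or_ne (x : ℂ) p with hxp | hxp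
  · have h0 : ∀ y : X, ‖(x : ℂ) - y‖ ≤ ‖(x : ℂ) - p‖ / 8 → y = x := fun y hy => by
      rw [hxp, sub_self, norm_zero, zero_div, norm_le_zero_iff, sub_eq_zero, ← hxp] at hy
      exact Subtype.ext hy.symm
    rw [h0 y hy, h0 z hz, fluxSign_self]
    simp only [reSign_conj_mul_self, one_mul]
  have hpos : 0 < ‖(x : ℂ) - p‖ := norm_pos_iff.2 (sub_ne_zero.2 hxp)
  have h1 : ∀ y : X, ‖(x : ℂ) - y‖ ≤ ‖(x : ℂ) - p‖ / 8 → ‖h x ^ 2 - h y ^ 2‖ ≤ 1 / 4 :=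
    fun y hy => by
      have hyp : (y : ℂ) ≠ p := fun h => by
        rw [h] at hy; linarith
      refine (hh.norm_sq_sub_sq_le hh hxp hyp).trans ?_
      rw [sub_sub_sub_cancel_right, div_le_iff₀ hpos]
      linarith
  rw [fluxSign, reSign_mul_reSign (hh.norm_eq_one x) (hh.norm_eq_one x) (hh.norm_eq_one y)
    (hh.norm_eq_one z) (by simp) (h1 y hy) (h1 z hz), reSign_conj_mul_self, mul_one]

/-- The signs `s` and `s'` agree up to a gauge transformation, except between sites whose
distance is comparable to their distance from the origin. -/
def AsympEquiv (s s' : X → X → ℤˣ) : Prop :=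
  ∃ (g : X → ℤˣ) (κ R : ℝ), 0 < κ ∧
    ∀ x y, s' x y ≠ g x * g y * s x y → κ * ‖(x : ℂ)‖ ≤ ‖(x : ℂ) - y‖ + R

theorem sign_mul_cancel (u v : ℤˣ) : u * (u * v) = v := by
  rw [← mul_assoc, Int.units_mul_self, one_mul]

theorem AsympEquiv.trans {s s' s'' : X → X → ℤˣ} (h : AsympEquiv s s') (h' : AsympEquiv s' s'') :
    AsympEquiv s s'' := by
  obtain ⟨g, κ, R, hκ, h1⟩ := h
  obtain ⟨g', κ', R', hκ', h2⟩ := h'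
  refine ⟨fun x => g' x * g x, min κ κ', max R R', lt_min hκ hκ', fun x y hne => ?_⟩
  by_cases h3 : s' x y = g x * g y * s x y
  · have := h2 x y fun h4 => hne (by rw [h4, h3]; simp only [mul_assoc, mul_left_comm])
    have h5 := mul_le_mul_of_nonneg_right (min_le_right κ κ') (norm_nonneg (x : ℂ))
    linarith [le_max_right R R']
  · have := h1 x y h3
    have h5 := mul_le_mul_of_nonneg_right (min_le_left κ κ') (norm_nonneg (x : ℂ))
    linarith [le_max_left R R']

/-- Seen from p and from q, a distant site lies in nearly the same direction; the gauge compares the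
two half angles at each site. -/
theorem IsHalfAngle.asympEquiv {p q : ℂ} {h k : X → ℂ} (hh : IsHalfAngle p h)
    (hk : IsHalfAngle q k) : AsympEquiv (fluxSign h) (fluxSign k) := by
  -- The constants make |x - y| and |p - q| at most an eighth of the relevant distances from p.
  refine ⟨fun x => reSign (conj (h x) * k x), 1 / 16, 2 * (‖p‖ + ‖p - q‖), by norm_num,
    fun x y hne => ?_⟩
  by_contra! hlt
  refine hne ?_
  have n0 := norm_nonneg p
  have n1 := norm_nonneg (p - q)
  have n2 := norm_nonneg ((x : ℂ) - y)
  have hx1 : ‖(x : ℂ)‖ - ‖p‖ ≤ ‖(x : ℂ) - p‖ := norm_sub_norm_le _ _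
  have hy1 : ‖(x : ℂ)‖ - ‖(x : ℂ) - y‖ - ‖p‖ ≤ ‖(y : ℂ) - p‖ := by
    have h1 := norm_sub_norm_le (x : ℂ) (y : ℂ)
    have h2 := norm_sub_norm_le (y : ℂ) p
    linarith
  have hxp : 0 < ‖(x : ℂ) - p‖ := by linarith
  have hyp : 0 < ‖(y : ℂ) - p‖ := by linarith
  have hxq : (x : ℂ) ≠ q := fun h => by rw [h, norm_sub_rev] at hx1; rw [h] at hlt n2; linarith
  have hyq : (y : ℂ) ≠ q := fun h => by rw [h, norm_sub_rev q] at hy1; rw [h] at hlt n2; linarith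
  have hxp' := sub_ne_zero.1 (norm_pos_iff.1 hxp)
  have hyp' := sub_ne_zero.1 (norm_pos_iff.1 hyp)
  refine reSign_mul_reSign (hh.norm_eq_one x) (hh.norm_eq_one y) (hk.norm_eq_one x)
    (hk.norm_eq_one y) ?_ ?_ ?_
  · refine (hh.norm_sq_sub_sq_le hh hxp' hyp').trans ?_
    rw [sub_sub_sub_cancel_right, div_le_iff₀ hxp]
    linarith
  · refine (hh.norm_sq_sub_sq_le hk hxp' hxq).trans ?_
    rw [sub_sub_sub_cancel_left, div_le_iff₀ hxp, norm_sub_rev]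
    linarith
  · refine (hh.norm_sq_sub_sq_le hk hyp' hyq).trans ?_
    rw [sub_sub_sub_cancel_left, div_le_iff₀ hyp, norm_sub_rev]
    linarith

/-- A particular choice of half angles. -/
noncomputable def halfAngle (p : ℂ) (x : X) : ℂ :=
  Complex.exp (((Complex.arg ((x : ℂ) - p) / 2 : ℝ) : ℂ) * Complex.I)

theorem exp_half_sq (t : ℝ) :
    Complex.exp (((t / 2 : ℝ) : ℂ) * Complex.I) ^ 2 = Complex.exp (t * Complex.I) := by
  rw [← Complex.exp_nat_mul]
  push_cast
  ring_nf

theorem exp_arg_mul_I {z : ℂ} (hz : z ≠ 0) : Complex.exp (Complex.arg z * Complex.I) = z / ‖z‖ := by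
  have : (‖z‖ : ℂ) ≠ 0 := by exact_mod_cast norm_ne_zero_iff.2 hz
  rw [eq_div_iff this, mul_comm, Complex.norm_mul_exp_arg_mul_I]

theorem isHalfAngle_halfAngle (p : ℂ) : IsHalfAngle p (halfAngle p : X → ℂ) where
  norm_eq_one x := Complex.norm_exp_ofReal_mul_I _
  sq_eq x hx := by rw [halfAngle, exp_half_sq, exp_arg_mul_I (sub_ne_zero.2 hx)]

end HalfAngle

/-! ### The three-sector construction is a half flux -/

section Topological

variable {X : Set ℂ}

/-- The signs of a partition: `1` within a part and `-1` between different parts. -/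
def sectorSign (c : X → Fin 3) (x y : X) : ℤˣ := if c x = c y then 1 else -1

theorem norm_exp_sub_exp (s t : ℝ) :
    ‖Complex.exp (s * Complex.I) - Complex.exp (t * Complex.I)‖ = 2 * |Real.sin ((s - t) / 2)| := by
  have h1 : Complex.exp (s * Complex.I) - Complex.exp (t * Complex.I)
      = Complex.exp (((s + t) / 2 : ℝ) * Complex.I) *
        (2 * (Real.sin ((s - t) / 2) : ℂ) * Complex.I) := by
    have h2 : 2 * (Real.sin ((s - t) / 2) : ℂ) * Complex.I
        = Complex.exp (((s - t) / 2 : ℝ) * Complex.I) -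
          Complex.exp (-((s - t) / 2 : ℝ) * Complex.I) := by
      rw [Complex.ofReal_sin, Complex.sin]
      linear_combination (Complex.exp (-((s - t) / 2 : ℝ) * Complex.I) -
        Complex.exp (((s - t) / 2 : ℝ) * Complex.I)) * Complex.I_mul_I
    rw [h2, mul_sub, ← Complex.exp_add, ← Complex.exp_add]
    congr 2 <;> push_cast <;> ring
  rw [h1, norm_mul, Complex.norm_exp_ofReal_mul_I, one_mul, norm_mul, norm_mul, Complex.norm_I,
    mul_one, Complex.norm_real, Real.norm_eq_abs, Complex.norm_ofNat]

theorem sin_half_le {δ D : ℝ} (hδ0 : 0 ≤ δ) (hδ : δ ≤ Real.pi) (h1 : δ ≤ D)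
    (h2 : D ≤ 2 * Real.pi - δ) : Real.sin (δ / 2) ≤ Real.sin (D / 2) := by
  rcases le_total D Real.pi with h | h
  · exact Real.sin_le_sin_of_le_of_le_pi_div_two (by linarith) (by linarith) (by linarith)
  · rw [← Real.sin_pi_sub (D / 2)]
    exact Real.sin_le_sin_of_le_of_le_pi_div_two (by linarith) (by linarith) (by linarith)

/-- The gauge transformation comparing three sectors with a half flux. -/
def sectorGauge (a : Fin 3) : ℤˣ := if a = 1 then -1 else 1

/-- With half angles cut along the ray θ₀, neighbouring directions in sectors 0 and 2 already have
flux sign -1. Changing the sign of the middle sector produces the -1 across the other two rays. -/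
theorem asympEquiv_sectorSign {p : ℂ} {θ₀ θ₁ θ₂ : ℝ} {c : X → Fin 3}
    (hc : IsSectorPartition p θ₀ θ₁ θ₂ c) :
    ∃ h : X → ℂ, IsHalfAngle p h ∧ AsympEquiv (fluxSign h) (sectorSign c) := by
  obtain ⟨h01, h12, h20, hx⟩ := hc
  choose r t hr hxt hct using hx
  have hπ := Real.pi_pos
  have hrange : ∀ x, θ₀ ≤ t x ∧ t x ≤ θ₀ + 2 * Real.pi := fun x => by
    rcases hct x with ⟨-, h⟩ | ⟨-, h⟩ | ⟨-, h⟩ <;> constructor <;> linarith [h.1, h.2]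
  have hh : IsHalfAngle p (fun x => Complex.exp (((t x / 2 : ℝ) : ℂ) * Complex.I)) := by
    refine ⟨fun x => Complex.norm_exp_ofReal_mul_I _, fun x hxp => ?_⟩
    have h1 : (x : ℂ) - p = r x * Complex.exp (t x * Complex.I) := by
      rw [sub_eq_iff_eq_add']; exact hxt x
    have h2 : ‖(x : ℂ) - p‖ = r x := by
      rw [h1, norm_mul, Complex.norm_exp_ofReal_mul_I, mul_one, Complex.norm_real,
        Real.norm_of_nonneg (hr x)]
    have h3 : (r x : ℂ) ≠ 0 := by
      intro h0
      rw [h0, zero_mul] at h1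
      exact hxp (sub_eq_zero.1 h1)
    rw [exp_half_sq, h2, h1, mul_div_cancel_left₀ _ h3]
  refine ⟨_, hh, ?_⟩
  -- With δ at most each opening angle, directions closer than δ lie in the same or in adjacent
  -- sectors.
  obtain ⟨δ, hδ0, hδπ, hδ1, hδ2, hδ3⟩ : ∃ δ : ℝ, 0 < δ ∧ δ ≤ Real.pi ∧ δ ≤ θ₁ - θ₀ ∧ δ ≤ θ₂ - θ₁ ∧
      δ ≤ θ₀ + 2 * Real.pi - θ₂ := by
    refine ⟨min Real.pi (min (θ₁ - θ₀) (min (θ₂ - θ₁) (θ₀ + 2 * Real.pi - θ₂))), ?_, ?_, ?_, ?_, ?_⟩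
    · exact lt_min hπ (lt_min (by linarith) (lt_min (by linarith) (by linarith)))
    all_goals simp
  have hsin : 0 < Real.sin (δ / 2) := Real.sin_pos_of_pos_of_lt_pi (by linarith) (by linarith)
  refine ⟨fun x => sectorGauge (c x), Real.sin (δ / 2) / 2, Real.sin (δ / 2) / 2 * ‖p‖,
    by positivity, fun x y hne => ?_⟩
  by_contra! hlt
  refine hne ?_
  have hclose : ‖(x : ℂ) - y‖ < Real.sin (δ / 2) / 2 * ‖(x : ℂ) - p‖ := by
    have := norm_sub_norm_le (x : ℂ) p
    nlinarith
  have hpos : 0 < ‖(x : ℂ) - p‖ := by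
    by_contra! h0
    have := norm_nonneg ((x : ℂ) - y)
    nlinarith
  have hxp : (x : ℂ) ≠ p := sub_ne_zero.1 (norm_pos_iff.1 hpos)
  have hyp : (y : ℂ) ≠ p := fun h0 => by
    rw [h0] at hclose
    have := Real.sin_le_one (δ / 2)
    nlinarith
  have hbound := hh.norm_sq_sub_sq_le hh hxp hyp
  rw [sub_sub_sub_cancel_right, exp_half_sq, exp_half_sq, norm_exp_sub_exp, le_div_iff₀ hpos]
    at hbound
  have hsmall : |Real.sin ((t x - t y) / 2)| < Real.sin (δ / 2) := by nlinarith
  have hflux : fluxSign (fun x => Complex.exp (((t x / 2 : ℝ) : ℂ) * Complex.I)) x y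
      = if Real.cos ((t x - t y) / 2) < 0 then -1 else 1 := by
    rw [fluxSign, reSign]
    have : (conj (Complex.exp (((t x / 2 : ℝ) : ℂ) * Complex.I)) *
        Complex.exp (((t y / 2 : ℝ) : ℂ) * Complex.I)).re = Real.cos ((t x - t y) / 2) := by
      rw [← Complex.exp_conj, ← Complex.exp_add, map_mul, Complex.conj_ofReal, Complex.conj_I,
        show ((t x / 2 : ℝ) : ℂ) * -Complex.I + ((t y / 2 : ℝ) : ℂ) * Complex.I
          = ((-((t x - t y) / 2) : ℝ) : ℂ) * Complex.I by push_cast; ring,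
        Complex.exp_ofReal_mul_I_re, Real.cos_neg]
    simp only [this]
  have key : ∀ x y : X, t x ≤ t y → |Real.sin ((t x - t y) / 2)| < Real.sin (δ / 2) →
      sectorSign c x y = sectorGauge (c x) * sectorGauge (c y) *
        (if Real.cos ((t x - t y) / 2) < 0 then -1 else 1) := by
    intro x y hle hs
    have hD : |Real.sin ((t x - t y) / 2)| = Real.sin ((t y - t x) / 2) := by
      rw [show (t x - t y) / 2 = -((t y - t x) / 2) by ring, Real.sin_neg, abs_neg,
        abs_of_nonneg (Real.sin_nonneg_of_nonneg_of_le_pi (by linarith)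
          (by linarith [(hrange x).1, (hrange y).2]))]
    rw [hD] at hs
    have hcos : Real.cos ((t x - t y) / 2) = Real.cos ((t y - t x) / 2) := by
      rw [show (t x - t y) / 2 = -((t y - t x) / 2) by ring, Real.cos_neg]
    rw [hcos]
    -- A small sine leaves two cases: angles closer than δ without crossing the cut, or differing by
    -- more than 2π - δ, on the two sides of the ray θ₀.
    rcases lt_or_ge (t y - t x) δ with h | h
    · have h0 : ¬ Real.cos ((t y - t x) / 2) < 0 :=
        not_lt.2 (Real.cos_nonneg_of_neg_pi_div_two_le_of_le (by linarith) (by linarith))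
      rw [if_neg h0]
      rcases hct x with ⟨hcx, hx⟩ | ⟨hcx, hx⟩ | ⟨hcx, hx⟩ <;>
      rcases hct y with ⟨hcy, hy⟩ | ⟨hcy, hy⟩ | ⟨hcy, hy⟩ <;>
      first
        | (simp [sectorSign, sectorGauge, hcx, hcy]; done)
        | (exfalso; linarith [hx.1, hx.2, hy.1, hy.2])
    · have h' : 2 * Real.pi - δ < t y - t x := by
        by_contra! h2
        exact absurd (sin_half_le hδ0.le hδπ h h2) (not_le.2 hs)
      have h0 : Real.cos ((t y - t x) / 2) < 0 := by
        refine Real.cos_neg_of_pi_div_two_lt_of_lt (by linarith) ?_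
        linarith [(hrange x).1, (hrange y).2]
      rw [if_pos h0]
      rcases hct x with ⟨hcx, hx⟩ | ⟨hcx, hx⟩ | ⟨hcx, hx⟩ <;>
      rcases hct y with ⟨hcy, hy⟩ | ⟨hcy, hy⟩ | ⟨hcy, hy⟩ <;>
      first
        | (exfalso; linarith [hx.1, hx.2, hy.1, hy.2])
        | simp [sectorSign, sectorGauge, hcx, hcy]
  rw [hflux]
  rcases le_total (t x) (t y) with h | h
  · exact key x y h hsmall
  · have e1 : (t y - t x) / 2 = -((t x - t y) / 2) := by ring
    have := key y x h (by rw [e1, Real.sin_neg, abs_neg]; exact hsmall)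
    rw [e1, Real.cos_neg] at this
    rw [mul_comm (sectorGauge (c x)), ← this]
    simp [sectorSign, eq_comm]

end Topological

/-! ### Signs with trivial holonomy are gauge transformations -/

section Potential

variable {X : Type*}

/-- `SignPath r t x y u`: there is an `r`-path from `x` to `y` along which the product of the
signs `t` is `u`. -/
inductive SignPath (r : X → X → Prop) (t : X → X → ℤˣ) (x : X) : X → ℤˣ → Prop
  | refl : SignPath r t x x 1
  | snoc {y z : X} {u : ℤˣ} : SignPath r t x y u → r y z → SignPath r t x z (u * t y z)

variable {r : X → X → Prop} {t : X → X → ℤˣ}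

theorem SignPath.trans {x y z : X} {u v : ℤˣ} (h : SignPath r t x y u) (h' : SignPath r t y z v) :
    SignPath r t x z (u * v) := by
  induction h' with
  | refl => simpa using h
  | snoc _ hr ih => rw [← mul_assoc]; exact ih.snoc hr

theorem SignPath.symm (hr : ∀ x y, r x y → r y x) (ht : ∀ x y, t y x = t x y) {x y : X} {u : ℤˣ}
    (h : SignPath r t x y u) : SignPath r t y x u := by
  induction h with
  | refl => exact .refl
  | snoc _ h ih =>
    rw [mul_comm]
    refine SignPath.trans ?_ ih
    simpa [ht] using (SignPath.refl (r := r) (t := t)).snoc (hr _ _ h)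

theorem SignPath.exists_seq {x y : X} {u : ℤˣ} (h : SignPath r t x y u) :
    ∃ (n : ℕ) (f : ℕ → X), f 0 = x ∧ f n = y ∧ (∀ i < n, r (f i) (f (i + 1))) ∧
      ∏ i ∈ Finset.range n, t (f i) (f (i + 1)) = u := by
  induction h with
  | refl => exact ⟨0, fun _ => x, rfl, rfl, by simp, by simp⟩
  | @snoc y z u _ hr ih =>
    obtain ⟨n, f, h0, hn, hf, hp⟩ := ih
    have hlt : ∀ i ≤ n, (if i ≤ n then f i else z) = f i := fun i hi => if_pos hi
    refine ⟨n + 1, fun i => if i ≤ n then f i else z, by simp [h0], by simp, fun i hi => ?_, ?_⟩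
    · rcases (Nat.lt_succ_iff.1 hi).lt_or_eq with h | h
      · simpa [h.le, Nat.succ_le_of_lt h] using hf i h
      · simpa [h, hn] using hr
    · rw [Finset.prod_range_succ, ← hp]
      congr 1
      · refine Finset.prod_congr rfl fun i hi => ?_
        have := Finset.mem_range.1 hi
        simp [this.le, Nat.succ_le_of_lt this]
      · simp [hn]

/-- Discrete Poincaré lemma: g x is the sign along any path to x from a chosen representative of its
component. Trivial loops make it independent of the path; connectedness is not needed. -/
theorem exists_potential (hr : ∀ x y, r x y → r y x) (ht : ∀ x y, t y x = t x y)
    (hloop : ∀ (n : ℕ) (f : ℕ → X), f 0 = f n → (∀ i < n, r (f i) (f (i + 1))) →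
      ∏ i ∈ Finset.range n, t (f i) (f (i + 1)) = 1) :
    ∃ g : X → ℤˣ, ∀ x y, r x y → t x y = g x * g y := by
  have huniq : ∀ {x y : X} {u v : ℤˣ}, SignPath r t x y u → SignPath r t x y v → u = v := by
    intro x y u v hu hv
    obtain ⟨n, f, h0, hn, hf, hp⟩ := (hu.trans (hv.symm hr ht)).exists_seq
    rw [hloop n f (h0.trans hn.symm) hf] at hp
    rw [← mul_one u, hp, sign_mul_cancel]
  let S : Setoid X :=
    ⟨fun x y => ∃ u, SignPath r t x y u, fun x => ⟨1, .refl⟩,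
      fun ⟨u, h⟩ => ⟨u, h.symm hr ht⟩, fun ⟨u, h⟩ ⟨v, h'⟩ => ⟨u * v, h.trans h'⟩⟩
  have hrep : ∀ x : X, ∃ u, SignPath r t (Quotient.mk S x).out x u := fun x =>
    Quotient.mk_out (s := S) x
  choose g hg using hrep
  refine ⟨g, fun x y hxy => ?_⟩
  have h1 : (Quotient.mk S x) = Quotient.mk S y :=
    Quotient.sound ⟨_, SignPath.refl.snoc hxy⟩
  have h2 := (hg x).snoc hxy
  rw [h1] at h2
  rw [huniq (hg y) h2, sign_mul_cancel]

end Potential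

/-! ### The geometric construction and winding numbers -/

section Geometric

variable {X : Set ℂ}

theorem mem_segment_of_arg_eq_pi {p x y : ℂ} (h : Complex.arg ((y - p) / (x - p)) = Real.pi) :
    p ∈ segment ℝ x y := by
  obtain ⟨hre, him⟩ := Complex.arg_eq_pi_iff.1 h
  set w := (y - p) / (x - p) with hw
  have hxp : x - p ≠ 0 := fun h0 => by
    rw [h0, div_zero] at hw; rw [hw] at hre; simp at hre
  have hw' : w = ((w.re : ℝ) : ℂ) := Complex.ext rfl (by simpa using him)
  have hy : y - p = (w.re : ℂ) * (x - p) := by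
    rw [← hw', hw, div_mul_cancel₀ _ hxp]
  have h1 : 0 < 1 - w.re := by linarith
  have h1' : (1 - (w.re : ℂ)) ≠ 0 := by exact_mod_cast h1.ne'
  refine ⟨-w.re / (1 - w.re), 1 / (1 - w.re), by apply div_nonneg <;> linarith,
    by positivity, by field_simp; ring, ?_⟩
  simp only [Complex.real_smul]
  push_cast
  field_simp
  linear_combination hy

/-- Both sides have the same square. An edge avoiding p is seen under an angle different from π, so
the left side has positive real part, which fixes the sign. -/
theorem exp_half_arg_eq {p : ℂ} {x y : X} (h : p ∉ segment ℝ (x : ℂ) (y : ℂ)) :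
    Complex.exp (((Complex.arg (((y : ℂ) - p) / ((x : ℂ) - p)) / 2 : ℝ) : ℂ) * Complex.I)
      = (fluxSign (halfAngle p) x y : ℤ) * (halfAngle p y / halfAngle p x) := by
  have hxp : (x : ℂ) ≠ p := fun h0 => h (h0 ▸ left_mem_segment ℝ _ _)
  have hyp : (y : ℂ) ≠ p := fun h0 => h (h0 ▸ right_mem_segment ℝ _ _)
  have hh := isHalfAngle_halfAngle (X := X) p
  set w := ((y : ℂ) - p) / ((x : ℂ) - p) with hw
  have hw0 : w ≠ 0 := div_ne_zero (sub_ne_zero.2 hyp) (sub_ne_zero.2 hxp)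
  set e := Complex.exp (((Complex.arg w / 2 : ℝ) : ℂ) * Complex.I) with he
  have he2 : e ^ 2 = (halfAngle p y / halfAngle p x) ^ 2 := by
    rw [he, exp_half_sq, exp_arg_mul_I hw0, div_pow, hh.sq_eq x hxp, hh.sq_eq y hyp, hw, norm_div]
    push_cast
    rw [div_div_div_comm]
  have hre : 0 < e.re := by
    rw [he, Complex.exp_ofReal_mul_I_re]
    refine Real.cos_pos_of_mem_Ioo ⟨?_, ?_⟩
    · linarith [Complex.neg_pi_lt_arg w]
    · have h1 := Complex.arg_le_pi w
      have h2 : Complex.arg w ≠ Real.pi := fun h0 => h (mem_segment_of_arg_eq_pi h0)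
      have := lt_of_le_of_ne h1 h2
      linarith
  have hconj : conj (halfAngle p x) * halfAngle p y = halfAngle p y / halfAngle p x := by
    rw [div_eq_mul_inv, Complex.inv_def, Complex.normSq_eq_norm_sq, hh.norm_eq_one]
    simp [mul_comm]
  rw [fluxSign, hconj]
  rcases sq_eq_sq_iff_eq_or_eq_neg.1 he2 with h1 | h1
  · rw [reSign, if_neg (by rw [← h1]; exact not_lt.2 hre.le), h1]; simp
  · have h2 : halfAngle p y / halfAngle p x = -e := by rw [h1, neg_neg]
    rw [h2, reSign, if_pos (by simpa using hre)]; simp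

/-- Multiplying `exp_half_arg_eq` around the loop, the quotients of half angles telescope to 1, so
exp (i S / 2) is the product of the flux signs; with S = 2πk it is (-1)^k. -/
theorem sum_arg_eq_and_prod_fluxSign {p : ℂ} (n : ℕ) (f : ℕ → X) (h0 : f 0 = f n)
    (hf : ∀ i < n, p ∉ segment ℝ (f i : ℂ) (f (i + 1) : ℂ)) :
    ∃ k : ℤ, (∑ i ∈ Finset.range n,
        Complex.arg (((f (i + 1) : ℂ) - p) / ((f i : ℂ) - p)) = 2 * Real.pi * k) ∧
      ((∏ i ∈ Finset.range n, fluxSign (halfAngle p) (f i) (f (i + 1)) : ℤˣ) : ℤ) =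
        (((-1 : ℤˣ) ^ k : ℤˣ) : ℤ) := by
  set S := ∑ i ∈ Finset.range n, Complex.arg (((f (i + 1) : ℂ) - p) / ((f i : ℂ) - p)) with hS
  set u := ∏ i ∈ Finset.range n, fluxSign (halfAngle p) (f i) (f (i + 1)) with hu
  have hne : ∀ x : X, halfAngle p x ≠ 0 := fun x => Complex.exp_ne_zero _
  have h1 : Complex.exp (((S / 2 : ℝ) : ℂ) * Complex.I) = (u : ℤ) := by
    have h2 : ((S / 2 : ℝ) : ℂ) * Complex.I = ∑ i ∈ Finset.range n,
        ((Complex.arg (((f (i + 1) : ℂ) - p) / ((f i : ℂ) - p)) / 2 : ℝ) : ℂ) * Complex.I := by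
      rw [← Finset.sum_mul, hS, Finset.sum_div]
      push_cast
      rfl
    rw [h2, Complex.exp_sum, Finset.prod_congr rfl fun i hi =>
      exp_half_arg_eq (hf i (Finset.mem_range.1 hi)), Finset.prod_mul_distrib]
    have h3 : ∏ i ∈ Finset.range n, halfAngle p (f (i + 1)) / halfAngle p (f i) = 1 := by
      have : ∀ n : ℕ, ∏ i ∈ Finset.range n, halfAngle p (f (i + 1)) / halfAngle p (f i)
          = halfAngle p (f n) / halfAngle p (f 0) := fun n => by
        induction n with
        | zero => simp [hne]
        | succ n ih =>
          rw [Finset.prod_range_succ, ih]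
          have := hne (f n)
          have := hne (f 0)
          field_simp
      rw [this, h0, div_self (hne _)]
    rw [h3, mul_one, hu]
    push_cast
    rfl
  have h4 : Complex.exp (S * Complex.I) = 1 := by
    rw [← exp_half_sq, h1, sq, sign_mul_self]
  obtain ⟨k, hk⟩ := Complex.exp_eq_one_iff.1 h4
  have hSk : S = 2 * Real.pi * k := by
    have : (S : ℂ) = ((2 * Real.pi * k : ℝ) : ℂ) := by
      apply mul_right_cancel₀ Complex.I_ne_zero
      rw [hk]; push_cast; ring
    exact_mod_cast this
  refine ⟨k, hSk, ?_⟩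
  have h5 : (((u : ℤˣ) : ℤ) : ℂ) = ((((-1 : ℤˣ) ^ k : ℤˣ) : ℤ) : ℂ) := by
    rw [← h1, hSk, show ((2 * Real.pi * k / 2 : ℝ) : ℂ) * Complex.I
      = (k : ℂ) * (Real.pi * Complex.I) by push_cast; ring, Complex.exp_int_mul, Complex.exp_pi_mul_I]
    rcases Int.even_or_odd k with h | h
    · rw [h.neg_one_zpow, h.neg_one_zpow]; simp
    · rw [h.neg_one_zpow, h.neg_one_zpow]; simp
  exact_mod_cast h5

/-- The phases of a half flux are a gauge transform of real signs which are asymptotically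
equivalent to the signs defined by half angles. -/
theorem IsHalfFluxPhase.exists_sign {p : ℂ} {s : X → X → ℂ} (hs : IsHalfFluxPhase p s) :
    ∃ (φ : X → ℂ) (σ : X → X → ℤˣ), (∀ x, ‖φ x‖ = 1) ∧ (∀ x y, σ y x = σ x y) ∧ (∀ x, σ x x = 1) ∧
      (∀ x y, s x y = φ x * conj (φ y) * (σ x y : ℤ)) ∧ AsympEquiv (fluxSign (halfAngle p)) σ := by
  rcases isEmpty_or_nonempty X with hX | ⟨⟨x₀⟩⟩
  · exact ⟨fun _ => 1, fun _ _ => 1, by simp, by simp, by simp, fun x => isEmptyElim x,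
      fun _ => 1, 1, 0, one_pos, fun x => isEmptyElim x⟩
  have hcc : ∀ x y, s x y * conj (s x y) = 1 := fun x y => by
    rw [Complex.mul_conj, Complex.normSq_eq_norm_sq, hs.norm_eq_one]; simp
  -- The holonomy of the triangle x₀, x, y is ±1 even if the triangle passes through p; the gauge φ
  -- x = s x x₀ thus makes all phases real.
  have hσ : ∀ x y, ∃ u : ℤˣ, conj (s x x₀) * s x y * s y x₀ = (u : ℤ) := fun x y => by
    have h1 := hs.loop_through 2 ![x₀, x, y]
    have h2 : ∏ i, s ((![x₀, x, y] : Fin 3 → X) i) ((![x₀, x, y] : Fin 3 → X) (i + 1))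
        = s x₀ x * s x y * s y x₀ := by
      rw [Fin.prod_univ_three]; rfl
    rw [h2, hs.symm x x₀] at h1
    rcases h1 with h | h
    · exact ⟨1, by simpa using h⟩
    · exact ⟨-1, by simpa using h⟩
  choose σ hσ using hσ
  have hs_eq : ∀ x y, s x y = s x x₀ * conj (s y x₀) * (σ x y : ℤ) := fun x y => by
    rw [← hσ]
    linear_combination (-s x y) * hcc y x₀ - s x y * s y x₀ * conj (s y x₀) * hcc x x₀
  have hsymm : ∀ x y, σ y x = σ x y := fun x y => by
    have h1 : ((σ y x : ℤ) : ℂ) = (σ x y : ℤ) := by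
      have h2 := congrArg conj (hσ x y)
      rw [map_mul, map_mul, Complex.conj_conj, ← hs.symm x y, map_intCast] at h2
      rw [← h2, ← hσ]; ring
    exact Units.ext (by exact_mod_cast h1)
  refine ⟨fun x => s x x₀, σ, fun x => hs.norm_eq_one x x₀, hsymm, fun x => ?_, hs_eq, ?_⟩
  · have h1 : ((σ x x : ℤ) : ℂ) = 1 := by
      rw [← hσ, hs.self_eq_one, mul_one, mul_comm, hcc]
    exact Units.ext (Int.cast_injective (α := ℂ) (by simpa using h1))
  have hprod : ∀ (n : ℕ) (f : ℕ → X), ∏ i ∈ Finset.range n, s (f i) (f (i + 1))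
      = s (f 0) x₀ * conj (s (f n) x₀) *
        ((∏ i ∈ Finset.range n, σ (f i) (f (i + 1)) : ℤˣ) : ℤ) := fun n f => by
    induction n with
    | zero => simp [hcc]
    | succ n ih =>
      rw [Finset.prod_range_succ, ih, Finset.prod_range_succ, hs_eq (f n) (f (n + 1))]
      simp only [Units.val_mul, Int.cast_mul]
      linear_combination s (f 0) x₀ * conj (s (f (n + 1)) x₀) *
        ((∏ i ∈ Finset.range n, σ (f i) (f (i + 1)) : ℤˣ) : ℤ) * ((σ (f n) (f (n + 1)) : ℤˣ) : ℤ) *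
          hcc (f n) x₀
  -- On loops avoiding p both sign systems have holonomy (-1)^k, so their product is trivial.
  have hloop : ∀ (n : ℕ) (f : ℕ → X), f 0 = f n →
      (∀ i < n, p ∉ segment ℝ (f i : ℂ) (f (i + 1) : ℂ)) →
      ∏ i ∈ Finset.range n, σ (f i) (f (i + 1)) * fluxSign (halfAngle p) (f i) (f (i + 1)) = 1 := by
    intro n f h0 hf
    rcases n with _ | n
    · simp
    obtain ⟨k, hk, hflux⟩ := sum_arg_eq_and_prod_fluxSign (n + 1) f h0 hf
    have hcyc : ∀ i : Fin (n + 1), f ((i + 1 : Fin (n + 1)) : ℕ) = f ((i : ℕ) + 1) := fun i => by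
      rw [Fin.val_add_one]
      split_ifs with h
      · rw [h, h0]; rfl
      · rfl
    have h1 := hs.loop n (fun i => f i) (fun i => by
      rw [hcyc]; exact hf i i.2) k (by
      simp only [hcyc]
      rw [Fin.sum_univ_eq_sum_range (fun i : ℕ =>
        Complex.arg (((f (i + 1) : ℂ) - p) / ((f i : ℂ) - p))) (n + 1)]
      exact hk)
    simp only [hcyc] at h1
    rw [Fin.prod_univ_eq_prod_range (fun i : ℕ => s (f i) (f (i + 1))) (n + 1), hprod, ← h0, hcc,
      one_mul] at h1
    rw [Finset.prod_mul_distrib]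
    have h2 : ∏ i ∈ Finset.range (n + 1), σ (f i) (f (i + 1))
        = ∏ i ∈ Finset.range (n + 1), fluxSign (halfAngle p) (f i) (f (i + 1)) := by
      refine Units.ext ?_
      rw [hflux]
      have h3 : (((((-1 : ℤˣ) ^ k : ℤˣ) : ℤ)) : ℂ) = (-1) ^ k := by
        rcases Int.even_or_odd k with h | h
        · rw [h.neg_one_zpow, h.neg_one_zpow]; simp
        · rw [h.neg_one_zpow, h.neg_one_zpow]; simp
      rw [← h3] at h1
      exact_mod_cast h1
    rw [h2, Int.units_mul_self]
  obtain ⟨g, hg⟩ := exists_potential (r := fun x y : X => p ∉ segment ℝ (x : ℂ) (y : ℂ))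
    (t := fun x y => σ x y * fluxSign (halfAngle p) x y)
    (fun x y h => by rwa [segment_symm]) (fun x y => by rw [hsymm, fluxSign_symm]) hloop
  -- The remaining edges pass through p, and then |x - p| ≤ |x - y|.
  refine ⟨g, 1, ‖p‖, one_pos, fun x y hne => ?_⟩
  have hp : p ∈ segment ℝ (x : ℂ) (y : ℂ) := by
    by_contra hp
    refine hne ?_
    rw [← hg x y hp, mul_assoc, Int.units_mul_self, mul_one]
  have h1 := norm_sub_le_of_mem_segment hp
  have h2 := norm_sub_norm_le (x : ℂ) p
  rw [norm_sub_rev p, norm_sub_rev (y : ℂ)] at h1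
  linarith

end Geometric

/-! ### Gauge invariance of the vertex trace -/

section Gauge

open scoped ENNReal

variable {X : Set ℂ} {m : ℕ} {H : Type*} [NormedAddCommGroup H] [InnerProductSpace ℂ H]
  [CompleteSpace H] (b : HilbertBasis (X × Fin m) ℂ H)

theorem entry_star (A : H →L[ℂ] H) (i j : X × Fin m) :
    entry b (star A) i j = conj (entry b A j i) := by
  rw [entry, entry, inner_conj_symm, ContinuousLinearMap.star_eq_adjoint,
    ContinuousLinearMap.adjoint_inner_right]

theorem isSelfAdjoint_iff_entry {A : H →L[ℂ] H} :
    IsSelfAdjoint A ↔ ∀ i j, entry b A j i = conj (entry b A i j) := by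
  constructor
  · intro h i j
    rw [← entry_star, h.star_eq]
  · intro h
    exact ext_entry b fun i j => by rw [entry_star, ← h]

theorem exists_diagonal {φ : X × Fin m → ℂ} (hφ : ∀ i, ‖φ i‖ = 1) :
    ∃ U : H →L[ℂ] H, ∀ i, U (b i) = φ i • b i := by
  classical
  have h1 : ∀ i, ‖φ i‖ₑ = 1 := fun i => by rw [← ofReal_norm, hφ]; simp
  obtain ⟨U, hU, -⟩ := exists_entry_eq b (fun i j => if i = j then φ i else 0) ENNReal.one_ne_top
    (fun i => by rw [tsum_eq_single i fun j hj => by simp [hj.symm]]; simp [h1])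
    (fun j => by rw [tsum_eq_single j fun i hi => by simp [hi]]; simp [h1])
  refine ⟨U, fun j => b.repr.injective (lp.ext (funext fun i => ?_))⟩
  rw [b.repr_apply_apply, b.repr_apply_apply, inner_smul_right,
    orthonormal_iff_ite.1 b.orthonormal]
  refine (hU i j).trans ?_
  split_ifs with h
  · rw [h, mul_one]
  · simp

omit [CompleteSpace H] in
theorem ext_basis {A B : H →L[ℂ] H} (h : ∀ i, A (b i) = B (b i)) : A = B :=
  ext_entry b fun i j => by rw [entry, entry, h]

/-- The gauge transformation by the phases `φ`. -/
theorem exists_unitary {φ : X × Fin m → ℂ} (hφ : ∀ i, ‖φ i‖ = 1) :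
    ∃ U : unitary (H →L[ℂ] H), ∀ A i j,
      entry b ((U : H →L[ℂ] H) * A * star (U : H →L[ℂ] H)) i j
        = φ i * conj (φ j) * entry b A i j := by
  obtain ⟨U, hU⟩ := exists_diagonal b hφ
  obtain ⟨V, hV⟩ := exists_diagonal b (φ := fun i => conj (φ i)) fun i => by simp [hφ]
  have hφφ : ∀ i, φ i * conj (φ i) = 1 := fun i => by
    rw [Complex.mul_conj, Complex.normSq_eq_norm_sq, hφ]; simp
  have hUV : star U = V := ext_entry b fun i j => by
    classical
    rw [entry_star, entry, entry, hU, hV, inner_smul_right, inner_smul_right, map_mul,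
      inner_conj_symm, orthonormal_iff_ite.1 b.orthonormal]
    split_ifs with h
    · rw [h]
    · simp
  refine ⟨⟨U, ?_⟩, fun A i j => ?_⟩
  · rw [Unitary.mem_iff, hUV]
    constructor <;> refine ext_basis b fun i => ?_
    · rw [mul_apply_eq_comp, hU, map_smul, hV, smul_smul, hφφ]; simp
    · rw [mul_apply_eq_comp, hV, map_smul, hU, smul_smul, mul_comm, hφφ]; simp
  · have h1 : star U (b i) = conj (φ i) • b i := by rw [hUV, hV]
    change inner ℂ (b i) (U (A (star U (b j)))) = _
    rw [hUV, hV, map_smul, map_smul, inner_smul_right, ← ContinuousLinearMap.adjoint_inner_left,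
      ← ContinuousLinearMap.star_eq_adjoint, h1, inner_smul_left, Complex.conj_conj, entry]
    ring

theorem flatten_conj (U : unitary (H →L[ℂ] H)) {A : H →L[ℂ] H} (hA : IsSelfAdjoint A) {μ : ℝ}
    (hc : ContinuousOn (step μ) (spectrum ℝ A)) :
    flatten μ ((U : H →L[ℂ] H) * A * star (U : H →L[ℂ] H))
      = (U : H →L[ℂ] H) * flatten μ A * star (U : H →L[ℂ] H) := by
  have h1 : Continuous (Unitary.conjStarAlgAut ℝ (H →L[ℂ] H) U) := by
    change Continuous fun A => (U : H →L[ℂ] H) * A * star (U : H →L[ℂ] H)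
    fun_prop
  have h2 : IsSelfAdjoint (Unitary.conjStarAlgAut ℝ (H →L[ℂ] H) U A) :=
    hA.map (Unitary.conjStarAlgAut ℝ (H →L[ℂ] H) U)
  exact (StarAlgHomClass.map_cfc (S := ℝ) (Unitary.conjStarAlgAut ℝ (H →L[ℂ] H) U) (step μ) A hc h1
    hA h2).symm

/-- Conjugation by a diagonal unitary commutes with the functional calculus and keeps diagonal
entries. No compatibility of the phases with Θ is required. -/
theorem vertexTrace_eq_of_gauge {A B : H →L[ℂ] H} {φ : X × Fin m → ℂ} (hφ : ∀ i, ‖φ i‖ = 1)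
    (hA : IsSelfAdjoint A) (hAT : IsTraceClass (A - A * A))
    (hB : ∀ i j, entry b B i j = φ i * conj (φ j) * entry b A i j) :
    IsSelfAdjoint B ∧ IsTraceClass (B - B * B) ∧
      ∀ μ ∈ Set.Ioo (0 : ℝ) 1, vertexTrace b μ B = vertexTrace b μ A := by
  obtain ⟨U, hU⟩ := exists_unitary b hφ
  have hBU : B = (U : H →L[ℂ] H) * A * star (U : H →L[ℂ] H) :=
    ext_entry b fun i j => by rw [hU, hB]
  have hUU : star (U : H →L[ℂ] H) * (U : H →L[ℂ] H) = 1 := Unitary.coe_star_mul_self U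
  have hφφ : ∀ i, φ i * conj (φ i) = 1 := fun i => by
    rw [Complex.mul_conj, Complex.normSq_eq_norm_sq, hφ]; simp
  have hBB : B - B * B = (U : H →L[ℂ] H) * (A - A * A) * star (U : H →L[ℂ] H) := by
    have : B * B = (U : H →L[ℂ] H) * A * (star (U : H →L[ℂ] H) * (U : H →L[ℂ] H)) * A *
        star (U : H →L[ℂ] H) := by rw [hBU]; noncomm_ring
    rw [this, hUU, hBU]; noncomm_ring
  refine ⟨?_, ?_, fun μ hμ => ?_⟩
  · rw [hBU]
    exact hA.conjugate _
  · rw [hBB]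
    exact (hAT.mul_left _).mul_right _
  · have h1 : B - flatten μ B
        = (U : H →L[ℂ] H) * (A - flatten μ A) * star (U : H →L[ℂ] H) := by
      rw [hBU, flatten_conj U hA (continuousOn_step_spectrum hA hAT hμ)]; noncomm_ring
    rw [vertexTrace, vertexTrace, h1]
    exact tsum_congr fun i => by rw [hU, hφφ, one_mul]

end Gauge

/-! ### Time reversal as an antilinear isometry of the Hilbert space -/

section TimeReversal

variable {X : Set ℂ} {m : ℕ} {H : Type*} [NormedAddCommGroup H] [InnerProductSpace ℂ H]
  (b : HilbertBasis (X × Fin m) ℂ H) {T : X → Matrix (Fin m) (Fin m) ℂ}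

/-- The basis vectors transformed by the matrices `T x`. -/
noncomputable def rotatedBasis (T : X → Matrix (Fin m) (Fin m) ℂ) (i : X × Fin m) : H :=
  ∑ k, T i.1 k i.2 • b (i.1, k)

open Classical in
theorem inner_rotatedBasis (i j : X × Fin m) :
    inner ℂ (b i) (rotatedBasis b T j) = if i.1 = j.1 then T j.1 i.2 j.2 else 0 := by
  rw [rotatedBasis, inner_sum]
  simp only [inner_smul_right, orthonormal_iff_ite.1 b.orthonormal, Prod.ext_iff, mul_ite, mul_one,
    mul_zero]
  by_cases h : i.1 = j.1
  · simp [h]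
  · simp [h]

theorem orthonormal_rotatedBasis (hT : IsTimeReversal T) : Orthonormal ℂ (rotatedBasis b T) := by
  classical
  rw [orthonormal_iff_ite]
  intro i j
  rw [rotatedBasis, sum_inner]
  simp only [inner_smul_left, inner_rotatedBasis]
  by_cases h : i.1 = j.1
  · have h1 := congrFun (congrFun (Matrix.mem_unitaryGroup_iff'.1 (hT j.1).1) i.2) j.2
    rw [Matrix.mul_apply, Matrix.one_apply] at h1
    simp only [Matrix.star_apply] at h1
    simp only [h, if_true, Prod.ext_iff, true_and]
    exact h1
  · have : i ≠ j := fun h' => h (by rw [h'])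
    simp [h, this]

/-- An on-site time reversal acts as an antilinear isometry. -/
theorem exists_timeReversal [CompleteSpace H] (hT : IsTimeReversal T) : ∃ Θ : H → H, IsKramers Θ ∧
    ∀ ψ (i : X × Fin m), inner ℂ (b i) (Θ ψ) = ∑ l, T i.1 i.2 l * conj (inner ℂ (b (i.1, l)) ψ) := by
  classical
  have ho := (orthonormal_rotatedBasis b hT).orthogonalFamily
  -- Coordinatewise conjugation followed by the isometry sending `b j` to the rotated vector.
  let Θ : H → H := fun ψ => ho.linearIsometry (star (b.repr ψ))
  have hcoord : ∀ ψ (i : X × Fin m),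
      inner ℂ (b i) (Θ ψ) = ∑ l, T i.1 i.2 l * conj (inner ℂ (b (i.1, l)) ψ) := by
    intro ψ i
    have h1 := (innerSL ℂ (b i)).hasSum (ho.hasSum_linearIsometry (star (b.repr ψ)))
    have h2 : ∀ j : X × Fin m, innerSL ℂ (b i) ((LinearIsometry.toSpanSingleton ℂ H
        ((orthonormal_rotatedBasis b hT).1 j)) (star (b.repr ψ) j))
        = if i.1 = j.1 then T j.1 i.2 j.2 * conj (inner ℂ (b j) ψ) else 0 := fun j => by
      rw [LinearIsometry.toSpanSingleton_apply, map_smul, innerSL_apply_apply, inner_rotatedBasis,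
        lp.star_apply, b.repr_apply_apply, smul_eq_mul]
      split_ifs
      · exact mul_comm _ _
      · simp
    have h3 := h1.tsum_eq
    simp only [h2] at h3
    rw [innerSL_apply_apply] at h3
    change inner ℂ (b i) (ho.linearIsometry (star (b.repr ψ))) = _
    rw [← h3, tsum_eq_sum (s := Finset.univ.image fun l => (i.1, l))]
    · rw [Finset.sum_image (by intro x _ y _ h; exact (Prod.ext_iff.1 h).2)]
      simp
    · intro j hj
      rw [if_neg]
      intro h
      exact hj (Finset.mem_image.2 ⟨j.2, Finset.mem_univ _, by rw [h]⟩)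
  refine ⟨Θ, ⟨fun x y => ?_, fun c x => ?_, fun x => ?_, fun x => ?_⟩, hcoord⟩
  · simp only [Θ, map_add, star_add]
  · simp only [Θ, map_smul, star_smul]; rfl
  · simp only [Θ, LinearIsometry.norm_map, norm_star, LinearIsometryEquiv.norm_map]
  · refine b.repr.injective (lp.ext (funext fun i => ?_))
    rw [b.repr_apply_apply, b.repr_apply_apply, hcoord]
    simp only [hcoord, map_sum, map_mul, Complex.conj_conj, inner_neg_right]
    have h1 := fun c => congrFun (congrFun (hT i.1).2 i.2) c
    simp only [Matrix.mul_apply, Matrix.map_apply, Matrix.neg_apply, Matrix.one_apply] at h1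
    simp only [Finset.mul_sum, ← mul_assoc]
    rw [Finset.sum_comm]
    simp only [← Finset.sum_mul, h1]
    simp

/-- The vectors on which A and Θ commute form a closed complex subspace, since both compositions are
antilinear; the block identity puts the basis in it. -/
theorem commutesWith_of_timeReversalSymmetric [CompleteSpace H] {Θ : H → H} (hΘ : IsKramers Θ)
    (hcoord : ∀ ψ (i : X × Fin m),
      inner ℂ (b i) (Θ ψ) = ∑ l, T i.1 i.2 l * conj (inner ℂ (b (i.1, l)) ψ))
    {A : H →L[ℂ] H} (hA : TimeReversalSymmetric b T A) : CommutesWith Θ A := by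
  classical
  let V : Submodule ℂ H :=
    { carrier := {ψ | A (Θ ψ) = Θ (A ψ)}
      add_mem' := fun {x y} hx hy => by
        simp only [Set.mem_ofPred_eq] at *
        rw [hΘ.map_add, map_add, hx, hy, map_add, hΘ.map_add]
      zero_mem' := by simp [hΘ.map_zero]
      smul_mem' := fun c x hx => by
        simp only [Set.mem_ofPred_eq] at *
        rw [hΘ.map_smul, map_smul, hx, map_smul, hΘ.map_smul] }
  have hVc : IsClosed (V : Set H) :=
    isClosed_eq (A.continuous.comp hΘ.isometry.continuous) (hΘ.isometry.continuous.comp A.continuous)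
  have hVb : Submodule.span ℂ (Set.range b) ≤ V := by
    rw [Submodule.span_le]
    rintro _ ⟨j, rfl⟩
    change A (Θ (b j)) = Θ (A (b j))
    refine b.repr.injective (lp.ext (funext fun i => ?_))
    rw [b.repr_apply_apply, b.repr_apply_apply, hcoord]
    have h1 : Θ (b j) = ∑ k, T j.1 k j.2 • b (j.1, k) := by
      refine b.repr.injective (lp.ext (funext fun i => ?_))
      rw [b.repr_apply_apply, b.repr_apply_apply, hcoord]
      refine Eq.trans ?_ (inner_rotatedBasis b (T := T) i j).symm
      by_cases h : i.1 = j.1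
      · simp [orthonormal_iff_ite.1 b.orthonormal, Prod.ext_iff, h]
      · simp [orthonormal_iff_ite.1 b.orthonormal, Prod.ext_iff, h]
    have h2 := congrFun (congrFun (hA i.1 j.1) i.2) j.2
    simp only [Matrix.mul_apply, Matrix.map_apply, block, Matrix.of_apply, entry] at h2
    rw [h1, map_sum, inner_sum]
    simp only [map_smul, inner_smul_right]
    rw [h2]
    exact Finset.sum_congr rfl fun k _ => mul_comm _ _
  have htop : V = ⊤ := by
    rw [eq_top_iff, ← b.dense_span]
    exact Submodule.topologicalClosure_minimal _ hVb hVc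
  intro ψ
  have : ψ ∈ V := htop ▸ Submodule.mem_top
  exact this

end TimeReversal

/-! ### Operators with modified signs: existence, comparison, local bounds -/

section SignOperator

open scoped ENNReal

variable {X : Set ℂ} {m : ℕ} {H : Type*} [NormedAddCommGroup H] [InnerProductSpace ℂ H]
  (b : HilbertBasis (X × Fin m) ℂ H)

/-- `Q` has the matrix elements of `P` multiplied by the signs `σ`. -/
def IsSignOperator (P : H →L[ℂ] H) (σ : X → X → ℤˣ) (Q : H →L[ℂ] H) : Prop :=
  ∀ i j, entry b Q i j = ((σ i.1 j.1 : ℤ) : ℂ) * entry b P i j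

variable {b} {P Q Q' : H →L[ℂ] H} {σ σ' : X → X → ℤˣ}

theorem IsSignOperator.enorm_entry (hQ : IsSignOperator b P σ Q) (i j : X × Fin m) :
    ‖entry b Q i j‖ₑ = ‖entry b P i j‖ₑ := by
  rw [hQ i j, enorm_sign_mul]

theorem IsSignOperator.rowBound (hQ : IsSignOperator b P σ Q) {c : ℝ} {K : ℝ≥0∞}
    (hP : RowBound b c K P) : RowBound b c K Q := fun i => by
  simpa only [hQ.enorm_entry] using hP i

theorem isSignOperator_one : IsSignOperator b P (fun _ _ => 1) P := fun i j => by simp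

/-- Real factors are unaffected by conjugation. General phases are not, hence the reduction of every
half flux to signs. -/
theorem IsSignOperator.timeReversalSymmetric {T : X → Matrix (Fin m) (Fin m) ℂ}
    (hQ : IsSignOperator b P σ Q) (hP : TimeReversalSymmetric b T P) :
    TimeReversalSymmetric b T Q := fun x y => by
  have h : block b Q x y = ((σ x y : ℤ) : ℂ) • block b P x y := by
    ext k l
    exact hQ (x, k) (y, l)
  have h' : (block b Q x y).map conj = ((σ x y : ℤ) : ℂ) • (block b P x y).map conj := by
    rw [h]; ext k l; simp
  rw [h', h, Matrix.mul_smul, hP x y, Matrix.smul_mul]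

/-- Half of the decay rate serves as weight, the other half makes the row sums converge. -/
theorem exists_rowBound (hX : BoundedDensity X) (hP : ExpDecay b P) :
    ∃ (c : ℝ) (K : ℝ≥0∞), 0 < c ∧ K ≠ ∞ ∧ RowBound b c K P := by
  obtain ⟨C₁, C₂, hC₁, hC₂, h⟩ := hP
  obtain ⟨K, hK, hsum⟩ := hX.exists_tsum_exp_le' m (half_pos hC₂)
  refine ⟨C₂ / 2, ENNReal.ofReal C₁ * K, half_pos hC₂, by finiteness, fun i => ?_⟩
  refine le_trans ?_ (mul_le_mul_right (hsum i.1) _)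
  rw [← ENNReal.tsum_mul_left]
  refine ENNReal.tsum_le_tsum fun j => ?_
  rw [← ofReal_norm, expWeight, ← ENNReal.ofReal_mul (norm_nonneg _),
    ← ENNReal.ofReal_mul hC₁.le]
  refine ENNReal.ofReal_le_ofReal ((mul_le_mul_of_nonneg_right (h i j)
    (Real.exp_pos _).le).trans_eq ?_)
  rw [mul_assoc, ← Real.exp_add, siteDist, norm_sub_rev (j.1 : ℂ)]
  congr 2
  ring

variable [CompleteSpace H]

/-- Schur test; self-adjointness of P turns the row bound into a column bound. The norm bound does
not depend on the signs. -/
theorem exists_signOperator {c : ℝ} {K : ℝ≥0∞} (hc : 0 < c) (hK : K ≠ ∞) (hrow : RowBound b c K P)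
    (hP : IsSelfAdjoint P) (hσ : ∀ x y, σ y x = σ x y) :
    ∃ Q, IsSignOperator b P σ Q ∧ IsSelfAdjoint Q ∧ ‖Q‖ ≤ 2 * K.toReal := by
  have hPs := (isSelfAdjoint_iff_entry b).1 hP
  have h1 : ∀ i, ∑' j, ‖entry b P i j‖ₑ ≤ K := fun i =>
    (ENNReal.tsum_le_tsum fun j => le_mul_of_one_le_right' (one_le_expWeight
      (mul_nonneg hc.le (siteDist_nonneg i j)))).trans (hrow i)
  obtain ⟨Q, hQ, hn⟩ := exists_entry_eq b
    (fun i j => ((σ i.1 j.1 : ℤ) : ℂ) * entry b P i j) hK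
    (fun i => by simpa only [enorm_sign_mul] using h1 i)
    (fun j => by
      simp only [enorm_sign_mul]
      refine le_trans (le_of_eq (tsum_congr fun i => ?_)) (h1 j)
      rw [hPs j i, RCLike.enorm_conj])
  refine ⟨Q, hQ, (isSelfAdjoint_iff_entry b).2 fun i j => ?_, hn⟩
  rw [hQ, hQ, hPs i j, hσ, map_mul, map_intCast]

theorem isTraceClass_of_tsum_ne_top [Countable X] {A : H →L[ℂ] H}
    (h : ∑' i, ∑' j, ‖entry b A i j‖ₑ ≠ ∞) : IsTraceClass A :=
  (hasTraceBound_of_tsum_enorm_entry_le b ENNReal.toReal_nonneg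
    (ENNReal.ofReal_toReal h).ge).isTraceClass

/-- Where the signs differ, |x - y| ≥ κ |x| - R, so the weighted row sums bound row x of the
difference by a multiple of exp (-c κ |x|), which is summable over the sites. -/
theorem isTraceClass_sub_of_asymp (hX : BoundedDensity X) {c : ℝ} {K : ℝ≥0∞} (hc : 0 < c)
    (hK : K ≠ ∞) (hrow : RowBound b c K P) (hQ : IsSignOperator b P σ Q)
    (hQ' : IsSignOperator b P σ' Q') {κ R : ℝ} (hκ : 0 < κ)
    (h : ∀ x y, σ' x y ≠ σ x y → κ * ‖(x : ℂ)‖ ≤ ‖(x : ℂ) - y‖ + R) :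
    IsTraceClass (Q - Q') := by
  have := hX.countable
  obtain ⟨K', hK', hsum⟩ := hX.exists_tsum_exp_le' m (mul_pos hc hκ)
  refine isTraceClass_of_tsum_ne_top (b := b)
    (ne_top_of_le_ne_top (b := 2 * K * expWeight (c * R) * K') ?_ ?_)
  · have := expWeight_ne_top (c * R)
    finiteness
  refine le_trans (ENNReal.tsum_le_tsum fun i => ?_)
    ((ENNReal.tsum_mul_left).trans_le (mul_le_mul_right (hsum 0) _))
  have hring : ∀ x y z : ℝ≥0∞, 2 * x * y * z = x * (2 * (y * z)) := fun x y z => by ring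
  rw [hring]
  refine le_trans ?_ (mul_le_mul_left (hrow i) _)
  rw [← ENNReal.tsum_mul_right]
  refine ENNReal.tsum_le_tsum fun j => ?_
  rw [entry_sub]
  by_cases hij : σ' i.1 j.1 = σ i.1 j.1
  · rw [hQ i j, hQ' i j, hij, sub_self]; simp
  · refine enorm_sub_le.trans ?_
    rw [hQ.enorm_entry, hQ'.enorm_entry, ← mul_two, mul_assoc]
    refine mul_le_mul_right ?_ _
    rw [mul_left_comm]
    refine le_mul_of_one_le_right' ?_
    change 1 ≤ _ * (expWeight (c * R) * expWeight _)
    rw [← expWeight_add, ← expWeight_add]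
    refine one_le_expWeight ?_
    have h1 := mul_le_mul_of_nonneg_left (h _ _ hij) hc.le
    rw [sub_zero, siteDist]
    linarith

/-- The intermediate operator A is the gauge transform of Q: it has the vertex trace of Q, and it
differs from Q' by a trace class operator with zero diagonal. -/
theorem vertexTrace_sub_even_of_asympEquiv (hX : BoundedDensity X) {c : ℝ} {K : ℝ≥0∞} (hc : 0 < c)
    (hK : K ≠ ∞) (hrow : RowBound b c K P) (hP : IsSelfAdjoint P) {Θ : H → H} (hΘ : IsKramers Θ)
    (hcomm : ∀ σ Q, IsSignOperator b P σ Q → CommutesWith Θ Q)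
    (hQ : IsSignOperator b P σ Q) (hQ' : IsSignOperator b P σ' Q') (hQs : IsSelfAdjoint Q)
    (hQs' : IsSelfAdjoint Q') (hσ : ∀ x y, σ y x = σ x y) (hσ1 : ∀ x, σ x x = 1)
    (hσ1' : ∀ x, σ' x x = 1) (h : AsympEquiv σ σ') (hT : IsTraceClass (Q - Q * Q)) :
    IsTraceClass (Q' - Q' * Q') ∧ ∀ μ ∈ Set.Ioo (0 : ℝ) 1, ∀ μ' ∈ Set.Ioo (0 : ℝ) 1,
      ∃ k : ℤ, vertexTrace b μ' Q' = vertexTrace b μ Q + ((2 * k : ℤ) : ℂ) := by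
  obtain ⟨g, κ, R, hκ, hg⟩ := h
  obtain ⟨A, hA, hAs, -⟩ := exists_signOperator (σ := fun x y => g x * g y * σ x y) hc hK hrow hP
    fun x y => by rw [hσ, mul_comm (g y)]
  have hgauge := vertexTrace_eq_of_gauge b (A := Q) (B := A) (φ := fun i => ((g i.1 : ℤ) : ℂ))
    (fun i => by rcases Int.units_eq_one_or (g i.1) with h | h <;> simp [h]) hQs hT fun i j => by
      rw [hA, hQ]; push_cast; rw [map_intCast]; ring
  have hAQ : IsTraceClass (A - Q') := isTraceClass_sub_of_asymp hX hc hK hrow hA hQ' hκ hg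
  refine ⟨isTraceClass_sub_sq_of_sub hgauge.2.1 hAQ, fun μ hμ μ' hμ' => ?_⟩
  obtain ⟨k, hk⟩ := vertexTrace_sub_even b hΘ hAs hQs' (hcomm _ _ hA) (hcomm _ _ hQ') hgauge.2.1 hAQ
    (fun i => by
      rw [hA, hQ', hσ1']
      beta_reduce
      rw [hσ1, mul_one, Int.units_mul_self]) hμ hμ'
  refine ⟨-k, ?_⟩
  rw [← hgauge.2.2 μ hμ]
  push_cast at hk ⊢
  linear_combination -hk

/-- Around the site of `i`, up to distance `ρ`, the signs `σ` are a gauge transformation. -/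
def TrivialOnBall (σ : X → X → ℤˣ) (x : X) (ρ : ℝ) : Prop :=
  ∃ g : X → ℤˣ, ∀ y z : X, ‖(x : ℂ) - y‖ ≤ ρ → ‖(x : ℂ) - z‖ ≤ ρ → σ y z = g y * g z

theorem TrivialOnBall.mul {x : X} {ρ ρ' : ℝ} (h : TrivialOnBall σ x ρ) (h' : TrivialOnBall σ' x ρ') :
    TrivialOnBall (fun y z => σ y z * σ' y z) x (min ρ ρ') := by
  obtain ⟨g, hg⟩ := h
  obtain ⟨g', hg'⟩ := h'
  refine ⟨fun y => g y * g' y, fun y z hy hz => ?_⟩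
  simp only [hg y z (hy.trans (min_le_left _ _)) (hz.trans (min_le_left _ _)),
    hg' y z (hy.trans (min_le_right _ _)) (hz.trans (min_le_right _ _))]
  exact mul_mul_mul_comm _ _ _ _

/-- Functions of two half flux operators which vanish at `P`, and whose signs differ near `i` by a
gauge transformation, have almost the same diagonal matrix elements at `i`; they are small where the
signs are trivial. -/
theorem exists_local_bounds {c : ℝ} {K : ℝ≥0∞} (hc : 0 < c) (hK : K ≠ ∞) (hrow : RowBound b c K P)
    (h : Polynomial ℝ) (hPh : Polynomial.aeval P h = 0) : ∃ C : ℝ≥0∞, C ≠ ∞ ∧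
      (∀ σ Q, IsSignOperator b P σ Q → ∀ (i : X × Fin m) ρ, TrivialOnBall σ i.1 ρ →
        ∑' j, ‖entry b (Polynomial.aeval Q h) i j‖ₑ ≤ C * expWeight (-(c * ρ))) ∧
      ∀ σ σ' Q Q', IsSignOperator b P σ Q →
        IsSignOperator b P (fun x y => σ x y * σ' x y) Q' → ∀ (i : X × Fin m) ρ,
        TrivialOnBall σ' i.1 ρ →
        ‖entry b (Polynomial.aeval Q' h) i i - entry b (Polynomial.aeval Q h) i i‖ₑ
          ≤ C * expWeight (-(c * ρ)) := by
  obtain ⟨C, hC, hdiff⟩ := exists_gaugeDiff_aeval_le b h hc.le hK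
  have hw : ∀ (i j : X × Fin m) ρ (z : ℝ≥0∞),
      z ≤ z * expWeight (c * max ρ (siteDist i j)) * expWeight (-(c * ρ)) := fun i j ρ z => by
    rw [mul_assoc, ← expWeight_add]
    refine le_mul_of_one_le_right' (one_le_expWeight ?_)
    have := mul_le_mul_of_nonneg_left (le_max_left ρ (siteDist i j)) hc.le
    linarith
  refine ⟨C, hC, fun σ Q hQ i ρ ⟨g, hg⟩ => ?_, fun σ σ' Q Q' hQ hQ' i ρ ⟨g, hg⟩ => ?_⟩
  -- Comparison with P itself, where the polynomial vanishes.
  · have h1 := hdiff Q P (hQ.rowBound hrow) hrow g i ρ fun j l hj hl => by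
      rw [hQ j l, hg j.1 l.1 hj hl]
    refine le_trans (ENNReal.tsum_le_tsum fun j => hw i j ρ _) ?_
    rw [ENNReal.tsum_mul_right]
    refine mul_le_mul_left (le_trans (le_of_eq (tsum_congr fun j => ?_)) h1) _
    rw [gaugeDiff, hPh]
    simp [entry]
  · have h1 := hdiff Q' Q (hQ'.rowBound hrow) (hQ.rowBound hrow) g i ρ fun j l hj hl => by
      rw [hQ' j l, hQ j l]
      beta_reduce
      rw [hg j.1 l.1 hj hl]
      simp only [Units.val_mul, Int.cast_mul]
      ring
    refine (hw i i ρ _).trans (mul_le_mul_left (le_trans ?_ h1) _)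
    refine le_trans (le_of_eq ?_) (ENNReal.le_tsum i)
    rw [gaugeDiff, Int.units_mul_self]
    simp

end SignOperator

/-! ### Spectral gaps and polynomial approximation of the flattening -/

section Approximation

/-- Pigeonhole: N disjoint open intervals of radius 1 / (4N) fill [1/4, 3/4] up to endpoints, so
fewer than N points miss one of them. -/
theorem exists_gap (F : Finset ℝ) {N : ℕ} (hN : F.card < N) :
    ∃ j < N, ∀ t ∈ F, 1 / (4 * N : ℝ) ≤ |t - (1 / 4 + (2 * j + 1) / (4 * N))| := by
  by_contra! h
  have hN0 : (0 : ℝ) < N := by exact_mod_cast (Nat.zero_le _).trans_lt hN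
  choose! f hf using h
  have hinj : Set.InjOn f (Finset.range N : Set ℕ) := by
    intro j hj k hk hjk
    have h1 := (hf j (by simpa using hj)).2
    have h2 := (hf k (by simpa using hk)).2
    rw [hjk] at h1
    rw [abs_lt] at h1 h2
    have h3 : |(2 * (j : ℝ) + 1) / (4 * N) - (2 * k + 1) / (4 * N)| < 2 * (1 / (4 * N)) := by
      rw [abs_lt]; constructor <;> linarith
    rw [← sub_div, abs_div, abs_of_pos (show (0 : ℝ) < 4 * N by positivity), mul_one_div,
      div_lt_div_iff_of_pos_right (by positivity), abs_lt] at h3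
    have h4 : (j : ℝ) < k + 1 := by linarith [h3.2]
    have h5 : (k : ℝ) < j + 1 := by linarith [h3.1]
    have h4' : j < k + 1 := by exact_mod_cast h4
    have h5' : k < j + 1 := by exact_mod_cast h5
    omega
  have := Finset.card_le_card_of_injOn f (s := Finset.range N) (t := F)
    (fun j hj => (hf j (by simpa using hj)).1) hinj
  rw [Finset.card_range] at this
  omega

/-- A linear ramp of width 2δ replaces the step without changing it at distance at least δ from μ;
Weierstrass approximation then applies. -/
theorem exists_polynomial_near_stepQuotient {μ δ L ε : ℝ} (hμ : μ ∈ Set.Ioo (0 : ℝ) 1)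
    (hδ : 0 < δ) (hε : 0 < ε) : ∃ w : Polynomial ℝ, ∀ t ∈ Set.Icc (-L) L, δ ≤ |t - μ| →
      |stepQuotient μ t - w.eval t| ≤ ε := by
  let ramp : ℝ → ℝ := fun t => max 0 (min 1 ((t - μ + δ) / (2 * δ)))
  let f : ℝ → ℝ := fun t => (1 - ramp t) * (1 - min t μ)⁻¹ - ramp t * (max t μ)⁻¹
  have h1 : ∀ t, 1 - min t μ ≠ 0 := fun t => by
    have := min_le_right t μ
    linarith [hμ.2]
  have h2 : ∀ t, max t μ ≠ 0 := fun t => by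
    have := le_max_right t μ
    linarith [hμ.1]
  have h3 : Continuous fun t => (1 - min t μ)⁻¹ := Continuous.inv₀ (by fun_prop) h1
  have h4 : Continuous fun t => (max t μ)⁻¹ := Continuous.inv₀ (by fun_prop) h2
  have h5 : Continuous ramp := by fun_prop
  have hf : Continuous f := ((continuous_const.sub h5).mul h3).sub (h5.mul h4)
  obtain ⟨w, hw⟩ := exists_polynomial_near_of_continuousOn (-L) L f hf.continuousOn ε hε
  refine ⟨w, fun t ht hδt => ?_⟩
  have hr : ramp t = step μ t := by
    simp only [ramp, step]
    split_ifs with h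
    · rw [abs_of_nonpos (by linarith)] at hδt
      refine max_eq_left ((min_le_right _ _).trans ?_)
      exact div_nonpos_of_nonpos_of_nonneg (by linarith) (by linarith)
    · rw [abs_of_pos (by linarith)] at hδt
      rw [min_eq_left ((one_le_div (by linarith)).2 (by linarith))]
      simp
  have : f t = stepQuotient μ t := by rw [stepQuotient_eq]; simp only [f, hr]
  rw [← this, abs_sub_comm]
  exact (hw t ht).le

variable {X : Set ℂ} {m : ℕ} {H : Type*} [NormedAddCommGroup H] [InnerProductSpace ℂ H]
  [CompleteSpace H] (b : HilbertBasis (X × Fin m) ℂ H)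

/-- The polynomial `(t - t ^ 2) * w`. -/
noncomputable def vanishingPolynomial (w : Polynomial ℝ) : Polynomial ℝ :=
  (Polynomial.X - Polynomial.X * Polynomial.X) * w

omit [CompleteSpace H] in
theorem aeval_vanishingPolynomial (A : H →L[ℂ] H) (w : Polynomial ℝ) :
    Polynomial.aeval A (vanishingPolynomial w) = (A - A * A) * Polynomial.aeval A w := by
  simp [vanishingPolynomial]

/-- The difference is the trace of A - A² times a function of A of norm at most ε. -/
theorem norm_vertexTrace_sub_trace_le {A : H →L[ℂ] H} (hA : IsSelfAdjoint A) {L M μ δ ε : ℝ}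
    (hL : ‖A‖ ≤ L) (hM : HasTraceBound (A - A * A) M) (hμ : μ ∈ Set.Ioo (0 : ℝ) 1)
    (hε : 0 ≤ ε) (hgap : ∀ t ∈ spectrum ℝ A, δ ≤ |t - μ|) {w : Polynomial ℝ}
    (hw : ∀ t ∈ Set.Icc (-L) L, δ ≤ |t - μ| → |stepQuotient μ t - w.eval t| ≤ ε) :
    ‖vertexTrace b μ A - trace b (Polynomial.aeval A (vanishingPolynomial w))‖ ≤ M * ε := by
  have hc := continuousOn_step_spectrum hA hM.isTraceClass hμ
  have hM0 : 0 ≤ M := (norm_nonneg _).trans (hM.norm_trace_le b)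
  rw [vertexTrace, sub_flatten_eq hA hμ hc, aeval_vanishingPolynomial, ← cfc_polynomial w A hA,
    ← trace_sub b (hM.isTraceClass.mul_right _) (hM.isTraceClass.mul_right _), ← mul_sub,
    ← cfc_sub _ _ A (continuousOn_stepQuotient hμ hc) (by fun_prop)]
  refine ((hM.mul_right _).norm_trace_le b).trans (mul_le_mul_of_nonneg_left ?_ hM0)
  refine norm_cfc_le hε fun t ht => hw t ?_ (hgap t ht)
  have h1 := (spectrum.norm_le_norm_mul_of_mem ht).trans
    (mul_le_mul_of_nonneg_left ContinuousLinearMap.norm_id_le (norm_nonneg A))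
  rw [mul_one, Real.norm_eq_abs] at h1
  exact abs_le.1 (h1.trans hL)

end Approximation

/-! ### Integrality from a pair of distant half fluxes -/

section Integrality

open scoped ENNReal

variable {X : Set ℂ} {m : ℕ} {H : Type*} [NormedAddCommGroup H] [InnerProductSpace ℂ H]
  [CompleteSpace H] {b : HilbertBasis (X × Fin m) ℂ H} {P : H →L[ℂ] H}

theorem trivialOnBall_fluxSign (p : ℂ) (x : X) :
    TrivialOnBall (fluxSign (halfAngle p)) x (‖(x : ℂ) - p‖ / 8) :=
  (isHalfAngle_halfAngle p).locally_trivial x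

theorem aeval_vanishingPolynomial_eq_zero (hP : IsStarProjection P) (w : Polynomial ℝ) :
    Polynomial.aeval P (vanishingPolynomial w) = 0 := by
  rw [aeval_vanishingPolynomial, hP.isIdempotentElem.eq, sub_self, zero_mul]

theorem expWeight_neg_le {c d e : ℝ} (hc : 0 < c) (h : e / 2 ≤ d) :
    expWeight (-(c * (d / 8))) ≤ ENNReal.ofReal (Real.exp (-(c / 16) * e)) :=
  expWeight_mono (by nlinarith)

/-- Row i of Q - Q² is exponentially small in the distance to the nearer flux. Sums of such
exponentials are bounded independently of their centres, so the pair may be pulled apart with M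
fixed. -/
theorem exists_uniform_hasTraceBound (hX : BoundedDensity X) {c : ℝ} {K : ℝ≥0∞} (hc : 0 < c)
    (hK : K ≠ ∞) (hrow : RowBound b c K P) (hP : IsStarProjection P) :
    ∃ M : ℝ, ∀ (p q : ℂ) σ Q, IsSignOperator b P σ Q →
      (∀ x, TrivialOnBall σ x (min (‖(x : ℂ) - p‖ / 8) (‖(x : ℂ) - q‖ / 8))) →
      HasTraceBound (Q - Q * Q) M := by
  have := hX.countable
  obtain ⟨C, hC, h1, -⟩ := exists_local_bounds hc hK hrow _ (aeval_vanishingPolynomial_eq_zero hP 1)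
  obtain ⟨K', hK', hsum⟩ := hX.exists_tsum_exp_le' m (c := c / 16) (by positivity)
  have hfin : C * (K' + K') ≠ ∞ := by finiteness
  refine ⟨(C * (K' + K')).toReal, fun p q σ Q hQ ht => ?_⟩
  refine hasTraceBound_of_tsum_enorm_entry_le b ENNReal.toReal_nonneg ?_
  rw [ENNReal.ofReal_toReal hfin]
  have h2 : Q - Q * Q = Polynomial.aeval Q (vanishingPolynomial 1) := by
    rw [aeval_vanishingPolynomial]; simp
  rw [h2]
  refine (ENNReal.tsum_le_tsum fun i => h1 σ Q hQ i _ (ht i.1)).trans ?_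
  rw [ENNReal.tsum_mul_left]
  refine mul_le_mul_right ((ENNReal.tsum_le_tsum fun i => ?_).trans
    (ENNReal.tsum_add.trans_le (add_le_add (hsum p) (hsum q)))) _
  rcases min_choice (‖(i.1 : ℂ) - p‖ / 8) (‖(i.1 : ℂ) - q‖ / 8) with h | h
  · rw [h]
    exact (expWeight_neg_le hc (by linarith [norm_nonneg ((i.1 : ℂ) - p)])).trans le_self_add
  · rw [h]
    exact (expWeight_neg_le hc (by linarith [norm_nonneg ((i.1 : ℂ) - q)])).trans le_add_self

/-- For a function vanishing at `0` and `1`, the traces over two distant half fluxes add up. -/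
theorem exists_norm_trace_sub_le (hX : BoundedDensity X) {c : ℝ} {K : ℝ≥0∞} (hc : 0 < c)
    (hK : K ≠ ∞) (hrow : RowBound b c K P) (hP : IsStarProjection P) (w : Polynomial ℝ) :
    ∃ C : ℝ, ∀ (n : ℕ) (A B D : H →L[ℂ] H),
      IsSignOperator b P (fluxSign (halfAngle 0)) A →
      IsSignOperator b P (fluxSign (halfAngle (n : ℂ))) B →
      IsSignOperator b P (fun x y => fluxSign (halfAngle 0) x y * fluxSign (halfAngle (n : ℂ)) x y) D →
      IsTraceClass (A - A * A) → IsTraceClass (B - B * B) → IsTraceClass (D - D * D) →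
      ‖trace b (Polynomial.aeval D (vanishingPolynomial w))
          - trace b (Polynomial.aeval A (vanishingPolynomial w))
          - trace b (Polynomial.aeval B (vanishingPolynomial w))‖ ≤ C * Real.exp (-(c / 32) * n) := by
  set h := vanishingPolynomial w with hh
  obtain ⟨C, hC, h1, h2⟩ := exists_local_bounds hc hK hrow h (aeval_vanishingPolynomial_eq_zero hP w)
  obtain ⟨K', hK', hsum⟩ := hX.exists_tsum_exp_le' m (c := c / 16) (by positivity)
  refine ⟨(2 * C * K').toReal, fun n A B D hA hB hD hAT hBT hDT => ?_⟩
  have hD' : IsSignOperator b P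
      (fun x y => fluxSign (halfAngle (n : ℂ)) x y * fluxSign (halfAngle 0) x y) D := fun i j => by
    rw [hD i j]
    beta_reduce
    rw [mul_comm (fluxSign (halfAngle 0) _ _)]
  have htc : ∀ A : H →L[ℂ] H, IsTraceClass (A - A * A) → IsTraceClass (Polynomial.aeval A h) :=
    fun A hA => by rw [hh, aeval_vanishingPolynomial]; exact hA.mul_right _
  have hentry : ∀ σ Q, IsSignOperator b P σ Q → ∀ (i : X × Fin m) ρ, TrivialOnBall σ i.1 ρ →
      ‖entry b (Polynomial.aeval Q h) i i‖ₑ ≤ C * expWeight (-(c * ρ)) :=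
    fun σ Q hQ i ρ ht => (ENNReal.le_tsum i).trans (h1 σ Q hQ i ρ ht)
  have hbound : ∀ i : X × Fin m, ‖entry b (Polynomial.aeval D h - Polynomial.aeval A h
      - Polynomial.aeval B h) i i‖ₑ ≤ 2 * C * (expWeight (-(c / 32) * n) *
        ENNReal.ofReal (Real.exp (-(c / 16) * ‖(i.1 : ℂ) - 0‖))) := fun i => by
    -- Hence the more distant flux is at distance d ≥ n / 2. Half of the exponent c d / 8 yields the
    -- decay in n, the other half the decay in |x|.
    have hn : (n : ℝ) ≤ ‖(i.1 : ℂ) - 0‖ + ‖(i.1 : ℂ) - n‖ := by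
      have := norm_sub_le ((i.1 : ℂ) - 0) ((i.1 : ℂ) - n)
      rw [sub_sub_sub_cancel_left, sub_zero, Complex.norm_natCast] at this
      exact this
    have hfin : ∀ d : ℝ, ‖(i.1 : ℂ) - 0‖ ≤ d → ‖(i.1 : ℂ) - n‖ ≤ d →
        C * expWeight (-(c * (d / 8))) + C * expWeight (-(c * (d / 8))) ≤
        2 * C * (expWeight (-(c / 32) * n) *
        ENNReal.ofReal (Real.exp (-(c / 16) * ‖(i.1 : ℂ) - 0‖))) := fun d hd hd' => by
      rw [← two_mul, ← mul_assoc]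
      refine mul_le_mul_right ?_ _
      change _ ≤ _ * expWeight _
      rw [← expWeight_add]
      refine expWeight_mono ?_
      nlinarith
    rw [entry_sub, entry_sub]
    -- Near 0 the pair D looks like A up to gauge and B looks like P; near n the roles of A and B
    -- are exchanged.
    rcases le_total ‖(i.1 : ℂ) - 0‖ ‖(i.1 : ℂ) - n‖ with hle | hle
    · refine le_trans ?_ (hfin _ hle le_rfl)
      exact enorm_sub_le.trans (add_le_add
        (h2 _ _ A D hA hD i _ (trivialOnBall_fluxSign _ _))
        (hentry _ _ hB i _ (trivialOnBall_fluxSign _ _)))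
    · refine le_trans ?_ (hfin _ le_rfl hle)
      rw [sub_right_comm]
      exact enorm_sub_le.trans (add_le_add
        (h2 _ _ B D hB hD' i _ (trivialOnBall_fluxSign _ _))
        (hentry _ _ hA i _ (trivialOnBall_fluxSign _ _)))
  rw [← trace_sub b (htc D hDT) (htc A hAT), ← trace_sub b ((htc D hDT).sub (htc A hAT)) (htc B hBT)]
  have h3 : ‖trace b (Polynomial.aeval D h - Polynomial.aeval A h - Polynomial.aeval B h)‖ₑ
      ≤ 2 * C * K' * expWeight (-(c / 32) * n) := by
    refine enorm_tsum_le_tsum_enorm.trans ((ENNReal.tsum_le_tsum hbound).trans ?_)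
    rw [ENNReal.tsum_mul_left, ENNReal.tsum_mul_left, mul_assoc (2 * C), mul_comm K']
    exact mul_le_mul_right (mul_le_mul_right (hsum 0) _) _
  have h4 := ENNReal.toReal_mono (by have := expWeight_ne_top (-(c / 32) * n); finiteness) h3
  rw [ENNReal.toReal_mul, expWeight, ENNReal.toReal_ofReal (Real.exp_pos _).le] at h4
  simpa using h4

theorem exists_int_eq_of_approx {z : ℂ} (h : ∀ η > 0, ∃ k : ℤ, ‖z - k‖ < η) : ∃ k : ℤ, z = k := by
  obtain ⟨k, hk⟩ := h (1 / 2) (by norm_num)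
  refine ⟨k, sub_eq_zero.1 (norm_le_zero_iff.1 (le_of_forall_gt fun η hη => ?_))⟩
  obtain ⟨l, hl⟩ := h (min η (1 / 2)) (lt_min hη (by norm_num))
  have hkl : k = l := by
    have h1 : ‖((k - l : ℤ) : ℂ)‖ < 1 := by
      have h2 : ((k - l : ℤ) : ℂ) = (z - l) - (z - k) := by push_cast; ring
      rw [h2]
      have := norm_sub_le (z - l) (z - k)
      linarith [hl.trans_le (min_le_right _ _)]
    rw [Complex.norm_intCast] at h1
    have h3 : |k - l| < 1 := by exact_mod_cast h1
    have := Int.abs_lt_one_iff.1 h3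
    omega
  rw [hkl]
  exact hl.trans_le (min_le_left _ _)

theorem vertexTrace_projection (hP : IsStarProjection P) {μ : ℝ} (hμ : μ ∈ Set.Ioo (0 : ℝ) 1) :
    vertexTrace b μ P = 0 := by
  have h0 : P - P * P = 0 := by rw [hP.isIdempotentElem.eq, sub_self]
  have hc := continuousOn_step_spectrum hP.isSelfAdjoint (h0 ▸ isTraceClass_zero) hμ
  rw [vertexTrace, sub_flatten_eq hP.isSelfAdjoint hμ hc, h0, zero_mul]
  simp [trace, entry]

theorem card_union_spectrum_le {A B D : H →L[ℂ] H} (hA : IsSelfAdjoint A) (hB : IsSelfAdjoint B)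
    (hD : IsSelfAdjoint D) {M : ℝ} (hMA : HasTraceBound (A - A * A) M)
    (hMB : HasTraceBound (B - B * B) M) (hMD : HasTraceBound (D - D * D) M) :
    ∃ F : Finset ℝ, F.card ≤ 32 * M ∧ ∀ t ∈ Set.Icc (1 / 4 : ℝ) (3 / 4),
      t ∈ spectrum ℝ A ∨ t ∈ spectrum ℝ B ∨ t ∈ spectrum ℝ D → t ∈ F := by
  classical
  -- For a = 1/4 each spectral point costs a (1 - a) / 2 = 3/32 of the trace norm.
  have h : ∀ A : H →L[ℂ] H, IsSelfAdjoint A → HasTraceBound (A - A * A) M →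
      ∃ F : Finset ℝ, (F.card : ℝ) ≤ 32 / 3 * M ∧
        ∀ t ∈ Set.Icc (1 / 4 : ℝ) (3 / 4), t ∈ spectrum ℝ A → t ∈ F := fun A hA hM => by
    have hfin := spectrum_inter_finite hA hM.isTraceClass (a := 1 / 4) (by norm_num) (by norm_num)
    refine ⟨hfin.toFinset, ?_, fun t ht htA => hfin.mem_toFinset.2 ⟨htA, ?_⟩⟩
    · have := card_spectrum_le hA hM (a := 1 / 4) (by norm_num) (by norm_num) hfin.toFinset
        fun t ht => hfin.mem_toFinset.1 ht
      linarith
    · exact ⟨ht.1, by linarith [ht.2]⟩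
  obtain ⟨F, hF, h1⟩ := h A hA hMA
  obtain ⟨G, hG, h2⟩ := h B hB hMB
  obtain ⟨I, hI, h3⟩ := h D hD hMD
  refine ⟨F ∪ (G ∪ I), ?_, fun t ht => ?_⟩
  · have h4 : ((F ∪ (G ∪ I)).card : ℝ) ≤ F.card + (G.card + I.card) := by
      exact_mod_cast (Finset.card_union_le _ _).trans
        (Nat.add_le_add_left (Finset.card_union_le _ _) _)
    linarith
  · rintro (h | h | h)
    · exact Finset.mem_union_left _ (h1 t ht h)
    · exact Finset.mem_union_right _ (Finset.mem_union_left _ (h2 t ht h))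
    · exact Finset.mem_union_right _ (Finset.mem_union_right _ (h3 t ht h))

/-- Far away the two sign systems agree up to gauge, so their product is a gauge transformation: two
half fluxes make a full flux, which is invisible. -/
theorem fluxSign_pair_asympEquiv (p q : ℂ) : AsympEquiv (fun _ _ : X => (1 : ℤˣ))
    (fun x y => fluxSign (halfAngle p) x y * fluxSign (halfAngle q) x y) := by
  obtain ⟨g, κ, R, hκ, h⟩ := (isHalfAngle_halfAngle (X := X) p).asympEquiv
    (isHalfAngle_halfAngle (X := X) q)
  refine ⟨g, κ, R, hκ, fun x y hne => h x y fun heq => hne ?_⟩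
  beta_reduce
  rw [heq, mul_left_comm, Int.units_mul_self]

/-- The trace over the vertex states of a half flux is an integer. -/
theorem exists_int_vertexTrace (hX : BoundedDensity X) {c : ℝ} {K : ℝ≥0∞} (hc : 0 < c)
    (hK : K ≠ ∞) (hrow : RowBound b c K P) (hP : IsStarProjection P) {Θ : H → H}
    (hΘ : IsKramers Θ) (hcomm : ∀ σ Q, IsSignOperator b P σ Q → CommutesWith Θ Q) :
    ∃ A : H →L[ℂ] H, IsSignOperator b P (fluxSign (halfAngle 0)) A ∧ IsSelfAdjoint A ∧
      IsTraceClass (A - A * A) ∧ ∃ k : ℤ, vertexTrace b (1 / 2) A = k := by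
  obtain ⟨A, hA, hAs, hAn⟩ := exists_signOperator (σ := fluxSign (halfAngle (0 : ℂ))) hc hK hrow
    hP.isSelfAdjoint (fluxSign_symm _)
  have hB' : ∀ n : ℕ, ∃ B, IsSignOperator b P (fluxSign (halfAngle (n : ℂ))) B ∧ IsSelfAdjoint B ∧
      ‖B‖ ≤ 2 * K.toReal := fun n =>
    exists_signOperator hc hK hrow hP.isSelfAdjoint (fluxSign_symm _)
  have hD' : ∀ n : ℕ, ∃ D, IsSignOperator b P (fun x y => fluxSign (halfAngle 0) x y *
      fluxSign (halfAngle (n : ℂ)) x y) D ∧ IsSelfAdjoint D ∧ ‖D‖ ≤ 2 * K.toReal := fun n =>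
    exists_signOperator hc hK hrow hP.isSelfAdjoint fun x y => by
      rw [fluxSign_symm _ x y, fluxSign_symm _ x y]
  choose B hB hBs hBn using hB'
  choose D hD hDs hDn using hD'
  obtain ⟨M, hM⟩ := exists_uniform_hasTraceBound hX hc hK hrow hP
  have hMA : HasTraceBound (A - A * A) M := hM 0 0 _ A hA fun x => by
    rw [min_self]; exact trivialOnBall_fluxSign 0 x
  have hMB : ∀ n, HasTraceBound (B n - B n * B n) M := fun n => hM n n _ (B n) (hB n) fun x => by
    rw [min_self]; exact trivialOnBall_fluxSign _ x
  have hMD : ∀ n : ℕ, HasTraceBound (D n - D n * D n) M := fun n => hM 0 n _ (D n) (hD n) fun x =>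
    (trivialOnBall_fluxSign 0 x).mul (trivialOnBall_fluxSign _ x)
  have hM0 : 0 ≤ M := (norm_nonneg _).trans (hMA.norm_trace_le b)
  refine ⟨A, hA, hAs, hMA.isTraceClass, exists_int_eq_of_approx fun η hη => ?_⟩
  -- The number N of candidate chemical potentials exceeds the number of spectral points of the
  -- three operators in [1/4, 3/4], whatever n is.
  obtain ⟨N, hN⟩ := exists_nat_gt (32 * M)
  have hN0 : (0 : ℝ) < N := by linarith
  let μ : ℕ → ℝ := fun j => 1 / 4 + (2 * j + 1) / (4 * N)
  have hμ : ∀ j < N, 1 / 4 + 1 / (4 * N : ℝ) ≤ μ j ∧ μ j + 1 / (4 * N : ℝ) ≤ 3 / 4 := fun j hj => by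
    have h1 : (j : ℝ) + 1 ≤ N := by exact_mod_cast hj
    constructor
    · simp only [μ]
      gcongr
      linarith [(Nat.cast_nonneg j : (0 : ℝ) ≤ j)]
    · simp only [μ]
      rw [add_assoc, ← add_div]
      have : (2 * (j : ℝ) + 1 + 1) / (4 * N) ≤ 1 / 2 := by
        rw [div_le_iff₀ (by positivity)]; linarith
      linarith
  have hδ : (0 : ℝ) < 1 / (4 * N) := by positivity
  have hμ' : ∀ j < N, μ j ∈ Set.Ioo (0 : ℝ) 1 := fun j hj => by
    have := hμ j hj
    constructor <;> linarith
  set ε := η / (3 * M + 1) with hε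
  have hε0 : 0 < ε := by positivity
  -- One polynomial per candidate, fixed before n: the error constants are then finitely many, and a
  -- single n serves all of them although the good candidate depends on n.
  have hw' : ∀ j, ∃ w : Polynomial ℝ, j < N → ∀ t ∈ Set.Icc (-(2 * K.toReal)) (2 * K.toReal),
      1 / (4 * N : ℝ) ≤ |t - μ j| → |stepQuotient (μ j) t - w.eval t| ≤ ε := fun j => by
    by_cases hj : j < N
    · obtain ⟨w, hw⟩ := exists_polynomial_near_stepQuotient (L := 2 * K.toReal) (hμ' j hj) hδ hε0
      exact ⟨w, fun _ => hw⟩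
    · exact ⟨0, fun h => absurd h hj⟩
  choose w hw using hw'
  have hC' := fun j => exists_norm_trace_sub_le hX hc hK hrow hP (w j)
  choose C hC using hC'
  obtain ⟨n, hn⟩ : ∃ n : ℕ, ∀ j ∈ Finset.range N, C j * Real.exp (-(c / 32) * n) < ε := by
    have : ∀ᶠ n : ℕ in Filter.atTop, ∀ j ∈ Finset.range N, C j * Real.exp (-(c / 32) * n) < ε := by
      rw [Filter.eventually_all_finset]
      intro j _
      have h1 : Filter.Tendsto (fun n : ℕ => C j * Real.exp (-(c / 32) * n)) Filter.atTop
          (nhds (C j * 0)) := by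
        refine Filter.Tendsto.const_mul _ (Real.tendsto_exp_atBot.comp ?_)
        exact tendsto_natCast_atTop_atTop.const_mul_atTop_of_neg (by linarith)
      rw [mul_zero] at h1
      exact h1.eventually_lt_const hε0
    exact this.exists
  obtain ⟨F, hF, hFmem⟩ := card_union_spectrum_le hAs (hBs n) (hDs n) hMA (hMB n) (hMD n)
  obtain ⟨j, hj, hgap⟩ := exists_gap F (N := N) (by exact_mod_cast hF.trans_lt hN)
  have hgap' : ∀ t, (t ∈ spectrum ℝ A ∨ t ∈ spectrum ℝ (B n) ∨ t ∈ spectrum ℝ (D n)) →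
      1 / (4 * N : ℝ) ≤ |t - μ j| := fun t ht => by
    by_cases h : t ∈ Set.Icc (1 / 4 : ℝ) (3 / 4)
    · exact hgap t (hFmem t h ht)
    · by_contra! hlt
      rw [abs_lt] at hlt
      have := hμ j hj
      exact h ⟨by linarith, by linarith⟩
  have eA := norm_vertexTrace_sub_trace_le b hAs hAn hMA (hμ' j hj) hε0.le
    (fun t ht => hgap' t (.inl ht)) (hw j hj)
  have eB := norm_vertexTrace_sub_trace_le b (hBs n) (hBn n) (hMB n) (hμ' j hj) hε0.le
    (fun t ht => hgap' t (.inr (.inl ht))) (hw j hj)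
  have eD := norm_vertexTrace_sub_trace_le b (hDs n) (hDn n) (hMD n) (hμ' j hj) hε0.le
    (fun t ht => hgap' t (.inr (.inr ht))) (hw j hj)
  have eT := (hC j n A (B n) (D n) hA (hB n) (hD n) hMA.isTraceClass (hMB n).isTraceClass
    (hMD n).isTraceClass).trans_lt (hn j (Finset.mem_range.2 hj))
  have hhalf : (1 / 2 : ℝ) ∈ Set.Ioo (0 : ℝ) 1 := by constructor <;> norm_num
  have hmain : ∀ σ σ' Q Q', IsSignOperator b P σ Q → IsSignOperator b P σ' Q' → IsSelfAdjoint Q →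
      IsSelfAdjoint Q' → (∀ x y, σ y x = σ x y) → (∀ x, σ x x = 1) → (∀ x, σ' x x = 1) →
      AsympEquiv σ σ' → IsTraceClass (Q - Q * Q) → ∃ k : ℤ,
        vertexTrace b (μ j) Q' = vertexTrace b (1 / 2) Q + ((2 * k : ℤ) : ℂ) :=
    fun σ σ' Q Q' h1 h2 h3 h4 h5 h6 h7 h8 h9 =>
      (vertexTrace_sub_even_of_asympEquiv hX hc hK hrow hP.isSelfAdjoint hΘ hcomm h1 h2 h3 h4 h5 h6
        h7 h8 h9).2 _ hhalf _ (hμ' j hj)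
  have hself : IsHalfAngle (0 : ℂ) (halfAngle 0 : X → ℂ) := isHalfAngle_halfAngle 0
  -- Comparing A with itself only moves the chemical potential from 1/2 to μ j.
  obtain ⟨k₁, hk₁⟩ := hmain _ _ A A hA hA hAs hAs (fluxSign_symm _) (fluxSign_self _)
    (fluxSign_self _) (hself.asympEquiv hself) hMA.isTraceClass
  obtain ⟨k₂, hk₂⟩ := hmain _ _ A (B n) hA (hB n) hAs (hBs n) (fluxSign_symm _) (fluxSign_self _)
    (fluxSign_self _) (hself.asympEquiv (isHalfAngle_halfAngle _)) hMA.isTraceClass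
  obtain ⟨k₃, hk₃⟩ := hmain _ _ P (D n) isSignOperator_one (hD n) hP.isSelfAdjoint (hDs n)
    (fun _ _ => rfl) (fun _ => rfl) (fun x => by rw [fluxSign_self, fluxSign_self, one_mul])
    (fluxSign_pair_asympEquiv _ _)
    (by rw [hP.isIdempotentElem.eq, sub_self]; exact isTraceClass_zero)
  rw [vertexTrace_projection hP hhalf, zero_add] at hk₃
  rw [hk₁] at eA
  rw [hk₂] at eB
  rw [hk₃] at eD
  refine ⟨k₃ - k₁ - k₂, ?_⟩
  set r := vertexTrace b (1 / 2) A
  set tA := trace b (Polynomial.aeval A (vanishingPolynomial (w j)))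
  set tB := trace b (Polynomial.aeval (B n) (vanishingPolynomial (w j)))
  set tD := trace b (Polynomial.aeval (D n) (vanishingPolynomial (w j)))
  -- All terms on the right are errors: three from the polynomial approximation, at most M ε each,
  -- and one from additivity, below ε.
  have hsplit : 2 * (r - ((k₃ - k₁ - k₂ : ℤ) : ℂ)) = (r + ((2 * k₁ : ℤ) : ℂ) - tA) +
      (r + ((2 * k₂ : ℤ) : ℂ) - tB) - (((2 * k₃ : ℤ) : ℂ) - tD) - (tD - tA - tB) := by
    push_cast; ring
  have hnorm : 2 * ‖r - ((k₃ - k₁ - k₂ : ℤ) : ℂ)‖ < 3 * (M * ε) + ε := by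
    have h1 : 2 * ‖r - ((k₃ - k₁ - k₂ : ℤ) : ℂ)‖ = ‖2 * (r - ((k₃ - k₁ - k₂ : ℤ) : ℂ))‖ := by
      rw [norm_mul]; simp
    rw [h1, hsplit]
    have h2 := norm_sub_le ((r + ((2 * k₁ : ℤ) : ℂ) - tA) + (r + ((2 * k₂ : ℤ) : ℂ) - tB)
      - (((2 * k₃ : ℤ) : ℂ) - tD)) (tD - tA - tB)
    have h3 := norm_sub_le ((r + ((2 * k₁ : ℤ) : ℂ) - tA) + (r + ((2 * k₂ : ℤ) : ℂ) - tB))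
      (((2 * k₃ : ℤ) : ℂ) - tD)
    have h4 := norm_add_le (r + ((2 * k₁ : ℤ) : ℂ) - tA) (r + ((2 * k₂ : ℤ) : ℂ) - tB)
    linarith
  have hεη : 3 * (M * ε) + ε = η := by
    rw [hε]; field_simp
  have := norm_nonneg (r - ((k₃ - k₁ - k₂ : ℤ) : ℂ))
  linarith

end Integrality

/-! ### Reduction to the half flux at the origin, and the theorem -/

section Main

open scoped ENNReal

variable {X : Set ℂ}

/-- Every half flux is, up to a gauge transformation by phases, given by signs which are
asymptotically equivalent to the signs of a half flux at the origin. -/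
theorem exists_sign_of_halfFlux {p : ℂ} {s : X → X → ℂ}
    (hs : IsHalfFluxPhase p s ∨ IsTopologicalSign p s) :
    ∃ (φ : X → ℂ) (σ : X → X → ℤˣ), (∀ x, ‖φ x‖ = 1) ∧ (∀ x y, σ y x = σ x y) ∧ (∀ x, σ x x = 1) ∧
      (∀ x y, s x y = φ x * conj (φ y) * (σ x y : ℤ)) ∧ AsympEquiv (fluxSign (halfAngle 0)) σ := by
  have h0 : IsHalfAngle (0 : ℂ) (halfAngle 0 : X → ℂ) := isHalfAngle_halfAngle 0
  rcases hs with hs | ⟨θ₀, θ₁, θ₂, c, hc, hs⟩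
  · obtain ⟨φ, σ, h1, h2, h3, h4, h5⟩ := hs.exists_sign
    exact ⟨φ, σ, h1, h2, h3, h4, (h0.asympEquiv (isHalfAngle_halfAngle p)).trans h5⟩
  · obtain ⟨h, hh, heq⟩ := asympEquiv_sectorSign hc
    refine ⟨fun _ => 1, sectorSign c, by simp, fun x y => by simp [sectorSign, eq_comm],
      fun x => by simp [sectorSign], fun x y => ?_, (h0.asympEquiv hh).trans heq⟩
    rw [hs, sectorSign]
    split_ifs <;> simp

end Main

end HalfFlux

theorem mainTheorem4 {H : Type*} [NormedAddCommGroup H] [InnerProductSpace ℂ H] [CompleteSpace H]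
    (X : Set ℂ) (hX : HalfFlux.BoundedDensity X) (m : ℕ)
    (b : HilbertBasis (X × Fin m) ℂ H)
    (P : H →L[ℂ] H) (hP : IsStarProjection P) (hdecay : HalfFlux.ExpDecay b P)
    (T : X → Matrix (Fin m) (Fin m) ℂ) (hT : HalfFlux.IsTimeReversal T)
    (hPT : HalfFlux.TimeReversalSymmetric b T P) :
    ∃ ν : ZMod 2, ∀ (p : ℂ) (s : X → X → ℂ),
      (HalfFlux.IsHalfFluxPhase p s ∨ HalfFlux.IsTopologicalSign p s) →
      ∃ Q : H →L[ℂ] H,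
        HalfFlux.IsPeierls b s P Q ∧ IsSelfAdjoint Q ∧
        ∀ μ ∈ Set.Ioo (0 : ℝ) 1,
          ContinuousOn (HalfFlux.step μ) (spectrum ℝ Q) ∧
          HalfFlux.IsTraceClass (Q - HalfFlux.flatten μ Q) ∧
          ∃ k : ℤ, HalfFlux.vertexTrace b μ Q = (k : ℂ) ∧ (k : ZMod 2) = ν := by
  obtain ⟨c, K, hc, hK, hrow⟩ := HalfFlux.exists_rowBound hX hdecay
  obtain ⟨Θ, hΘ, hcoord⟩ := HalfFlux.exists_timeReversal b hT
  have hcomm : ∀ σ Q, HalfFlux.IsSignOperator b P σ Q → HalfFlux.CommutesWith Θ Q :=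
    fun σ Q hQ => HalfFlux.commutesWith_of_timeReversalSymmetric b hΘ hcoord
      (hQ.timeReversalSymmetric hPT)
  -- The half flux at the origin is the reference: ν is the parity of its vertex trace at μ = 1/2.
  obtain ⟨A, hA, hAs, hAT, k₀, hk₀⟩ := HalfFlux.exists_int_vertexTrace hX hc hK hrow hP hΘ hcomm
  refine ⟨(k₀ : ZMod 2), fun p s hs => ?_⟩
  obtain ⟨φ, σ, hφ, hσ, hσ1, hsφ, heq⟩ := HalfFlux.exists_sign_of_halfFlux hs
  obtain ⟨B, hB, hBs, -⟩ := HalfFlux.exists_signOperator hc hK hrow hP.isSelfAdjoint hσ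
  obtain ⟨hBT, hBv⟩ := HalfFlux.vertexTrace_sub_even_of_asympEquiv hX hc hK hrow hP.isSelfAdjoint hΘ
    hcomm hA hB hAs hBs (HalfFlux.fluxSign_symm _) (HalfFlux.fluxSign_self _) hσ1 heq hAT
  -- The symmetric operator B built from signs has been compared with the reference; the phases are
  -- restored by a unitary gauge transformation.
  obtain ⟨U, hU⟩ := HalfFlux.exists_unitary b (φ := fun i => φ i.1) fun i => hφ i.1
  obtain ⟨hQs, hQT, hQv⟩ := HalfFlux.vertexTrace_eq_of_gauge b (φ := fun i => φ i.1)
    (fun i => hφ i.1) hBs hBT (hU B)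
  refine ⟨_, fun i j => ?_, hQs, fun μ hμ => ⟨HalfFlux.continuousOn_step_spectrum hQs hQT hμ,
    HalfFlux.isTraceClass_sub_flatten hQs hQT hμ, ?_⟩⟩
  · rw [hU, hB, hsφ]; ring
  · obtain ⟨k, hk⟩ := hBv (1 / 2) (by constructor <;> norm_num) μ hμ
    refine ⟨k₀ + 2 * k, by rw [hQv μ hμ, hk, hk₀]; push_cast; ring, ?_⟩
    have h2 : (2 : ZMod 2) = 0 := rfl
    push_cast
    rw [h2, zero_mul, add_zero]
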